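/- **Theorem (Non-asymptotic performance of online SGD for linear regression with dependent data).** *Setting.* For a $\sigma$-field $\mathcal F$ and a constant $K>0$ write $\|Z|\mathcal F\|_{\Psi_2}\le K$ for a real random variable $Z$ if $\mathbb E[\exp(|Z/K|^2)\,|\,\mathcal F]\le 2$ a.s., and for a random vector $Z\in\mathbb R^d$ if $\|u^\top Z|\mathcal F\|_{\Psi_2}\le K$ for every $\mathcal F$-measurable random unit vector $u$. Let $d\ge 1$, $\beta^*\in\mathbb R^d$, and $Y_t=X_t^\top\beta^*+\xi_t$, $t=0,1,2,\dots$, with random $X_t\in\mathbb R^d$, $\xi_t\in\mathbb R$. Put $\mathcal F_t=\sigma(Y_{t-1},X_{t-1},\dots,Y_0,X_0)$ and $\mathcal F_t^+=\sigma(X_t,Y_{t-1},X_{t-1},\dots,Y_0,X_0)$. Assume that for all $t$, a.s., $$\mathbb E[X_t|\mathcal F_t]=0,\quad \|X_t|\mathcal F_t\|_{\Psi_2}^2\le\lambda_{\max},\quad \mathbb E[X_tX_t^\top|\mathcal F_t]\succeq\lambda_{\min}I_d,\quad \mathbb E[\xi_t|\mathcal F_t^+]=0,\quad \|\xi_t|\mathcal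 F_t^+\|_{\Psi_2}\le\sigma ,$$ with constants $\lambda_{\min},\lambda_{\max},\sigma>0$. For an arbitrary deterministic $\beta_0\in\mathbb R^d$ and deterministic stepsizes $\eta_t$ let $\beta_{t+1}=\beta_t-\eta_t(X_t^\top\beta_t-Y_t)X_t$. Write $\kappa=\lambda_{\max}/\lambda_{\min}$. 1. **Constant stepsize.** There are absolute constants $c_1,C_1>0$ such that, whenever $\eta_t\equiv\eta$ with $0<\eta\le\lambda_{\min}/(d\lambda_{\max}^2)$, for each $t\ge 0$, with probability at least $1-(t+1)e^{-c_1d}$, $$\|\beta_{t+1}-\beta^*\|^2\le 5(1-\eta\lambda_{\min}/2)^{t+1}\|\beta_0-\beta^*\|^2+5\kappa\,\eta\sigma^2d .$$ In particular, for every integer $t_1\ge 0$ with $t_1\ge\frac{4}{\eta\lambda_{\min}}\log\big(\|\beta_0-\beta^*\|/(\sqrt{\eta d}\,\sigma)\big)$ (for $\beta_0=\beta^*$: every $t_1\ge0$), with probability at least $1-t_1e^{-c_1d}$, $\|\beta_{t_1}-\beta^*\|^2\le C_1\kappa\,\eta\sigma^2d$; and $C_1\kappa\,\eta\sigma^2d\le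 C_1\sigma^2/\lambda_{\max}$. 2. **Decaying stepsize.** Let $C_a\ge 2$, $C_b\ge 3C_a^2\kappa^2$, $t_1\ge 0$, let $\eta_t=\dfrac{C_a/\lambda_{\min}}{t-t_1+C_bd}$ for $t\ge t_1$ (the stepsizes before $t_1$ are arbitrary), and let $A=\{\|\beta_{t_1}-\beta^*\|^2\le\sigma^2/\lambda_{\max}\}$. For every $C_0>0$ there are $C,c>0$ depending only on $C_0$ such that for every non-decreasing sequence $\delta_t\ge 0$ with $\delta_t\le C_0t/C_b$ and every horizon $T\in\{t_1,t_1+1,\dots\}\cup\{+\infty\}$, conditionally on $A$ (so unconditionally if $A$ is almost sure), with probability at least $$1-Ce^{-cd}-\sum_{t_1\le l\le T}e^{-c(d+\delta_l)}$$ the following holds simultaneously for all integers $t$ with $t_1\le t\le T$: $$\|\beta_{t+1}-\beta^*\|^2\le C^*\,\frac1{\lambda_{\min}}\,\frac{\max\{d,\delta_{t+1}\}}{t+1-t_1+C_bd}\,\sigma^2,\qquad C^*=C\Big(C_a\kappa+\frac{C_b}{\kappa}\Big),$$ and the same bound holds with $C^*=2CC_a\kappa$ for those $t$ with $t+1-t_1+C_bd\ge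 C_b^2d/(C_a\kappa^2)$. (For $T=+\infty$ the claim is void if the series diverges; "conditionally on $A$ with probability at least $p$" means that $A$ and the bounds hold together with probability at least $p\,\mathbb P(A)$.) 3. **Logarithmic tail level.** There are absolute constants $C,c>0$ such that, with $C_a,C_b,t_1,\eta_t,A$ as in part 2, conditionally on $A$, with probability at least $1-Ce^{-cd}$, simultaneously for all integers $t\ge t_1$, $$\|\beta_t-\beta^*\|^2\le C^*\,\frac1{\lambda_{\min}}\,\frac{\max\{d,\log(t-t_1)\}}{t-t_1+C_bd}\,\sigma^2,\qquad C^*=C\Big(C_a\kappa+\frac{C_b}{\kappa}\Big)$$ (read $\max\{d,\log 0\}=d$), and the same bound holds with $C^*=2CC_a\kappa$ for those $t$ with $t-t_1+C_bd\ge C_b^2d/(C_a\kappa^2)$. -/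

import Mathlib

open MeasureTheory

noncomputable section

/-- The conditional Orlicz bound `‖Z | m‖_{Ψ₂} ≤ K` for a real random variable `Z` and a constant
`K > 0`: `E[exp(|Z / K|²) | m] ≤ 2` almost surely. Integrability is stated because the conditional
expectation of a non-integrable function is `0` by convention; for a nonnegative variable it is
part of having a conditional expectation bounded by `2`. -/
def CondPsi2Le {Ω : Type*} {m0 : MeasurableSpace Ω} (μ : Measure Ω) (m : MeasurableSpace Ω)
    (Z : Ω → ℝ) (K : ℝ) : Prop :=
  0 < K ∧ Integrable (fun ω => Real.exp (|Z ω / K| ^ 2)) μ ∧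
    ∀ᵐ ω ∂μ, (μ[fun ω' => Real.exp (|Z ω' / K| ^ 2) | m]) ω ≤ 2

/-- The conditional Orlicz bound `‖Z | m‖_{Ψ₂} ≤ K` for a random vector `Z`: the scalar bound holds
for `uᵀ Z`, for every `m`-measurable random direction `u` on the unit sphere. -/
def CondPsi2LeVec {Ω : Type*} {m0 : MeasurableSpace Ω} {d : ℕ} (μ : Measure Ω)
    (m : MeasurableSpace Ω) (Z : Ω → EuclideanSpace ℝ (Fin d)) (K : ℝ) : Prop :=
  ∀ u : Ω → EuclideanSpace ℝ (Fin d), Measurable[m] u → (∀ ω, ‖u ω‖ = 1) →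
    CondPsi2Le μ m (fun ω => inner ℝ (u ω) (Z ω)) K

/-- The responses `Y_t = X_tᵀ β* + ξ_t` of the linear model. -/
def response {Ω : Type*} {d : ℕ} (X : ℕ → Ω → EuclideanSpace ℝ (Fin d)) (ξ : ℕ → Ω → ℝ)
    (βstar : EuclideanSpace ℝ (Fin d)) (t : ℕ) (ω : Ω) : ℝ :=
  inner ℝ (X t ω) βstar + ξ t ω

/-- `ℱ_t = σ(Y_{t-1}, X_{t-1}, …, Y_0, X_0)`. -/
@[reducible] def pastSigma {Ω : Type*} {d : ℕ} (X : ℕ → Ω → EuclideanSpace ℝ (Fin d)) (Y : ℕ → Ω → ℝ)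
    (t : ℕ) : MeasurableSpace Ω :=
  ⨆ l : Fin t, (MeasurableSpace.comap (Y l) inferInstance ⊔
    MeasurableSpace.comap (X l) inferInstance)

/-- `ℱ_t⁺ = σ(X_t, Y_{t-1}, X_{t-1}, …, Y_0, X_0)`. -/
@[reducible] def pastSigmaPlus {Ω : Type*} {d : ℕ} (X : ℕ → Ω → EuclideanSpace ℝ (Fin d)) (Y : ℕ → Ω → ℝ)
    (t : ℕ) : MeasurableSpace Ω :=
  MeasurableSpace.comap (X t) inferInstance ⊔ pastSigma X Y t

/-- The conditional second moment matrix `E[Z Zᵀ | m]`. -/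
def condSecondMoment {Ω : Type*} {m0 : MeasurableSpace Ω} {d : ℕ} (μ : Measure Ω)
    (m : MeasurableSpace Ω) (Z : Ω → EuclideanSpace ℝ (Fin d)) (ω : Ω) :
    Matrix (Fin d) (Fin d) ℝ :=
  Matrix.of fun i j => (μ[fun ω' => Z ω' i * Z ω' j | m]) ω

/-- Covariates: conditionally centred, `‖X_t | ℱ_t‖²_{Ψ₂} ≤ λ_max`, and
`E[X_t X_tᵀ | ℱ_t] ⪰ λ_min I` almost surely with `λ_min > 0`. -/
structure CovariateAssumption {Ω : Type*} {m0 : MeasurableSpace Ω} {d : ℕ} (μ : Measure Ω)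
    (X : ℕ → Ω → EuclideanSpace ℝ (Fin d)) (Y : ℕ → Ω → ℝ) (lmin lmax : ℝ) : Prop where
  measurable : ∀ t, Measurable (X t)
  mean_zero : ∀ t, μ[X t | pastSigma X Y t] =ᵐ[μ] 0
  psi2_le : ∀ t, CondPsi2LeVec μ (pastSigma X Y t) (X t) (Real.sqrt lmax)
  lmin_pos : 0 < lmin
  second_moment : ∀ t, ∀ᵐ ω ∂μ,
    (condSecondMoment μ (pastSigma X Y t) (X t) ω - lmin • (1 : Matrix (Fin d) (Fin d) ℝ)).PosSemidef

/-- Noise: `E[ξ_t | ℱ_t⁺] = 0` and `‖ξ_t | ℱ_t⁺‖_{Ψ₂} ≤ σ`. -/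
structure NoiseAssumption {Ω : Type*} {m0 : MeasurableSpace Ω} {d : ℕ} (μ : Measure Ω)
    (X : ℕ → Ω → EuclideanSpace ℝ (Fin d)) (Y : ℕ → Ω → ℝ) (ξ : ℕ → Ω → ℝ) (σ : ℝ) : Prop where
  measurable : ∀ t, Measurable (ξ t)
  mean_zero : ∀ t, μ[ξ t | pastSigmaPlus X Y t] =ᵐ[μ] 0
  psi2_le : ∀ t, CondPsi2Le μ (pastSigmaPlus X Y t) (ξ t) σ

/-- The SGD iterates `β_{t+1} = β_t - η_t (X_tᵀ β_t - Y_t) X_t`, started at `β₀`. -/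
def sgd {Ω : Type*} {d : ℕ} (X : ℕ → Ω → EuclideanSpace ℝ (Fin d)) (Y : ℕ → Ω → ℝ) (η : ℕ → ℝ)
    (β₀ : EuclideanSpace ℝ (Fin d)) : ℕ → Ω → EuclideanSpace ℝ (Fin d)
  | 0, _ => β₀
  | t + 1, ω =>
      sgd X Y η β₀ t ω - (η t * (inner ℝ (X t ω) (sgd X Y η β₀ t ω) - Y t ω)) • X t ω

/-- The squared error `V` obeys the optimal rate with dimension `d`, tail level `D` (either `d` or
the larger tail parameter) and effective sample size `n`:
`V ≤ C* (1/λ_min) (D / n) σ²` with `C* = C (C_a λ_max/λ_min + C_b λ_min/λ_max)`, where the second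
summand of `C*` is the price of the initial error, and with `C* = 2 C C_a λ_max/λ_min` as soon as
the initial error is forgotten, i.e. `n ≥ C_b² d / (C_a (λ_max/λ_min)²)`. -/
def WithinRate (C Ca Cb lmin lmax σ d D n V : ℝ) : Prop :=
  V ≤ (C * (Ca * (lmax / lmin) + Cb * (lmin / lmax))) * (1 / lmin) * (D / n) * σ ^ 2 ∧
  (Cb ^ 2 * d ≤ Ca * (lmax / lmin) ^ 2 * n →
    V ≤ (2 * C * Ca * (lmax / lmin)) * (1 / lmin) * (D / n) * σ ^ 2)

end

/-! Write `V_t = ‖β_t - β*‖²`, `κ = L / l` for the ratio of the two covariate constants, and add the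
noise floor `s_t = κ η_t σ² D`, where `D ≥ d` is a tail level. The proof controls a high moment of
`W_t = V_t + s_t`, of order `p` about `D / 2^20`. Since `1 + u ≤ exp u`, one step multiplies `W ^ p`
by at most the exponential of `p` times the relative increment (`pow_norm_step_le`). The increment
is quadratic in the noise, so the noise is integrated out first, given the covariate
(`lintegral_exp_quadratic_le`). The covariate is integrated out next, given the past, on the event
`‖X_t‖² ≤ 32 L D` (`lintegral_exp_step_le`). The outcome, `lintegral_pow_step_le`, is a linear drift
for the `p`-th moment: it contracts at rate `ρ η l` and is fed by `s`.

Comparison with a deterministic envelope `w_t` obeying the corresponding scalar recursion keeps the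
truncated moment of `W_t / w_t` below the probability of the starting event
(`lintegral_envelope_le`). Markov's inequality then makes exceeding `θ w_t` cost `θ⁻¹ ^ p`, which is
exponentially small in `D` (`measure_envelope_lt_le`). The truncation fails with probability at most
`exp (-D)` at each time, by a net of lattice directions
(`CovariateAssumption.measure_norm_sq_gt_le`).

For a constant stepsize the envelope is a geometric term plus `4 s`, used once with `D = d`. For
decaying stepsizes the one-step bound needs `κ (D η L)² ≤ 1`, where `D` is the level at the final
time and `η` the stepsize at the start. One run over a long horizon would violate this, so the
argument looks at the first time `T` at which the bound fails and restarts the envelope at most a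
factor 4 earlier in effective sample size, where the bound still holds
(`measure_first_exceedance_le`). The initial error decays like the cube of the ratio of effective
sample sizes while the claim asks only for the square. The spare factor pays for `θ = 2`, so the
constants do not grow over restarts. Capping the tail level at a multiple of `log (1 + t - t₁)`
keeps the stepsize condition and adds only a summable series to the failure probability. Dimensions
below an absolute threshold are covered by the choice of constants, except for the first constant
step, which gets a direct argument. -/

open MeasureTheory
open scoped ENNReal

noncomputable section

/-! ### Regular conditional laws and freezing of the past. -/

section CondLaw

variable {Ω E F : Type*} {m0 : MeasurableSpace Ω} [MeasurableSpace E] [StandardBorelSpace E]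
  [Nonempty E] [MeasurableSpace F]

/-- The regular conditional law of `Z` given the `σ`-field `m`. -/
def condLaw (μ : Measure Ω) [IsFiniteMeasure μ] (m : MeasurableSpace Ω) (Z : Ω → E) (ω : Ω) :
    Measure E :=
  @ProbabilityTheory.condDistrib Ω Ω E _ _ _ m0 m Z id μ _ ω

variable {μ : Measure Ω} [IsFiniteMeasure μ] {m : MeasurableSpace Ω} {Z : Ω → E}

instance (ω : Ω) : IsProbabilityMeasure (condLaw μ m Z ω) := by
  unfold condLaw; infer_instance

lemma measurable_id_prod_mk {Ω E : Type*} {m0 : MeasurableSpace Ω} [MeasurableSpace E]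
    {m : MeasurableSpace Ω} {Z : Ω → E} (hm : m ≤ m0) (hZ : Measurable[m0] Z) :
    @Measurable Ω (Ω × E) m0 (@Prod.instMeasurableSpace Ω E m _) (fun ω => (ω, Z ω)) :=
  @Measurable.prodMk Ω m0 Ω E m _ id Z (measurable_id'' hm) hZ

/-- The joint law of `(id, Z)` on `(Ω, m) × E` disintegrates along the kernel, and `P` is a function
of the first coordinate. No integrability is asked for, so high moments not known to be finite can
be handled. -/
lemma lintegral_condLaw (hm : m ≤ m0) (hZ : Measurable[m0] Z) {P : Ω → F} (hP : Measurable[m] P)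
    {g : F × E → ℝ≥0∞} (hg : Measurable g) :
    ∫⁻ ω, g (P ω, Z ω) ∂μ = ∫⁻ ω, ∫⁻ z, g (P ω, z) ∂(condLaw μ m Z ω) ∂μ := by
  have hid : @Measurable Ω Ω m0 m id := measurable_id'' hm
  have hg' : @Measurable (Ω × E) ℝ≥0∞ (@Prod.instMeasurableSpace Ω E m _) _
      (fun p : Ω × E => g (P p.1, p.2)) :=
    hg.comp (@Measurable.prodMk (Ω × E) (@Prod.instMeasurableSpace Ω E m _) F E _ _ _ _
      (hP.comp (@measurable_fst Ω E m _)) (@measurable_snd Ω E m _))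
  have h1 := @ProbabilityTheory.compProd_map_condDistrib Ω Ω E _ _ _ m0 μ _ id Z m hZ.aemeasurable
  have h2 := @lintegral_map Ω (Ω × E) m0 (@Prod.instMeasurableSpace Ω E m _) μ _ _ hg'
    (measurable_id_prod_mk hm hZ)
  have h3 := @Measure.lintegral_compProd Ω E m _ (@Measure.map Ω Ω m0 m id μ)
    (@ProbabilityTheory.condDistrib Ω Ω E _ _ _ m0 m Z id μ _) _ _ _ hg'
  have h4 := @lintegral_map Ω Ω m0 m μ _ id
    (@Measurable.lintegral_kernel_prod_right' Ω E m _
      (@ProbabilityTheory.condDistrib Ω Ω E _ _ _ m0 m Z id μ _) _ _ hg') hid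
  refine h2.symm.trans (Eq.trans ?_ (h3.trans h4))
  exact congrArg (fun ν => @lintegral _ (@Prod.instMeasurableSpace Ω E m _) ν
    fun p : Ω × E => g (P p.1, p.2)) h1.symm

/-- This turns the hypotheses, stated through conditional expectations, into almost sure statements
about one fixed law, to which estimates for deterministic laws apply. -/
lemma condExp_condLaw (hm : m ≤ m0) (hZ : Measurable[m0] Z) {P : Ω → F} (hP : Measurable[m] P)
    {g : F × E → ℝ} (hg : Measurable g) (hint : Integrable (fun ω => g (P ω, Z ω)) μ) :
    (∀ᵐ ω ∂μ, Integrable (fun z => g (P ω, z)) (condLaw μ m Z ω)) ∧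
    μ[fun ω => g (P ω, Z ω) | m] =ᵐ[μ] fun ω => ∫ z, g (P ω, z) ∂(condLaw μ m Z ω) := by
  have hid : @Measurable Ω Ω m0 m id := measurable_id'' hm
  have hg' : @Measurable (Ω × E) ℝ (@Prod.instMeasurableSpace Ω E m _) _
      (fun p : Ω × E => g (P p.1, p.2)) :=
    hg.comp (@Measurable.prodMk (Ω × E) (@Prod.instMeasurableSpace Ω E m _) F E _ _ _ _
      (hP.comp (@measurable_fst Ω E m _)) (@measurable_snd Ω E m _))
  have hs := @Measurable.stronglyMeasurable (Ω × E) ℝ _ (@Prod.instMeasurableSpace Ω E m _)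
    _ _ _ _ _ hg'
  constructor
  · have h5 : @Integrable ℝ _ _ (Ω × E) (@Prod.instMeasurableSpace Ω E m _)
        (fun p : Ω × E => g (P p.1, p.2))
        (@Measure.map Ω (Ω × E) m0 (@Prod.instMeasurableSpace Ω E m _) (fun ω => (ω, Z ω)) μ) :=
      (@integrable_map_measure Ω ℝ m0 μ _ _ (Ω × E) (@Prod.instMeasurableSpace Ω E m _) _ _ 
        (@StronglyMeasurable.aestronglyMeasurable (Ω × E) ℝ _
          (@Prod.instMeasurableSpace Ω E m _) (@Prod.instMeasurableSpace Ω E m _) _ _ hs)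
        (@Measurable.aemeasurable Ω (Ω × E) m0 (@Prod.instMeasurableSpace Ω E m _) _ _
          (measurable_id_prod_mk hm hZ))).2 hint
    exact @Integrable.condDistrib_ae Ω Ω E ℝ _ _ _ _ m0 μ _ id Z m _
      (@Measurable.aemeasurable Ω Ω m0 m _ _ hid) hZ.aemeasurable h5
  · have := @ProbabilityTheory.condExp_prod_ae_eq_integral_condDistrib Ω Ω E ℝ _ _ _ _ m0 μ _ id Z
      m _ _ _ hid hZ.aemeasurable hs hint
    rw [MeasurableSpace.comap_id] at this
    exact this

end CondLaw

/-! ### Elementary inequalities that trade polynomial factors for exponentials. -/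

section RealInequalities

/-- The linear term disappears under a centred law, which leaves only the exponential of the square
that the Orlicz bound controls. -/
lemma exp_le_add_exp_sq (y : ℝ) : Real.exp y ≤ y + Real.exp (y ^ 2) := by
  have h2 := Real.add_one_le_exp (y ^ 2)
  rcases le_or_gt |y| 1 with h | h
  · have := (abs_le.1 (Real.abs_exp_sub_one_sub_id_le h)).2
    linarith
  · rcases lt_abs.1 h with h | h
    · have : Real.exp y ≤ Real.exp (y ^ 2) := Real.exp_le_exp.2 (by nlinarith)
      linarith
    · have : Real.exp y ≤ 1 := Real.exp_le_one_iff.2 (by linarith)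
      nlinarith

/-- Convexity of `exp` between `0` and `w`. The Orlicz bound gives `E exp w ≤ 2` only, so a reduced
exponent `θ w` costs `θ` in the mean. -/
lemma exp_mul_le_of_le_one {θ w : ℝ} (h0 : 0 ≤ θ) (h1 : θ ≤ 1) :
    Real.exp (θ * w) ≤ 1 + θ * (Real.exp w - 1) := by
  have := convexOn_exp.2 (Set.mem_univ w) (Set.mem_univ 0) h0 (sub_nonneg.2 h1) (by ring)
  simp only [smul_eq_mul, mul_zero, add_zero, Real.exp_zero, mul_one] at this
  linarith

lemma exp_neg_le_quadratic {a : ℝ} (ha : 0 ≤ a) : Real.exp (-a) ≤ 1 - a + a ^ 2 / 2 := by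
  have h := Real.quadratic_le_exp_of_nonneg ha
  have hpos : 0 < Real.exp a := Real.exp_pos a
  rw [Real.exp_neg, inv_le_iff_one_le_mul₀ hpos]
  have : 0 ≤ 1 - a + a ^ 2 / 2 := by nlinarith [sq_nonneg (a - 1)]
  nlinarith [mul_le_mul_of_nonneg_left h this, sq_nonneg (a ^ 2)]

lemma exp_le_one_add_sq_mul_exp {z : ℝ} (hz : 0 ≤ z) :
    Real.exp z ≤ 1 + z + z ^ 2 * Real.exp z := by
  have h := exp_neg_le_quadratic hz
  have hpos : 0 < Real.exp z := Real.exp_pos z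
  have h1 : Real.exp z * Real.exp (-z) = 1 := by rw [← Real.exp_add]; simp
  have h2 := Real.add_one_le_exp (-z)
  have h3 : 1 - z ^ 2 ≤ Real.exp (-z) * (1 + z) := by nlinarith
  nlinarith [mul_le_mul_of_nonneg_left h3 hpos.le]

lemma sq_add_one_le_exp {y : ℝ} (hy : 0 ≤ y) : y ^ 2 + 1 ≤ Real.exp y := by
  have h := Real.sum_le_exp_of_nonneg hy 5
  simp [Finset.sum_range_succ, Nat.factorial] at h
  nlinarith [sq_nonneg (y ^ 2 - 2 * y), sq_nonneg (y * (y - 2)), sq_nonneg (y - 2), 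
    sq_nonneg (y - 1), mul_nonneg hy (sq_nonneg (y - 2)), mul_nonneg hy (sq_nonneg (y - 1)),
    mul_nonneg hy (sq_nonneg (y - 3/2)), sq_nonneg (y*(y-3/2))]

lemma cube_le_six_mul_exp {y : ℝ} (hy : 0 ≤ y) : y ^ 3 ≤ 6 * Real.exp y := by
  have h := Real.sum_le_exp_of_nonneg hy 4
  simp [Finset.sum_range_succ, Nat.factorial] at h
  nlinarith [sq_nonneg y]

lemma sq_mul_exp_quarter_le {y : ℝ} (hy : 0 ≤ y) :
    y ^ 2 * Real.exp (y / 4) ≤ 4 * Real.exp y := by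
  have h := Real.quadratic_le_exp_of_nonneg (x := 3 * y / 4) (by positivity)
  have h1 : Real.exp y = Real.exp (3 * y / 4) * Real.exp (y / 4) := by
    rw [← Real.exp_add]; ring_nf
  rw [h1]
  have := Real.exp_pos (y / 4)
  nlinarith [mul_le_mul_of_nonneg_right (show y ^ 2 ≤ 4 * Real.exp (3 * y / 4) by nlinarith) this.le]

lemma mul_exp_quarter_le {t y : ℝ} (ht : 0 ≤ t) (hy : 0 ≤ y) :
    t * Real.exp (y / 4) ≤ (Real.exp t - 1 + Real.exp y) / 2 := by
  have h1 := sq_add_one_le_exp ht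
  have h2 : Real.exp (y / 4) ^ 2 ≤ Real.exp y := by
    rw [← Real.exp_nat_mul]; exact Real.exp_le_exp.2 (by push_cast; linarith)
  nlinarith [sq_nonneg (t - Real.exp (y / 4))]

lemma mul_le_half_exp_add {t y : ℝ} (ht : 0 ≤ t) (hy : 0 ≤ y) :
    y * t ≤ (Real.exp y + Real.exp t) / 2 - 1 := by
  have h1 := sq_add_one_le_exp ht
  have h2 := sq_add_one_le_exp hy
  nlinarith [sq_nonneg (t - y)]

end RealInequalities

/-! ### Exponential moments of one step under fixed laws. -/

lemma lintegral_ofReal_le_of_le {α : Type*} [MeasurableSpace α] {ν : Measure α} {f g : α → ℝ}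
    {c : ℝ} (hf : ∀ x, 0 ≤ f x) (hfg : ∀ x, f x ≤ g x) (hg : Integrable g ν)
    (hc : ∫ x, g x ∂ν ≤ c) : ∫⁻ x, ENNReal.ofReal (f x) ∂ν ≤ ENNReal.ofReal c :=
  calc ∫⁻ x, ENNReal.ofReal (f x) ∂ν ≤ ∫⁻ x, ENNReal.ofReal (g x) ∂ν :=
        lintegral_mono fun x => ENNReal.ofReal_le_ofReal (hfg x)
    _ = ENNReal.ofReal (∫ x, g x ∂ν) :=
        (ofReal_integral_eq_lintegral_ofReal hg
          (Filter.Eventually.of_forall fun x => (hf x).trans (hfg x))).symm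
    _ ≤ ENNReal.ofReal c := ENNReal.ofReal_le_ofReal hc

/-- A centred sub-Gaussian variable: the exponential moment of a small quadratic polynomial. -/
lemma lintegral_exp_quadratic_le {ν : Measure ℝ} [IsProbabilityMeasure ν] {σ : ℝ} (hσ : 0 < σ)
    (hexp : Integrable (fun r => Real.exp ((r / σ) ^ 2)) ν)
    (hexp2 : ∫ r, Real.exp ((r / σ) ^ 2) ∂ν ≤ 2)
    (hid : Integrable (fun r : ℝ => r) ν) (hmean : ∫ r, r ∂ν = 0) {B G : ℝ} (hG : 0 ≤ G)
    (hG1 : 2 * (G * σ ^ 2) ≤ 1) :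
    ∫⁻ r, ENNReal.ofReal (Real.exp (B * r + G * r ^ 2)) ∂ν ≤
      ENNReal.ofReal (Real.exp (4 * (B ^ 2 * σ ^ 2)) + G * σ ^ 2) := by
  set a := 2 * (B * σ) with ha
  have ha2 : 4 * (B ^ 2 * σ ^ 2) = a ^ 2 := by rw [ha]; ring
  have hexpa : 1 + a ^ 2 ≤ Real.exp (a ^ 2) := by linarith [Real.add_one_le_exp (a ^ 2)]
  have hquad : ∀ r : ℝ, Real.exp (2 * (G * r ^ 2)) ≤
      1 + 2 * (G * σ ^ 2) * (Real.exp ((r / σ) ^ 2) - 1) := fun r => by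
    have := exp_mul_le_of_le_one (θ := 2 * (G * σ ^ 2)) (w := (r / σ) ^ 2) (by positivity) hG1
    convert this using 2
    field_simp
  -- The arithmetic-geometric mean inequality decouples the linear and the quadratic parts, at the
  -- price of doubling both exponents.
  have hsplit : ∀ r : ℝ, Real.exp (B * r + G * r ^ 2) ≤
      (Real.exp (2 * (B * r)) + Real.exp (2 * (G * r ^ 2))) / 2 := fun r => by
    have h1 : Real.exp (2 * (B * r)) = Real.exp (B * r) ^ 2 := by
      rw [← Real.exp_nat_mul]; norm_num
    have h2 : Real.exp (2 * (G * r ^ 2)) = Real.exp (G * r ^ 2) ^ 2 := by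
      rw [← Real.exp_nat_mul]; norm_num
    rw [h1, h2, Real.exp_add]
    nlinarith [sq_nonneg (Real.exp (B * r) - Real.exp (G * r ^ 2))]
  have hbr : ∀ r : ℝ, 2 * (B * r) = a * (r / σ) := fun r => by rw [ha]; field_simp
  rw [ha2]
  -- For small `a`, centring removes the linear term and `exp (a² (r/σ)²)` is interpolated by
  -- convexity. For large `a`, Young's inequality `a y ≤ a²/2 + y²/2` suffices, because the
  -- resulting factor `3/2` is absorbed by `exp (a²/2)`.
  rcases le_or_gt (a ^ 2) 1 with h1 | h1
  · refine lintegral_ofReal_le_of_le (g := fun r => (2 * B * r + (1 - a ^ 2 - 2 * (G * σ ^ 2) + 1) +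
      (a ^ 2 + 2 * (G * σ ^ 2)) * Real.exp ((r / σ) ^ 2)) / 2) (fun r => (Real.exp_pos _).le)
      (fun r => ?_) (by have := hid.const_mul (2 * B); fun_prop) ?_
    · have h3 := exp_le_add_exp_sq (a * (r / σ))
      have h4 := exp_mul_le_of_le_one (θ := a ^ 2) (w := (r / σ) ^ 2) (sq_nonneg a) h1
      rw [mul_pow] at h3
      rw [← hbr] at h3
      linarith [hsplit r, hquad r]
    · have hB := hid.const_mul (2 * B)
      rw [integral_div, integral_add (by fun_prop) (by fun_prop),
        integral_add hB (by fun_prop), integral_const_mul, integral_const_mul, hmean]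
      simp only [integral_const, probReal_univ, smul_eq_mul]
      have : (a ^ 2 + 2 * (G * σ ^ 2)) * ∫ r, Real.exp ((r / σ) ^ 2) ∂ν ≤
        (a ^ 2 + 2 * (G * σ ^ 2)) * 2 := mul_le_mul_of_nonneg_left hexp2 (by positivity)
      linarith [sq_nonneg a]
  · have h5 : Real.exp (a ^ 2 / 2) * (3 / 2) ≤ Real.exp (a ^ 2) := by
      have : Real.exp (a ^ 2) = Real.exp (a ^ 2 / 2) * Real.exp (a ^ 2 / 2) := by
        rw [← Real.exp_add]; ring_nf
      rw [this]
      have := Real.add_one_le_exp (a ^ 2 / 2)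
      gcongr
      linarith
    refine lintegral_ofReal_le_of_le (g := fun r => (Real.exp (a ^ 2 / 2) / 2 + 1 - 2 * (G * σ ^ 2) +
      (Real.exp (a ^ 2 / 2) / 2 + 2 * (G * σ ^ 2)) * Real.exp ((r / σ) ^ 2)) / 2)
      (fun r => (Real.exp_pos _).le) (fun r => ?_) (by fun_prop) ?_
    · have h3 : Real.exp (2 * (B * r)) ≤ Real.exp (a ^ 2 / 2) * Real.exp (1 / 2 * (r / σ) ^ 2) := by
        rw [← Real.exp_add, hbr]
        exact Real.exp_le_exp.2 (by nlinarith [sq_nonneg (a - r / σ)])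
      have h4 := exp_mul_le_of_le_one (θ := 1 / 2) (w := (r / σ) ^ 2) (by norm_num) (by norm_num)
      have h6 := mul_le_mul_of_nonneg_left h4 (Real.exp_pos (a ^ 2 / 2)).le
      linarith [hsplit r, hquad r]
    · rw [integral_div, integral_add (by fun_prop) (by fun_prop), integral_const_mul]
      simp only [integral_const, probReal_univ, smul_eq_mul]
      have := mul_le_mul_of_nonneg_left hexp2
        (show 0 ≤ Real.exp (a ^ 2 / 2) / 2 + 2 * (G * σ ^ 2) by positivity)
      linarith

/-- From `y (1 - h y)² ≥ 0` one gets `2 h y² ≤ y + h² y³`. A bound by `h exp y` would be too weak: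
the drift is known only through `E y ≥ l / L`, so an error must be a small multiple of `y`, or carry
`h²`, for which `q h² ≤ τ` is available. -/
lemma sq_half_le {q h v y : ℝ} (hv0 : 0 ≤ v) (hv1 : v ≤ 1) (hh0 : 0 < h)
    (hq0 : 0 ≤ q) (hqh : q ≤ h / 1048576) (hy : 0 ≤ y) :
    (2 * q * v * y) ^ 2 / 2 ≤ q * v * (y + 6 * h ^ 2 * Real.exp y) / 1048576 := by
  have e0 : 2 * h * y ^ 2 ≤ y + 6 * h ^ 2 * Real.exp y := by
    have := mul_le_mul_of_nonneg_left (cube_le_six_mul_exp hy) (sq_nonneg h)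
    linarith [mul_nonneg hy (sq_nonneg (1 - h * y))]
  calc (2 * q * v * y) ^ 2 / 2 = 2 * (q * v) * y ^ 2 * (q * v) := by ring
    _ ≤ 2 * (q * v) * y ^ 2 * (h / 1048576 * 1) := by gcongr
    _ = q * v * (2 * h * y ^ 2) / 1048576 := by ring
    _ ≤ _ := by gcongr

/-- Second-order expansion of the weight. Here `q` scales the drift `-2 q v y`, `τ ≤ q` is the drift
guaranteed in the mean, `ya` is the second-order term of the covariate and `yb` comes from the
noise. The remainder `(ya + yb)² exp (ya + yb)` is at most `τ v exp y / 64`, because the slope `g`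
of `ya + yb` satisfies `g² ≤ τ / 256`. -/
lemma exp_neg_add_mul_exp_le {q τ h v y ya yb : ℝ} (hv0 : 0 ≤ v) (hv1 : v ≤ 1) (hh0 : 0 < h)
    (hh1 : h ≤ 1) (hq0 : 0 ≤ q) (hqh : q ≤ h / 1048576) (hτ0 : 0 ≤ τ) (hτq : τ ≤ q)
    (hqhh : q * h ^ 2 ≤ τ) (hy : 0 ≤ y) (hya0 : 0 ≤ ya) (hya : ya ≤ 32 * q * h * v * y)
    (hyb0 : 0 ≤ yb) (hyb : yb ≤ τ * v * y / 64) :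
    ya + yb ≤ y / 4 ∧ Real.exp (-(2 * q * v * y) + ya) * Real.exp yb ≤ 1 - 2 * q * v * y +
      q * v * (y + 6 * h ^ 2 * Real.exp y) / 1048576 + (ya + yb) + τ * v * Real.exp y / 64 := by
  have hy10 : 0 ≤ 2 * q * v * y := by positivity
  obtain ⟨g, hg⟩ : ∃ g, g = 32 * q * h + τ / 64 := ⟨_, rfl⟩
  have hg0 : 0 ≤ g := by rw [hg]; positivity
  have hqle : q ≤ 1 / 1048576 := hqh.trans (by gcongr)
  have hqhle : q * h ≤ 1 / 1048576 := by
    calc q * h ≤ q * 1 := by gcongr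
      _ ≤ _ := by linarith
  have hg4 : g ≤ 1 / 4 := by rw [hg]; linarith
  have hgsq : g ^ 2 ≤ τ / 256 := by
    have e1 : g ^ 2 ≤ 2 * (32 * q * h) ^ 2 + 2 * (τ / 64) ^ 2 := by
      rw [hg]; linarith [sq_nonneg (32 * q * h - τ / 64)]
    have e2 : (32 * q * h) ^ 2 ≤ 1024 * (1 / 1048576 * τ) := by
      have : q * (q * h ^ 2) ≤ 1 / 1048576 * τ :=
        mul_le_mul hqle hqhh (by positivity) (by positivity)
      calc (32 * q * h) ^ 2 = 1024 * (q * (q * h ^ 2)) := by ring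
        _ ≤ _ := by gcongr
    have e3 : τ * τ ≤ τ * (1 / 1048576) := by gcongr; linarith
    have e4 : (τ / 64) ^ 2 = τ * τ / 4096 := by ring
    linarith
  have hvy : v * y ≤ y := mul_le_of_le_one_left hy hv1
  have hy2_le : ya + yb ≤ g * (v * y) := by
    have : g * (v * y) = 32 * q * h * v * y + τ * v * y / 64 := by rw [hg]; ring
    linarith
  have hy2_quarter : ya + yb ≤ y / 4 := by
    have : g * (v * y) ≤ 1 / 4 * y := mul_le_mul hg4 hvy (by positivity) (by norm_num)
    linarith
  have hy2sq : (ya + yb) ^ 2 * Real.exp (ya + yb) ≤ τ * v * Real.exp y / 64 := by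
    have e1 : (ya + yb) ^ 2 ≤ g ^ 2 * v * y ^ 2 := by
      calc (ya + yb) ^ 2 ≤ (g * (v * y)) ^ 2 := by gcongr
        _ = g ^ 2 * y ^ 2 * (v * v) := by ring
        _ ≤ g ^ 2 * y ^ 2 * (1 * v) := by gcongr
        _ = _ := by ring
    calc (ya + yb) ^ 2 * Real.exp (ya + yb) ≤ (g ^ 2 * v * y ^ 2) * Real.exp (y / 4) := by gcongr
      _ = g ^ 2 * v * (y ^ 2 * Real.exp (y / 4)) := by ring
      _ ≤ (τ / 256) * v * (4 * Real.exp y) :=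
          mul_le_mul (by gcongr) (sq_mul_exp_quarter_le hy) (by positivity) (by positivity)
      _ = _ := by ring
  have hy1sq := sq_half_le (v := v) hv0 hv1 hh0 hq0 hqh hy
  refine ⟨hy2_quarter, ?_⟩
  have e1 := exp_neg_le_quadratic hy10
  have e2 := exp_le_one_add_sq_mul_exp (add_nonneg hya0 hyb0)
  have e3 : Real.exp (-(2 * q * v * y)) ≤ 1 := Real.exp_le_one_iff.2 (by linarith)
  have e4 : 1 ≤ Real.exp (ya + yb) := Real.one_le_exp (by linarith)
  rw [← Real.exp_add, add_assoc, Real.exp_add]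
  have e5 := mul_nonneg (sub_nonneg.2 e3) (sub_nonneg.2 e4)
  linarith

/-- Pointwise majorant, affine in `y`, `exp y`, `y * X2` and `X2 * exp (y / 4)`, of the exponential
weight of one step. Here `y` is the squared normalised projection of the covariate on the error
direction, `X2` its squared norm and `V` the squared error. -/
lemma exp_step_le {l L η D s σ V W y X2 P : ℝ} (hl : 0 < l) (hlL : l ≤ L) (hη : 0 < η)
    (hD : 1 ≤ D) (hσ : 0 < σ) (hV : 0 ≤ V) (hy : 0 ≤ y) (hX : 0 ≤ X2) (hX2 : X2 ≤ 32 * (L * D))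
    (hP0 : 0 ≤ P) (hP : P ≤ D / 1048576) (hh : L * (D * η * L) ^ 2 ≤ l)
    (hs : s = L / l * η * σ ^ 2 * D) (hW : W = V + s) :
    Real.exp (P / W * (-2 * η * (V * L * y) + η ^ 2 * (V * L * y) * X2)) *
      (Real.exp (4 * ((P / W * (2 * η)) ^ 2 * (V * L * y) * (1 - η * X2) ^ 2 * σ ^ 2)) +
        P / W * η ^ 2 * X2 * σ ^ 2) ≤
    1 - 2 * (P * η * L) * (V / W) * y
      + P * η * L * (V / W) * (y + 6 * (D * η * L) ^ 2 * Real.exp y) / 1048576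
      + (P * η ^ 2 * (V / W) * L * (y * X2) + P * η * l * (V / W) * y / 64)
      + P * η * l * (V / W) * Real.exp y / 64
      + P / W * η ^ 2 * σ ^ 2 * (X2 * Real.exp (y / 4)) := by
  have hL : 0 < L := hl.trans_le hlL
  have hD0 : 0 < D := one_pos.trans_le hD
  have hs0 : 0 < s := by rw [hs]; positivity
  have hW0 : 0 < W := by linarith
  have hv0 : 0 ≤ V / W := by positivity
  have hv1 : V / W ≤ 1 := by rw [div_le_one hW0]; linarith
  have hh0 : 0 < D * η * L := by positivity
  have hh1 : D * η * L ≤ 1 := by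
    have h1 : L * (D * η * L) ^ 2 ≤ L * 1 := by linarith
    exact (sq_le_one_iff₀ hh0.le).1 (le_of_mul_le_mul_left h1 hL)
  have hqh : P * η * L ≤ D * η * L / 1048576 := by
    have := mul_le_mul_of_nonneg_right hP (show 0 ≤ η * L by positivity)
    linarith
  have hτq : P * η * l ≤ P * η * L := by gcongr
  have hqhh : P * η * L * (D * η * L) ^ 2 ≤ P * η * l := by
    have := mul_le_mul_of_nonneg_left hh (show 0 ≤ P * η by positivity)
    linarith
  have hya_le : P * η ^ 2 * (V / W) * L * (y * X2) ≤
      32 * (P * η * L) * (D * η * L) * (V / W) * y := by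
    have := mul_le_mul_of_nonneg_left hX2 (show 0 ≤ P * η ^ 2 * (V / W) * L * y by positivity)
    linarith
  have hsq : (1 - η * X2) ^ 2 ≤ 1024 := by
    have h1 : η * X2 ≤ 32 := by
      have := mul_le_mul_of_nonneg_left hX2 hη.le
      linarith
    have h2 : 0 ≤ η * X2 := by positivity
    have := abs_le_of_sq_le_sq (a := 1 - η * X2) (b := 32)
    nlinarith
  -- The choice of `s` is made for this: the variance of the noise cross term equals the guaranteed
  -- drift times `4 (P / D) (s / W)`, and both ratios are bounded, the first one by `2^(-20)`.
  have hcoef : (P / W * (2 * η)) ^ 2 * (V * L) * σ ^ 2 ≤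
      4 * (P * η * l * (V / W)) * (1 / 1048576) := by
    have e1 : (P / W * (2 * η)) ^ 2 * (V * L) * σ ^ 2 =
        4 * (P * η * l * (V / W)) * (P / D * (s / W)) := by
      rw [hs]; field_simp; ring
    have e2 : P / D ≤ 1 / 1048576 := by rw [div_le_iff₀ hD0]; linarith
    have e3 : s / W ≤ 1 := by rw [div_le_one hW0]; linarith
    have e4 : P / D * (s / W) ≤ 1 / 1048576 * 1 :=
      mul_le_mul e2 e3 (by positivity) (by norm_num)
    rw [e1, ← mul_one (1 / 1048576 : ℝ)]
    exact mul_le_mul_of_nonneg_left e4 (by positivity)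
  have hyb_le : 4 * ((P / W * (2 * η)) ^ 2 * (V * L * y) * (1 - η * X2) ^ 2 * σ ^ 2) ≤
      P * η * l * (V / W) * y / 64 := by
    have e1 := mul_le_mul hcoef hsq (by positivity) (by positivity)
    have e2 := mul_le_mul_of_nonneg_left e1 (show 0 ≤ 4 * y by positivity)
    calc _ = 4 * y * ((P / W * (2 * η)) ^ 2 * (V * L) * σ ^ 2 * (1 - η * X2) ^ 2) := by ring
      _ ≤ _ := e2
      _ = _ := by ring
  obtain ⟨h1, h2⟩ := exp_neg_add_mul_exp_le hv0 hv1 hh0 hh1 (by positivity) hqh (by positivity) hτq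
    hqhh hy (by positivity) hya_le (by positivity) hyb_le
  have hE0 : P / W * (-2 * η * (V * L * y) + η ^ 2 * (V * L * y) * X2) =
      -(2 * (P * η * L) * (V / W) * y) + P * η ^ 2 * (V / W) * L * (y * X2) := by ring
  have hG : Real.exp (-(2 * (P * η * L) * (V / W) * y) + P * η ^ 2 * (V / W) * L * (y * X2)) *
      (P / W * η ^ 2 * X2 * σ ^ 2) ≤ P / W * η ^ 2 * σ ^ 2 * (X2 * Real.exp (y / 4)) := by
    have e0 : 0 ≤ 2 * (P * η * L) * (V / W) * y := by positivity
    have e2 : 0 ≤ 4 * ((P / W * (2 * η)) ^ 2 * (V * L * y) * (1 - η * X2) ^ 2 * σ ^ 2) := by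
      positivity
    calc _ ≤ Real.exp (y / 4) * (P / W * η ^ 2 * X2 * σ ^ 2) :=
          mul_le_mul_of_nonneg_right (Real.exp_le_exp.2 (by linarith)) (by positivity)
      _ = _ := by ring
  rw [hE0, mul_add]
  linarith

/-- One step of the recursion for a fixed law of the covariate. -/
lemma lintegral_exp_step_le {d : ℕ} {ν : Measure (EuclideanSpace ℝ (Fin d))}
    [IsProbabilityMeasure ν] {u : EuclideanSpace ℝ (Fin d)} {l L η D s σ ρ V W P : ℝ}
    (hu : Integrable (fun x => Real.exp (inner ℝ u x ^ 2 / L)) ν)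
    (hu2 : ∫ x, Real.exp (inner ℝ u x ^ 2 / L) ∂ν ≤ 2)
    (hx : ∀ i, Integrable (fun x => Real.exp (x i ^ 2 / L)) ν)
    (hx2 : ∀ i, ∫ x, Real.exp (x i ^ 2 / L) ∂ν ≤ 2)
    (hlow : l ≤ ∫ x, inner ℝ u x ^ 2 ∂ν)
    (hl : 0 < l) (hlL : l ≤ L) (hη : 0 < η) (hD : 1 ≤ D) (hdD : d ≤ D) (hσ : 0 < σ) (hV : 0 ≤ V)
    (hP0 : 0 ≤ P) (hP : P ≤ D / 1048576) (hh : L * (D * η * L) ^ 2 ≤ l)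
    (hs : s = L / l * η * σ ^ 2 * D) (hW : W = V + s) (hρ : ρ + L / l * η * d * L ≤ 7 / 4) :
    ∫⁻ x, Set.indicator {x | ‖x‖ ^ 2 ≤ 32 * (L * D)} (fun x => ENNReal.ofReal
      (Real.exp (P / W * (-2 * η * (V * inner ℝ u x ^ 2) + η ^ 2 * (V * inner ℝ u x ^ 2) * ‖x‖ ^ 2)) *
      (Real.exp (4 * ((P / W * (2 * η)) ^ 2 * (V * inner ℝ u x ^ 2) * (1 - η * ‖x‖ ^ 2) ^ 2 * σ ^ 2))
        + P / W * η ^ 2 * ‖x‖ ^ 2 * σ ^ 2))) x ∂ν ≤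
    ENNReal.ofReal (1 + P * η * l / W * (-ρ * V + 3 / 2 * s)) := by
  have hL : 0 < L := hl.trans_le hlL
  have hD0 : 0 < D := one_pos.trans_le hD
  have hs0 : 0 < s := by rw [hs]; positivity
  have hW0 : 0 < W := by linarith
  have hh0 : 0 < D * η * L := by positivity
  have hqh : P * η * L ≤ D * η * L / 1048576 := by
    have := mul_le_mul_of_nonneg_right hP (show 0 ≤ η * L by positivity)
    linarith
  obtain ⟨v, hv⟩ : ∃ v, v = V / W := ⟨_, rfl⟩
  have hv0 : 0 ≤ v := by rw [hv]; positivity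
  have hv1 : v ≤ 1 := by rw [hv, div_le_one hW0]; linarith
  obtain ⟨y, hy⟩ : ∃ y : EuclideanSpace ℝ (Fin d) → ℝ, ∀ x, y x = inner ℝ u x ^ 2 / L :=
    ⟨_, fun _ => rfl⟩
  have hy0 : ∀ x, 0 ≤ y x := fun x => by rw [hy]; positivity
  have hiy : ∀ x : EuclideanSpace ℝ (Fin d), inner ℝ u x ^ 2 = L * y x := fun x => by
    rw [hy]; field_simp
  simp only [← hy] at hu hu2
  simp only [hiy] at hlow ⊢
  have hyint : Integrable y ν := by
    refine hu.mono' ?_ (Filter.Eventually.of_forall fun x => ?_)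
    · rw [funext hy]; fun_prop
    · rw [Real.norm_of_nonneg (hy0 x)]
      linarith [Real.add_one_le_exp (y x)]
  obtain ⟨m, hm⟩ : ∃ m, m = ∫ x, y x ∂ν := ⟨_, rfl⟩
  have hm1 : m ≤ 1 := by
    have : m ≤ ∫ x, (Real.exp (y x) - 1) ∂ν := by
      rw [hm]
      refine integral_mono hyint (by fun_prop) fun x => ?_
      have := Real.add_one_le_exp (y x)
      simp only
      linarith
    rw [integral_sub hu (by fun_prop)] at this
    simp only [integral_const, probReal_univ, smul_eq_mul] at this
    linarith
  have hml : l / L ≤ m := by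
    rw [integral_const_mul, ← hm] at hlow
    rw [div_le_iff₀ hL]; linarith
  obtain ⟨S, hS⟩ : ∃ S : EuclideanSpace ℝ (Fin d) → ℝ, ∀ x, S x = ∑ i, Real.exp (x i ^ 2 / L) :=
    ⟨_, fun _ => rfl⟩
  have hSint : Integrable S ν := by rw [funext hS]; exact integrable_finsetSum _ fun i _ => hx i
  have hS2 : ∫ x, S x ∂ν ≤ 2 * d := by
    rw [funext hS, integral_finsetSum _ fun i _ => hx i]
    calc _ ≤ ∑ i : Fin d, (2 : ℝ) := Finset.sum_le_sum fun i _ => hx2 i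
      _ = _ := by simp [mul_comm]
  have hnorm : ∀ x : EuclideanSpace ℝ (Fin d), ‖x‖ ^ 2 = L * ∑ i, x i ^ 2 / L := fun x => by
    rw [EuclideanSpace.real_norm_sq_eq, Finset.mul_sum]
    exact Finset.sum_congr rfl fun i _ => by field_simp
  -- Applied coordinate by coordinate, and keeping the `-1`: the right side then has mean at most `L
  -- d` with constant one, which gives the term `L / l * η * d * L` in `hρ`.
  have hyX : ∀ x, y x * ‖x‖ ^ 2 ≤ L * (d * (Real.exp (y x) / 2 - 1) + S x / 2) := fun x => by
    rw [hnorm x, mul_left_comm, Finset.mul_sum]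
    gcongr
    calc ∑ i, y x * (x i ^ 2 / L) ≤ ∑ i : Fin d, ((Real.exp (y x) + Real.exp (x i ^ 2 / L)) / 2 - 1) :=
          Finset.sum_le_sum fun i _ => mul_le_half_exp_add (by positivity) (hy0 x)
      _ = _ := by
          rw [hS, Finset.sum_sub_distrib, ← Finset.sum_div, Finset.sum_add_distrib]
          simp; ring
  have hXe : ∀ x, ‖x‖ ^ 2 * Real.exp (y x / 4) ≤ L * (d * (Real.exp (y x) - 1) / 2 + S x / 2) :=
    fun x => by
    rw [hnorm x, mul_assoc, Finset.sum_mul]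
    gcongr
    calc ∑ i, x i ^ 2 / L * Real.exp (y x / 4) ≤
        ∑ i : Fin d, ((Real.exp (x i ^ 2 / L) - 1 + Real.exp (y x)) / 2) :=
          Finset.sum_le_sum fun i _ => mul_exp_quarter_le (by positivity) (hy0 x)
      _ = _ := by
          rw [hS, ← Finset.sum_div, Finset.sum_add_distrib, Finset.sum_sub_distrib]
          simp; ring
  obtain ⟨α, hα⟩ : ∃ α, α = P * η ^ 2 * v * L := ⟨_, rfl⟩
  obtain ⟨γ, hγ⟩ : ∃ γ, γ = P / W * η ^ 2 * σ ^ 2 := ⟨_, rfl⟩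
  have hα0 : 0 ≤ α := by rw [hα]; positivity
  have hγ0 : 0 ≤ γ := by rw [hγ]; positivity
  -- Coefficients of the majorant in `1`, `y`, `exp y` and `S`, the functions whose means are
  -- controlled.
  obtain ⟨a0, ha0⟩ : ∃ a0, a0 = 1 - α * L * d - γ * L * d / 2 := ⟨_, rfl⟩
  obtain ⟨a1, ha1⟩ : ∃ a1, a1 = -(2 * (P * η * L) * v) + P * η * L * v / 1048576 +
    P * η * l * v / 64 := ⟨_, rfl⟩
  obtain ⟨a2, ha2⟩ : ∃ a2, a2 = P * η * L * v * (6 * (D * η * L) ^ 2) / 1048576 + α * L * d / 2 +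
    P * η * l * v / 64 + γ * L * d / 2 := ⟨_, rfl⟩
  obtain ⟨a3, ha3⟩ : ∃ a3, a3 = α * L / 2 + γ * L / 2 := ⟨_, rfl⟩
  have ha20 : 0 ≤ a2 := by rw [ha2]; positivity
  have ha30 : 0 ≤ a3 := by rw [ha3]; positivity
  have hFdecomp : ∀ x, a0 + a1 * y x + a2 * Real.exp (y x) + a3 * S x =
      1 - 2 * (P * η * L) * v * y x
      + P * η * L * v * (y x + 6 * (D * η * L) ^ 2 * Real.exp (y x)) / 1048576
      + α * (L * (d * (Real.exp (y x) / 2 - 1) + S x / 2)) + P * η * l * v * y x / 64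
      + P * η * l * v * Real.exp (y x) / 64
      + γ * (L * (d * (Real.exp (y x) - 1) / 2 + S x / 2)) := fun x => by
    rw [ha0, ha1, ha2, ha3]; ring
  have hle : ∀ x, ‖x‖ ^ 2 ≤ 32 * (L * D) → 
      Real.exp (P / W * (-2 * η * (V * (L * y x)) + η ^ 2 * (V * (L * y x)) * ‖x‖ ^ 2)) *
      (Real.exp (4 * ((P / W * (2 * η)) ^ 2 * (V * (L * y x)) * (1 - η * ‖x‖ ^ 2) ^ 2 * σ ^ 2))
        + P / W * η ^ 2 * ‖x‖ ^ 2 * σ ^ 2) ≤ a0 + a1 * y x + a2 * Real.exp (y x) + a3 * S x :=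
    fun x hx => by
    have h1 := exp_step_le hl hlL hη hD hσ hV (hy0 x) (sq_nonneg ‖x‖) hx hP0 hP hh hs hW
    rw [← hv, ← hα, ← hγ, mul_assoc V] at h1
    have h2 := mul_le_mul_of_nonneg_left (hyX x) hα0
    have h3 := mul_le_mul_of_nonneg_left (hXe x) hγ0
    rw [hFdecomp]
    linarith
  -- Off the truncation event the integrand is `0`, so the majorant has to be nonnegative there.
  -- With `z = 2 q v y` and `q = P η L`, this follows from `1 - z + z²/2 ≥ 0`, since `sq_half_le`
  -- bounds `z²/2`.
  have hpos : ∀ x, 0 ≤ a0 + a1 * y x + a2 * Real.exp (y x) + a3 * S x := fun x => by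
    have h1 := sq_half_le (v := v) hv0 hv1 hh0 (by positivity) hqh (hy0 x)
    have h2 := mul_nonneg hα0 ((mul_nonneg (hy0 x) (sq_nonneg ‖x‖)).trans (hyX x))
    have h3 := mul_nonneg hγ0 ((mul_nonneg (sq_nonneg ‖x‖) (Real.exp_pos _).le).trans (hXe x))
    have h4 : 0 ≤ P * η * l * v * y x / 64 := by have := hy0 x; positivity
    have h5 : 0 ≤ P * η * l * v * Real.exp (y x) / 64 := by positivity
    rw [hFdecomp]
    linarith [sq_nonneg (2 * (P * η * L) * v * y x - 1)]
  have hint : ∫ x, (a0 + a1 * y x + a2 * Real.exp (y x) + a3 * S x) ∂ν ≤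
      1 + P * η * l / W * (-ρ * V + 3 / 2 * s) := by
    rw [integral_add (by fun_prop) (by fun_prop), integral_add (by fun_prop) (by fun_prop),
      integral_add (by fun_prop) (by fun_prop), integral_const_mul, integral_const_mul,
      integral_const_mul, ← hm]
    simp only [integral_const, probReal_univ, smul_eq_mul, one_mul]
    have h1 := mul_le_mul_of_nonneg_left hu2 ha20
    have h2 := mul_le_mul_of_nonneg_left hS2 ha30
    -- The quadratic covariate term reduces the contraction rate by `L / l * η * d * L`, and `γ L D`
    -- is `P η l s / W` by the definition of `s`. The margin of `1/4` in `hρ` absorbs all remaining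
    -- errors.
    have e1 : P * η * l * v * (L / l * η * d * L) = α * L * d := by rw [hα]; field_simp
    have e2 : γ * L * d ≤ P * η * l / W * s := by
      have : P * η * l / W * s = γ * L * D := by rw [hγ, hs]; field_simp
      rw [this]
      gcongr
    have e3 : P * η * L * v * (D * η * L) ^ 2 ≤ P * η * l * v := by
      have := mul_le_mul_of_nonneg_left hh (show 0 ≤ P * η * v by positivity)
      linarith
    have e4 : P * η * l * v ≤ P * η * L * v * m := by
      have := mul_le_mul_of_nonneg_left hml (show 0 ≤ P * η * L * v by positivity)
      have e : P * η * L * v * (l / L) = P * η * l * v := by field_simp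
      linarith
    have e5 : P * η * l * v * m ≤ P * η * l * v * 1 := by gcongr
    have e6 := mul_le_mul_of_nonneg_left hρ (show 0 ≤ P * η * l * v by positivity)
    have e7 : P * η * l / W * (-ρ * V + 3 / 2 * s) =
        -ρ * (P * η * l * v) + 3 / 2 * (P * η * l / W * s) := by rw [hv]; ring
    have e8 : 0 ≤ P * η * l * v := by positivity
    rw [e7]
    have e9 : a0 + a1 * m + a2 * 2 + a3 * (2 * d) = 1 + α * L * d + 3 / 2 * (γ * L * d)
        - 2 * (P * η * L * v * m) + P * η * L * v * m / 1048576 + P * η * l * v * m / 64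
        + 12 * (P * η * L * v * (D * η * L) ^ 2) / 1048576 + P * η * l * v / 32 := by
      rw [ha0, ha1, ha2, ha3]; ring
    linarith
  calc _ = ∫⁻ x, ENNReal.ofReal (Set.indicator {x | ‖x‖ ^ 2 ≤ 32 * (L * D)} (fun x =>
      Real.exp (P / W * (-2 * η * (V * (L * y x)) + η ^ 2 * (V * (L * y x)) * ‖x‖ ^ 2)) *
      (Real.exp (4 * ((P / W * (2 * η)) ^ 2 * (V * (L * y x)) * (1 - η * ‖x‖ ^ 2) ^ 2 * σ ^ 2))
        + P / W * η ^ 2 * ‖x‖ ^ 2 * σ ^ 2)) x) ∂ν := by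
        congr 1; ext x
        by_cases hx : ‖x‖ ^ 2 ≤ 32 * (L * D) <;> simp [Set.indicator, hx]
    _ ≤ _ := by
      refine lintegral_ofReal_le_of_le
        (g := fun x => a0 + a1 * y x + a2 * Real.exp (y x) + a3 * S x) (fun x => ?_) (fun x => ?_)
        (by fun_prop) hint
      · exact Set.indicator_nonneg (fun x _ => by positivity) x
      · by_cases hx : ‖x‖ ^ 2 ≤ 32 * (L * D)
        · rw [Set.indicator_of_mem (by exact hx)]
          exact hle x hx
        · rw [Set.indicator_of_notMem (by simpa using hx)]
          exact hpos x

/-! ### Measurability of the iterates with respect to the past. -/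

section Filtration

variable {Ω : Type*} {m0 : MeasurableSpace Ω} {d : ℕ} {X : ℕ → Ω → EuclideanSpace ℝ (Fin d)}

lemma pastSigma_le {Y : ℕ → Ω → ℝ} (hX : ∀ t, Measurable (X t)) (hY : ∀ t, Measurable (Y t))
    (t : ℕ) : pastSigma X Y t ≤ m0 :=
  iSup_le fun l => sup_le (hY l).comap_le (hX l).comap_le

lemma pastSigmaPlus_le {Y : ℕ → Ω → ℝ} (hX : ∀ t, Measurable (X t)) (hY : ∀ t, Measurable (Y t))
    (t : ℕ) : pastSigmaPlus X Y t ≤ m0 :=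
  sup_le (hX t).comap_le (pastSigma_le hX hY t)

lemma pastSigma_mono (Y : ℕ → Ω → ℝ) {s t : ℕ} (hst : s ≤ t) :
    pastSigma X Y s ≤ pastSigma X Y t :=
  iSup_le fun l => le_iSup (fun l : Fin t => MeasurableSpace.comap (Y l) inferInstance ⊔
    MeasurableSpace.comap (X l) inferInstance) (Fin.castLE hst l)

lemma measurable_pastSigma_covariate (Y : ℕ → Ω → ℝ) {s t : ℕ} (hst : s < t) :
    Measurable[pastSigma X Y t] (X s) :=
  Measurable.of_comap_le (le_sup_right.trans (le_iSup (fun l : Fin t =>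
    MeasurableSpace.comap (Y l) inferInstance ⊔ MeasurableSpace.comap (X l) inferInstance) ⟨s, hst⟩))

lemma measurable_pastSigma_response (Y : ℕ → Ω → ℝ) {s t : ℕ} (hst : s < t) :
    Measurable[pastSigma X Y t] (Y s) :=
  Measurable.of_comap_le (le_sup_left.trans (le_iSup (fun l : Fin t =>
    MeasurableSpace.comap (Y l) inferInstance ⊔ MeasurableSpace.comap (X l) inferInstance) ⟨s, hst⟩))

lemma measurable_response {ξ : ℕ → Ω → ℝ} (βstar : EuclideanSpace ℝ (Fin d))
    (hX : ∀ t, Measurable (X t)) (hξ : ∀ t, Measurable (ξ t)) (t : ℕ) :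
    Measurable (response X ξ βstar t) :=
  ((hX t).inner measurable_const).add (hξ t)

lemma measurable_sgd (Y : ℕ → Ω → ℝ) (η : ℕ → ℝ) (β₀ : EuclideanSpace ℝ (Fin d)) (t : ℕ) :
    Measurable[pastSigma X Y t] (sgd X Y η β₀ t) := by
  induction t with
  | zero => exact @measurable_const _ _ _ (pastSigma X Y 0) β₀
  | succ t ih =>
    have h1 := ih.mono (pastSigma_mono Y t.le_succ) le_rfl
    have h2 := measurable_pastSigma_covariate (X := X) Y t.lt_succ_self
    have h3 := measurable_pastSigma_response (X := X) Y t.lt_succ_self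
    exact h1.sub (((h2.inner h1).sub h3).const_mul (η t) |>.smul h2)

end Filtration

/-! ### The random direction of the error vector. -/

section Direction

variable {d : ℕ}

/-- The direction of a vector, with a default value at `0`. -/
def direction (e v : EuclideanSpace ℝ (Fin d)) : EuclideanSpace ℝ (Fin d) :=
  if v = 0 then e else ‖v‖⁻¹ • v

lemma measurable_direction (e : EuclideanSpace ℝ (Fin d)) : Measurable (direction e) :=
  Measurable.ite (measurableSet_singleton 0) measurable_const
    (measurable_norm.inv.smul measurable_id)

lemma norm_direction {e : EuclideanSpace ℝ (Fin d)} (he : ‖e‖ = 1) (v : EuclideanSpace ℝ (Fin d)) :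
    ‖direction e v‖ = 1 := by
  unfold direction
  split_ifs with h
  · exact he
  · rw [norm_smul, norm_inv, norm_norm, inv_mul_cancel₀ (norm_ne_zero_iff.2 h)]

lemma norm_smul_direction (e v : EuclideanSpace ℝ (Fin d)) : ‖v‖ • direction e v = v := by
  unfold direction
  split_ifs with h
  · simp [h]
  · rw [smul_smul, mul_inv_cancel₀ (norm_ne_zero_iff.2 h), one_smul]

lemma norm_sq_mul_inner_direction_sq (e v x : EuclideanSpace ℝ (Fin d)) :
    ‖v‖ ^ 2 * inner ℝ (direction e v) x ^ 2 = inner ℝ x v ^ 2 := by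
  conv_rhs => rw [← norm_smul_direction e v]
  rw [inner_smul_right, real_inner_comm x, mul_pow]

end Direction

/-! ### Model assumptions as statements about conditional laws. -/

section CondLawBounds

variable {Ω : Type*} {m0 : MeasurableSpace Ω} {μ : Measure Ω} [IsProbabilityMeasure μ]
  {m : MeasurableSpace Ω}

lemma CondPsi2LeVec.ae_condLaw {d : ℕ} {Z u : Ω → EuclideanSpace ℝ (Fin d)} {L : ℝ} (hL : 0 < L)
    (hm : m ≤ m0) (hZ : Measurable[m0] Z) (h : CondPsi2LeVec μ m Z (Real.sqrt L))
    (hu : Measurable[m] u) (hu1 : ∀ ω, ‖u ω‖ = 1) :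
    Integrable (fun ω => Real.exp (inner ℝ (u ω) (Z ω) ^ 2 / L)) μ ∧
    ∀ᵐ ω ∂μ, Integrable (fun x => Real.exp (inner ℝ (u ω) x ^ 2 / L)) (condLaw μ m Z ω) ∧
      ∫ x, Real.exp (inner ℝ (u ω) x ^ 2 / L) ∂(condLaw μ m Z ω) ≤ 2 := by
  obtain ⟨-, h1, h2⟩ := h u hu hu1
  simp only [sq_abs, div_pow, Real.sq_sqrt hL.le] at h1 h2
  obtain ⟨h3, h4⟩ := condExp_condLaw hm hZ hu
    (g := fun p : EuclideanSpace ℝ (Fin d) × EuclideanSpace ℝ (Fin d) =>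
      Real.exp (inner ℝ p.1 p.2 ^ 2 / L)) (by fun_prop) h1
  refine ⟨h1, ?_⟩
  filter_upwards [h2, h3, h4] with ω a1 a2 a3
  exact ⟨a2, a3 ▸ a1⟩

lemma CondPsi2LeVec.integrable_mul {d : ℕ} {Z : Ω → EuclideanSpace ℝ (Fin d)} {L : ℝ} (hL : 0 < L)
    (hm : m ≤ m0) (hZ : Measurable[m0] Z) (h : CondPsi2LeVec μ m Z (Real.sqrt L)) (i j : Fin d) :
    Integrable (fun ω => Z ω i * Z ω j) μ := by
  have key : ∀ i, Integrable (fun ω => Real.exp (Z ω i ^ 2 / L)) μ := fun i => by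
    have := (h.ae_condLaw hL hm hZ (u := fun _ => EuclideanSpace.single i 1)
      (@measurable_const _ _ _ m _) (by simp)).1
    simpa [EuclideanSpace.inner_single_left] using this
  refine (((key i).add (key j)).const_mul L).mono' (by fun_prop)
    (Filter.Eventually.of_forall fun ω => ?_)
  have h1 := Real.add_one_le_exp (Z ω i ^ 2 / L)
  have h2 := Real.add_one_le_exp (Z ω j ^ 2 / L)
  have h3 : Z ω i ^ 2 ≤ L * Real.exp (Z ω i ^ 2 / L) := by
    calc Z ω i ^ 2 = L * (Z ω i ^ 2 / L) := by field_simp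
      _ ≤ _ := by gcongr; linarith
  have h4 : Z ω j ^ 2 ≤ L * Real.exp (Z ω j ^ 2 / L) := by
    calc Z ω j ^ 2 = L * (Z ω j ^ 2 / L) := by field_simp
      _ ≤ _ := by gcongr; linarith
  simp only [Pi.add_apply, Real.norm_eq_abs, mul_add]
  rw [abs_le]
  constructor <;> nlinarith [sq_nonneg (Z ω i + Z ω j), sq_nonneg (Z ω i - Z ω j),
    sq_nonneg (Z ω i), sq_nonneg (Z ω j)]

/-- Only finitely many matrix entries have to be identified with integrals against the conditional
law. Off one null set the quadratic form inequality therefore holds in every direction, in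
particular in a random one. -/
lemma ae_le_integral_inner_sq_condLaw {d : ℕ} {Z u : Ω → EuclideanSpace ℝ (Fin d)} {l : ℝ}
    (hm : m ≤ m0) (hZ : Measurable[m0] Z)
    (hint : ∀ i j, Integrable (fun ω => Z ω i * Z ω j) μ)
    (hpos : ∀ᵐ ω ∂μ,
      (condSecondMoment μ m Z ω - l • (1 : Matrix (Fin d) (Fin d) ℝ)).PosSemidef)
    (hu1 : ∀ ω, ‖u ω‖ = 1) :
    ∀ᵐ ω ∂μ, l ≤ ∫ x, inner ℝ (u ω) x ^ 2 ∂(condLaw μ m Z ω) := by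
  have h1 : ∀ i j, (∀ᵐ ω ∂μ, Integrable (fun x : EuclideanSpace ℝ (Fin d) => x i * x j)
      (condLaw μ m Z ω)) ∧ μ[fun ω => Z ω i * Z ω j | m] =ᵐ[μ]
        fun ω => ∫ x, x i * x j ∂(condLaw μ m Z ω) := fun i j =>
    condExp_condLaw hm hZ (P := fun _ => (0 : ℝ)) (@measurable_const _ _ _ m _)
      (g := fun p : ℝ × EuclideanSpace ℝ (Fin d) => p.2 i * p.2 j) (by fun_prop) (hint i j)
  have h2 := ae_all_iff.2 fun i => ae_all_iff.2 fun j => (h1 i j).1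
  have h3 := ae_all_iff.2 fun i => ae_all_iff.2 fun j => (h1 i j).2
  filter_upwards [hpos, h2, h3] with ω a1 a2 a3
  have h4 := a1.dotProduct_mulVec_nonneg (u ω)
  have h5 : ∫ x, inner ℝ (u ω) x ^ 2 ∂(condLaw μ m Z ω) =
      ∑ i, ∑ j, u ω i * u ω j * ∫ x, x i * x j ∂(condLaw μ m Z ω) := by
    have : ∀ x : EuclideanSpace ℝ (Fin d), inner ℝ (u ω) x ^ 2 =
        ∑ i, ∑ j, u ω i * u ω j * (x i * x j) := fun x => by
      rw [PiLp.inner_apply, sq, Finset.sum_mul_sum]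
      refine Finset.sum_congr rfl fun i _ => Finset.sum_congr rfl fun j _ => ?_
      simp; ring
    simp only [this]
    rw [integral_finsetSum _ fun i _ => integrable_finsetSum _ fun j _ => (a2 i j).const_mul _]
    refine Finset.sum_congr rfl fun i _ => ?_
    rw [integral_finsetSum _ fun j _ => (a2 i j).const_mul _]
    exact Finset.sum_congr rfl fun j _ => integral_const_mul _ _
  have h6 : ∑ i, u ω i ^ 2 = 1 := by
    rw [← EuclideanSpace.real_norm_sq_eq, hu1, one_pow]
  rw [h5]
  have h7 : star (u ω : Fin d → ℝ) ⬝ᵥ ((condSecondMoment μ m Z ω - l • 1).mulVec (u ω)) =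
      (∑ i, ∑ j, u ω i * u ω j * ∫ x, x i * x j ∂(condLaw μ m Z ω)) - l * ∑ i, u ω i ^ 2 := by
    rw [Matrix.sub_mulVec, dotProduct_sub, Matrix.smul_mulVec, Matrix.one_mulVec,
      dotProduct_smul]
    simp only [dotProduct, Matrix.mulVec, condSecondMoment, Matrix.of_apply, a3, Finset.mul_sum,
      smul_eq_mul]
    congr 1
    · refine Finset.sum_congr rfl fun i _ => Finset.sum_congr rfl fun j _ => ?_
      simp; ring
    · refine Finset.sum_congr rfl fun i _ => ?_
      simp only [Pi.star_apply, star_trivial]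
      ring
  have h8 := h7 ▸ h4
  rw [h6] at h8
  linarith

lemma CondPsi2Le.ae_condLaw {Z : Ω → ℝ} {σ : ℝ} (hm : m ≤ m0) (hZ : Measurable[m0] Z)
    (h : CondPsi2Le μ m Z σ) (hmean : μ[Z | m] =ᵐ[μ] 0) :
    ∀ᵐ ω ∂μ, Integrable (fun r => Real.exp ((r / σ) ^ 2)) (condLaw μ m Z ω) ∧
      ∫ r, Real.exp ((r / σ) ^ 2) ∂(condLaw μ m Z ω) ≤ 2 ∧
      Integrable (fun r : ℝ => r) (condLaw μ m Z ω) ∧ ∫ r, r ∂(condLaw μ m Z ω) = 0 := by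
  obtain ⟨hσ, h1, h2⟩ := h
  simp only [sq_abs] at h1 h2
  obtain ⟨h3, h4⟩ := condExp_condLaw hm hZ (P := fun _ => (0 : ℝ)) (@measurable_const _ _ _ m _)
    (g := fun p : ℝ × ℝ => Real.exp ((p.2 / σ) ^ 2)) (by fun_prop) h1
  have hint : Integrable Z μ := by
    refine (h1.const_mul σ).mono' hZ.aestronglyMeasurable (Filter.Eventually.of_forall fun ω => ?_)
    have e1 := Real.add_one_le_exp ((Z ω / σ) ^ 2)
    have e2 : |Z ω / σ| ≤ (Z ω / σ) ^ 2 + 1 := by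
      rw [← sq_abs]; nlinarith [sq_nonneg (|Z ω / σ| - 1)]
    calc ‖Z ω‖ = σ * |Z ω / σ| := by
          rw [abs_div, abs_of_pos hσ, Real.norm_eq_abs]; field_simp
      _ ≤ _ := by gcongr; linarith
  obtain ⟨h5, h6⟩ := condExp_condLaw hm hZ (P := fun _ => (0 : ℝ)) (@measurable_const _ _ _ m _)
    (g := fun p : ℝ × ℝ => p.2) (by fun_prop) hint
  filter_upwards [h2, h3, h4, h5, h6, hmean] with ω a1 a2 a3 a4 a5 a6
  exact ⟨a2, a3 ▸ a1, a4, a5 ▸ a6⟩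

end CondLawBounds

/-! ### The conditional moment recursion for one step. -/

section OneStep

variable {Ω : Type*} {m0 : MeasurableSpace Ω} {μ : Measure Ω} [IsProbabilityMeasure μ] {d : ℕ}
  {X : ℕ → Ω → EuclideanSpace ℝ (Fin d)} {ξ : ℕ → Ω → ℝ}
  {βstar β₀ : EuclideanSpace ℝ (Fin d)} {l L σ : ℝ}

lemma CovariateAssumption.lmax_pos {Ω : Type*} {m0 : MeasurableSpace Ω} {μ : Measure Ω} {d : ℕ}
    {X : ℕ → Ω → EuclideanSpace ℝ (Fin d)} {l L : ℝ} {Y : ℕ → Ω → ℝ} (h : CovariateAssumption μ X Y l L)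
    (hd : 0 < d) : 0 < L :=
  Real.sqrt_pos.1 (h.psi2_le 0 (fun _ => EuclideanSpace.single (⟨0, hd⟩ : Fin d) 1)
    (@measurable_const _ _ _ (pastSigma X Y 0) _) (by simp)).1

/-- Almost surely, the conditional law of the covariate satisfies the moment bounds in a given
measurable direction and in all coordinate directions. -/
lemma CovariateAssumption.ae_condLaw {Y : ℕ → Ω → ℝ} (h : CovariateAssumption μ X Y l L)
    (hY : ∀ t, Measurable (Y t)) (hd : 0 < d) (t : ℕ) {u : Ω → EuclideanSpace ℝ (Fin d)}
    (hu : Measurable[pastSigma X Y t] u) (hu1 : ∀ ω, ‖u ω‖ = 1) :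
    ∀ᵐ ω ∂μ, (Integrable (fun x => Real.exp (inner ℝ (u ω) x ^ 2 / L))
        (condLaw μ (pastSigma X Y t) (X t) ω) ∧
      ∫ x, Real.exp (inner ℝ (u ω) x ^ 2 / L) ∂(condLaw μ (pastSigma X Y t) (X t) ω) ≤ 2) ∧
      (∀ i, Integrable (fun x : EuclideanSpace ℝ (Fin d) => Real.exp (x i ^ 2 / L))
        (condLaw μ (pastSigma X Y t) (X t) ω) ∧
      ∫ x : EuclideanSpace ℝ (Fin d), Real.exp (x i ^ 2 / L)
        ∂(condLaw μ (pastSigma X Y t) (X t) ω) ≤ 2) ∧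
      l ≤ ∫ x, inner ℝ (u ω) x ^ 2 ∂(condLaw μ (pastSigma X Y t) (X t) ω) := by
  have hL := h.lmax_pos hd
  have hm := pastSigma_le h.measurable hY t
  have h1 := ((h.psi2_le t).ae_condLaw hL hm (h.measurable t) hu hu1).2
  have h2 := ae_all_iff.2 fun i => ((h.psi2_le t).ae_condLaw hL hm (h.measurable t)
    (u := fun _ => EuclideanSpace.single i 1)
    (@measurable_const _ _ _ (pastSigma X Y t) _) (by simp)).2
  have h3 := ae_le_integral_inner_sq_condLaw hm (h.measurable t)
    ((h.psi2_le t).integrable_mul hL hm (h.measurable t)) (h.second_moment t) hu1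
  filter_upwards [h1, h2, h3] with ω a1 a2 a3
  refine ⟨a1, fun i => ?_, a3⟩
  simpa [EuclideanSpace.inner_single_left] using a2 i

/-- In a coordinate direction, `z² ≤ L (exp (z² / L) - 1)` has mean at most `L`. -/
lemma CovariateAssumption.lmin_le_lmax {Y : ℕ → Ω → ℝ} (h : CovariateAssumption μ X Y l L)
    (hY : ∀ t, Measurable (Y t)) (hd : 0 < d) : l ≤ L := by
  have hL := h.lmax_pos hd
  obtain ⟨ω, ⟨h1, h2⟩, -, h3⟩ := (h.ae_condLaw hY hd 0
    (u := fun _ => EuclideanSpace.single (⟨0, hd⟩ : Fin d) 1)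
    (@measurable_const _ _ _ (pastSigma X Y 0) _) (by simp)).exists
  refine h3.trans ?_
  set u : EuclideanSpace ℝ (Fin d) := EuclideanSpace.single (⟨0, hd⟩ : Fin d) 1
  have h4 : ∀ x : EuclideanSpace ℝ (Fin d),
      inner ℝ u x ^ 2 ≤ L * (Real.exp (inner ℝ u x ^ 2 / L) - 1) := fun x => by
    calc inner ℝ u x ^ 2 = L * (inner ℝ u x ^ 2 / L) := by field_simp
      _ ≤ _ := by
        gcongr
        linarith [Real.add_one_le_exp (inner ℝ u x ^ 2 / L)]
  have h5 := integral_mono_of_nonneg (Filter.Eventually.of_forall fun x => sq_nonneg _)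
    (((h1.sub (integrable_const 1)).const_mul L)) (Filter.Eventually.of_forall h4)
  rw [integral_const_mul] at h5
  simp only [Pi.sub_apply] at h5
  rw [integral_sub h1 (by fun_prop)] at h5
  simp only [integral_const, probReal_univ, smul_eq_mul, mul_one] at h5
  nlinarith

/-- The squared norm after one step with error `v`, covariate `x` and noise `r`. -/
lemma norm_sub_smul_sq (v x : EuclideanSpace ℝ (Fin d)) (η r : ℝ) :
    ‖v - (η * (inner ℝ x v - r)) • x‖ ^ 2 = ‖v‖ ^ 2 +
      (-2 * η * inner ℝ x v ^ 2 + η ^ 2 * inner ℝ x v ^ 2 * ‖x‖ ^ 2 +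
      (2 * η * inner ℝ x v * (1 - η * ‖x‖ ^ 2) * r + η ^ 2 * ‖x‖ ^ 2 * r ^ 2)) := by
  rw [norm_sub_sq_real, inner_smul_right, norm_smul, real_inner_comm, mul_pow, Real.norm_eq_abs,
    sq_abs]
  ring

/-- With `u` the relative increment of `‖v‖² + s`, this is `(1 + u) ^ p ≤ exp (p u)`. The exponent
is split into a part free of the noise `r` and a part quadratic in `r`, so that the two integrations
can be done one after the other. -/
lemma pow_norm_step_le (v x : EuclideanSpace ℝ (Fin d)) (η r : ℝ) {s : ℝ} (hs : 0 < s) (p : ℕ) :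
    (‖v - (η * (inner ℝ x v - r)) • x‖ ^ 2 + s) ^ p ≤ (‖v‖ ^ 2 + s) ^ p *
      (Real.exp (p / (‖v‖ ^ 2 + s) *
        (-2 * η * inner ℝ x v ^ 2 + η ^ 2 * inner ℝ x v ^ 2 * ‖x‖ ^ 2)) *
      Real.exp ((p / (‖v‖ ^ 2 + s) * (2 * η) * inner ℝ x v * (1 - η * ‖x‖ ^ 2)) * r +
        (p / (‖v‖ ^ 2 + s) * η ^ 2 * ‖x‖ ^ 2) * r ^ 2)) := by
  have hW : 0 < ‖v‖ ^ 2 + s := by positivity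
  rw [← Real.exp_add]
  have h1 := norm_sub_smul_sq v x η r
  obtain ⟨u, hu⟩ : ∃ u, u = (‖v - (η * (inner ℝ x v - r)) • x‖ ^ 2 - ‖v‖ ^ 2) / (‖v‖ ^ 2 + s) :=
    ⟨_, rfl⟩
  have h2 : ‖v - (η * (inner ℝ x v - r)) • x‖ ^ 2 + s = (‖v‖ ^ 2 + s) * (1 + u) := by
    rw [hu]; field_simp; ring
  have h3 : 0 ≤ 1 + u := by
    have : 0 < (‖v‖ ^ 2 + s) * (1 + u) := by rw [← h2]; positivity
    exact (pos_of_mul_pos_right this hW.le).le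
  have h4 : p / (‖v‖ ^ 2 + s) * (-2 * η * inner ℝ x v ^ 2 + η ^ 2 * inner ℝ x v ^ 2 * ‖x‖ ^ 2) +
      ((p / (‖v‖ ^ 2 + s) * (2 * η) * inner ℝ x v * (1 - η * ‖x‖ ^ 2)) * r +
        (p / (‖v‖ ^ 2 + s) * η ^ 2 * ‖x‖ ^ 2) * r ^ 2) = p * u := by
    rw [hu, h1]; field_simp; ring
  rw [h4, h2, mul_pow, Real.exp_nat_mul]
  gcongr
  linarith [Real.add_one_le_exp u]

lemma sgd_succ_sub (Y : ℕ → Ω → ℝ) (η : ℕ → ℝ) (t : ℕ) (ω : Ω)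
    (hY : Y = response X ξ βstar) :
    sgd X Y η β₀ (t + 1) ω - βstar = (sgd X Y η β₀ t ω - βstar) -
      (η t * (inner ℝ (X t ω) (sgd X Y η β₀ t ω - βstar) - ξ t ω)) • X t ω := by
  simp only [sgd, hY, response, inner_sub_right]
  rw [sub_right_comm]
  congr 3
  ring

/-- One step of the conditional moment recursion of the squared error, on the event that the
covariate is not too large. -/
lemma lintegral_pow_step_le (hX : CovariateAssumption μ X (response X ξ βstar) l L)
    (hξ : NoiseAssumption μ X (response X ξ βstar) ξ σ) (hd : 0 < d) (η : ℕ → ℝ) (t p : ℕ)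
    {D s ρ : ℝ} {B : Set Ω} (hB : MeasurableSet[pastSigma X (response X ξ βstar) t] B)
    (hη : 0 < η t) (hdD : d ≤ D) (hp : (p : ℝ) ≤ D / 1048576)
    (hh : L * (D * η t * L) ^ 2 ≤ l) (hs : s = L / l * η t * σ ^ 2 * D)
    (hρ : ρ + L / l * η t * d * L ≤ 7 / 4) :
    ∫⁻ ω in B ∩ {ω | ‖X t ω‖ ^ 2 ≤ 32 * (L * D)}, ENNReal.ofReal
      ((‖sgd X (response X ξ βstar) η β₀ (t + 1) ω - βstar‖ ^ 2 + s) ^ p) ∂μ ≤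
    ∫⁻ ω in B, ENNReal.ofReal ((‖sgd X (response X ξ βstar) η β₀ t ω - βstar‖ ^ 2 + s) ^ p *
      (1 + p * η t * l / (‖sgd X (response X ξ βstar) η β₀ t ω - βstar‖ ^ 2 + s) *
        (-ρ * ‖sgd X (response X ξ βstar) η β₀ t ω - βstar‖ ^ 2 + 3 / 2 * s))) ∂μ := by
  obtain ⟨Y, hY⟩ : ∃ Y, Y = response X ξ βstar := ⟨_, rfl⟩
  rw [← hY] at hX hξ hB ⊢
  have hYm : ∀ t, Measurable (Y t) := fun t => hY ▸ measurable_response βstar hX.measurable hξ.measurable t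
  have hL := hX.lmax_pos hd
  have hl := hX.lmin_pos
  have hlL := hX.lmin_le_lmax hYm hd
  have hσ : 0 < σ := (hξ.psi2_le 0).1
  have hd1 : (1 : ℝ) ≤ d := by exact_mod_cast hd
  have hD1 : 1 ≤ D := hd1.trans hdD
  have hD0 : 0 < D := one_pos.trans_le hD1
  have hs0 : 0 < s := by rw [hs]; positivity
  have hm := pastSigma_le hX.measurable hYm t
  have hmp := pastSigmaPlus_le hX.measurable hYm t
  set V : Ω → EuclideanSpace ℝ (Fin d) := fun ω => sgd X Y η β₀ t ω - βstar with hV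
  have hVm : Measurable[pastSigma X Y t] V :=
    (measurable_sgd Y η β₀ t).sub (@measurable_const _ _ _ (pastSigma X Y t) βstar)
  set e : EuclideanSpace ℝ (Fin d) := EuclideanSpace.single (⟨0, hd⟩ : Fin d) 1 with he
  have he1 : ‖e‖ = 1 := by simp [he]
  set M : Set (EuclideanSpace ℝ (Fin d)) := {x | ‖x‖ ^ 2 ≤ 32 * (L * D)} with hM
  have hMm : MeasurableSet M := measurableSet_le (by fun_prop) measurable_const
  -- the weight of the covariate step
  set A : EuclideanSpace ℝ (Fin d) → EuclideanSpace ℝ (Fin d) → ℝ := fun v x =>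
    Real.exp (p / (‖v‖ ^ 2 + s) * (-2 * η t * inner ℝ x v ^ 2 + η t ^ 2 * inner ℝ x v ^ 2 * ‖x‖ ^ 2))
    with hA
  set b : EuclideanSpace ℝ (Fin d) → EuclideanSpace ℝ (Fin d) → ℝ := fun v x =>
    p / (‖v‖ ^ 2 + s) * (2 * η t) * inner ℝ x v * (1 - η t * ‖x‖ ^ 2) with hb
  set G : EuclideanSpace ℝ (Fin d) → EuclideanSpace ℝ (Fin d) → ℝ := fun v x =>
    p / (‖v‖ ^ 2 + s) * η t ^ 2 * ‖x‖ ^ 2 with hG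
  have hind : ∀ ω, (B ∩ {ω | ‖X t ω‖ ^ 2 ≤ 32 * (L * D)}).indicator (fun ω => ENNReal.ofReal
      ((‖sgd X Y η β₀ (t + 1) ω - βstar‖ ^ 2 + s) ^ p)) ω ≤
      B.indicator (fun _ => 1) ω * M.indicator (fun _ => 1) (X t ω) * ENNReal.ofReal ((‖V ω‖ ^ 2 + s) ^ p * A (V ω) (X t ω)) *
        ENNReal.ofReal (Real.exp (b (V ω) (X t ω) * ξ t ω + G (V ω) (X t ω) * ξ t ω ^ 2)) :=
    fun ω => by
    by_cases h1 : ω ∈ B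
    · by_cases h2 : X t ω ∈ M
      · rw [Set.indicator_of_mem (Set.mem_inter h1 h2), Set.indicator_of_mem h1, Set.indicator_of_mem h2]
        simp only [one_mul]
        rw [← ENNReal.ofReal_mul' (Real.exp_pos _).le]
        refine ENNReal.ofReal_le_ofReal ?_
        rw [sgd_succ_sub Y η t ω hY, mul_assoc]
        exact pow_norm_step_le (V ω) (X t ω) (η t) (ξ t ω) hs0 p
      · rw [Set.indicator_of_notMem fun h => h2 h.2]
        exact zero_le
    · rw [Set.indicator_of_notMem fun h => h1 h.1]
      exact zero_le
  have hBm : MeasurableSet B := hm _ hB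
  have hBi : Measurable[pastSigma X Y t] (B.indicator (fun _ => (1 : ℝ≥0∞))) :=
    @Measurable.indicator Ω ℝ≥0∞ B (fun _ => 1) (pastSigma X Y t) _ _
      (@measurable_const _ _ _ (pastSigma X Y t) (1 : ℝ≥0∞)) hB
  have hMi : Measurable (M.indicator (fun _ => (1 : ℝ≥0∞))) :=
    measurable_const.indicator hMm
  have hle : pastSigma X Y t ≤ pastSigmaPlus X Y t := le_sup_right
  have hXp : Measurable[pastSigmaPlus X Y t] (X t) := Measurable.of_comap_le le_sup_left
  -- integrate the noise out
  have hnoise : ∫⁻ ω, B.indicator (fun _ => 1) ω * M.indicator (fun _ => 1) (X t ω) *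
        ENNReal.ofReal ((‖V ω‖ ^ 2 + s) ^ p * A (V ω) (X t ω)) *
        ENNReal.ofReal (Real.exp (b (V ω) (X t ω) * ξ t ω + G (V ω) (X t ω) * ξ t ω ^ 2)) ∂μ ≤
      ∫⁻ ω, B.indicator (fun _ => 1) ω * M.indicator (fun _ => 1) (X t ω) *
        ENNReal.ofReal ((‖V ω‖ ^ 2 + s) ^ p * A (V ω) (X t ω)) *
        ENNReal.ofReal (Real.exp (4 * (b (V ω) (X t ω) ^ 2 * σ ^ 2)) + G (V ω) (X t ω) * σ ^ 2) ∂μ := by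
    have key := lintegral_condLaw (μ := μ) hmp (hξ.measurable t)
      (P := fun ω => (B.indicator (fun _ => (1 : ℝ≥0∞)) ω, V ω, X t ω))
      ((hBi.mono hle le_rfl).prodMk ((hVm.mono hle le_rfl).prodMk hXp))
      (g := fun q : (ℝ≥0∞ × EuclideanSpace ℝ (Fin d) × EuclideanSpace ℝ (Fin d)) × ℝ =>
        q.1.1 * M.indicator (fun _ => 1) q.1.2.2 *
        ENNReal.ofReal ((‖q.1.2.1‖ ^ 2 + s) ^ p * A q.1.2.1 q.1.2.2) *
        ENNReal.ofReal (Real.exp (b q.1.2.1 q.1.2.2 * q.2 + G q.1.2.1 q.1.2.2 * q.2 ^ 2)))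
      (by simp only [hA, hb, hG]; fun_prop)
    refine key.trans_le (lintegral_mono_ae ?_)
    filter_upwards [(hξ.psi2_le t).ae_condLaw hmp (hξ.measurable t) (hξ.mean_zero t)] with ω hω
    obtain ⟨a1, a2, a3, a4⟩ := hω
    rw [lintegral_const_mul _ (by fun_prop)]
    by_cases h2 : X t ω ∈ M
    · gcongr
      refine lintegral_exp_quadratic_le hσ a1 a2 a3 a4 (by simp only [hG]; positivity) ?_
      have h3 : ‖X t ω‖ ^ 2 ≤ 32 * (L * D) := h2
      have h4 : D * η t * L ≤ 1 := by
        have h5 : L * (D * η t * L) ^ 2 ≤ L * 1 := by linarith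
        exact (sq_le_one_iff₀ (by positivity)).1 (le_of_mul_le_mul_left h5 hL)
      have h6 : D * η t * l ≤ D * η t * L := by gcongr
      -- The denominator is at least `s`, and `s` contains `σ² D`, so that `σ²` cancels and a small
      -- multiple of `D η l` remains.
      calc 2 * (G (V ω) (X t ω) * σ ^ 2)
          = 2 * (p / (‖V ω‖ ^ 2 + s) * η t ^ 2 * ‖X t ω‖ ^ 2 * σ ^ 2) := rfl
        _ ≤ 2 * (D / 1048576 / s * η t ^ 2 * (32 * (L * D)) * σ ^ 2) := by
            gcongr
            linarith [sq_nonneg ‖V ω‖]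
        _ = 64 / 1048576 * (D * η t * l) := by rw [hs]; field_simp; norm_num
        _ ≤ 1 := by linarith
    · simp [Set.indicator_of_notMem h2]
  -- integrate the covariate out
  have hcov : ∫⁻ ω, B.indicator (fun _ => 1) ω * M.indicator (fun _ => 1) (X t ω) *
        ENNReal.ofReal ((‖V ω‖ ^ 2 + s) ^ p * A (V ω) (X t ω)) *
        ENNReal.ofReal (Real.exp (4 * (b (V ω) (X t ω) ^ 2 * σ ^ 2)) + G (V ω) (X t ω) * σ ^ 2) ∂μ ≤
      ∫⁻ ω, B.indicator (fun _ => 1) ω * ENNReal.ofReal ((‖V ω‖ ^ 2 + s) ^ p *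
        (1 + p * η t * l / (‖V ω‖ ^ 2 + s) * (-ρ * ‖V ω‖ ^ 2 + 3 / 2 * s))) ∂μ := by
    have key := lintegral_condLaw (μ := μ) hm (hX.measurable t)
      (P := fun ω => (B.indicator (fun _ => (1 : ℝ≥0∞)) ω, V ω)) (hBi.prodMk hVm)
      (g := fun q : (ℝ≥0∞ × EuclideanSpace ℝ (Fin d)) × EuclideanSpace ℝ (Fin d) =>
        q.1.1 * M.indicator (fun _ => 1) q.2 * ENNReal.ofReal ((‖q.1.2‖ ^ 2 + s) ^ p * A q.1.2 q.2) *
        ENNReal.ofReal (Real.exp (4 * (b q.1.2 q.2 ^ 2 * σ ^ 2)) + G q.1.2 q.2 * σ ^ 2))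
      (by simp only [hA, hb, hG]; fun_prop)
    refine key.trans_le (lintegral_mono_ae ?_)
    filter_upwards [hX.ae_condLaw hYm hd t (u := fun ω => direction e (V ω))
      ((measurable_direction e).comp hVm) fun ω => norm_direction he1 _] with ω hω
    obtain ⟨⟨a1, a2⟩, a3, a4⟩ := hω
    have h1 := lintegral_exp_step_le (V := ‖V ω‖ ^ 2) (P := p) a1 a2 (fun i => (a3 i).1)
      (fun i => (a3 i).2) a4 hl hlL hη hD1 hdD hσ (sq_nonneg _) (Nat.cast_nonneg p) hp hh hs rfl hρ
    simp only [norm_sq_mul_inner_direction_sq] at h1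
    rw [ENNReal.ofReal_mul (by positivity), ← mul_assoc]
    refine le_trans (le_of_eq ?_) (mul_le_mul_right h1 _)
    rw [← lintegral_const_mul]
    · refine lintegral_congr fun x => ?_
      by_cases h2 : x ∈ M
      · have h3 : x ∈ {x : EuclideanSpace ℝ (Fin d) | ‖x‖ ^ 2 ≤ 32 * (L * D)} := h2
        rw [Set.indicator_of_mem h2, Set.indicator_of_mem h3, mul_one,
          ENNReal.ofReal_mul (by positivity), ENNReal.ofReal_mul (Real.exp_pos _).le]
        simp only [hA, hb, hG]
        have h5 : (p / (‖V ω‖ ^ 2 + s) * (2 * η t) * inner ℝ x (V ω) * (1 - η t * ‖x‖ ^ 2)) ^ 2 * σ ^ 2 =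
          (p / (‖V ω‖ ^ 2 + s) * (2 * η t)) ^ 2 * inner ℝ x (V ω) ^ 2 * (1 - η t * ‖x‖ ^ 2) ^ 2 *
            σ ^ 2 := by ring
        rw [h5]
        ring
      · have h3 : x ∉ {x : EuclideanSpace ℝ (Fin d) | ‖x‖ ^ 2 ≤ 32 * (L * D)} := h2
        rw [Set.indicator_of_notMem h2, Set.indicator_of_notMem h3]
        simp
    · refine Measurable.indicator ?_ hMm
      fun_prop
  have hBM : MeasurableSet (B ∩ {ω | ‖X t ω‖ ^ 2 ≤ 32 * (L * D)}) := hBm.inter (hX.measurable t hMm)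
  rw [← lintegral_indicator hBM, ← lintegral_indicator hBm]
  refine (lintegral_mono hind).trans (hnoise.trans (hcov.trans (lintegral_mono fun ω => ?_)))
  by_cases h1 : ω ∈ B <;> simp [h1, hV]

end OneStep

/-! ### A net of lattice directions on the sphere. -/

section LatticeNet

lemma sum_exp_neg_sq_le (R : ℕ) :
    ∑ j ∈ Finset.Icc (-(R : ℤ)) R, Real.exp (-(j : ℝ) ^ 2) ≤ 3 := by
  have hbound : ∀ n : ℕ, Real.exp (-((n : ℝ) + 1) ^ 2) ≤ (1 / 2) ^ (n + 1) := fun n => by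
    have h1 : Real.exp (-((n : ℝ) + 1) ^ 2) ≤ Real.exp ((n + 1 : ℕ) * (-1 : ℝ)) :=
      Real.exp_le_exp.2 (by push_cast; nlinarith [(Nat.cast_nonneg n : (0 : ℝ) ≤ n)])
    rw [Real.exp_nat_mul] at h1
    refine h1.trans (pow_le_pow_left₀ (Real.exp_pos _).le ?_ _)
    rw [Real.exp_neg, one_div]
    exact inv_anti₀ two_pos (by linarith [Real.add_one_le_exp (1 : ℝ)])
  -- The bound is strengthened by the geometric tail so that the induction closes.
  suffices h : ∑ j ∈ Finset.Icc (-(R : ℤ)) R, Real.exp (-(j : ℝ) ^ 2) ≤ 3 - 2 * (1 / 2) ^ R by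
    have : (0 : ℝ) < (1 / 2) ^ R := by positivity
    linarith
  induction R with
  | zero => norm_num
  | succ n ih =>
    have h1 : Finset.Icc (-((n + 1 : ℕ) : ℤ)) ((n + 1 : ℕ) : ℤ) =
        insert (-((n : ℤ) + 1)) (insert ((n : ℤ) + 1) (Finset.Icc (-(n : ℤ)) n)) := by
      ext j
      simp only [Finset.mem_Icc, Finset.mem_insert]
      push_cast
      omega
    rw [h1, Finset.sum_insert, Finset.sum_insert]
    · have := hbound n
      push_cast
      rw [neg_sq, pow_succ (1 / 2 : ℝ)]
      rw [pow_succ (1 / 2 : ℝ)] at this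
      linarith
    · simp
    · simp only [Finset.mem_Icc, Finset.mem_insert]
      omega

/-- A finite set of integer vectors whose directions form a net of the unit sphere. -/
def latticeNet (d : ℕ) : Finset (Fin d → ℤ) :=
  (Fintype.piFinset fun _ => Finset.Icc (-((4 * d : ℕ) : ℤ)) (4 * d : ℕ)).filter
    fun k => ∑ i, (k i : ℝ) ^ 2 ≤ 4 * d

/-- Each point of the net has weight `exp (4 d - ‖k‖²) ≥ 1`, and the total weight over the
surrounding box factorises over the coordinates. -/
lemma card_latticeNet_le (d : ℕ) : ((latticeNet d).card : ℝ) ≤ Real.exp (6 * d) := by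
  have h3 : (3 : ℝ) ≤ Real.exp 2 := by linarith [Real.add_one_le_exp (2 : ℝ)]
  calc ((latticeNet d).card : ℝ) = ∑ k ∈ latticeNet d, (1 : ℝ) := by simp
    _ ≤ ∑ k ∈ latticeNet d, Real.exp (4 * d) * ∏ i, Real.exp (-(k i : ℝ) ^ 2) := by
        refine Finset.sum_le_sum fun k hk => ?_
        rw [← Real.exp_sum, ← Real.exp_add, Finset.sum_neg_distrib]
        exact Real.one_le_exp (by linarith [(Finset.mem_filter.1 hk).2])
    _ ≤ ∑ k ∈ Fintype.piFinset fun _ : Fin d => Finset.Icc (-((4 * d : ℕ) : ℤ)) (4 * d : ℕ),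
          Real.exp (4 * d) * ∏ i, Real.exp (-(k i : ℝ) ^ 2) :=
        Finset.sum_le_sum_of_subset_of_nonneg (Finset.filter_subset _ _)
          fun _ _ _ => by positivity
    _ = Real.exp (4 * d) * ∏ _i : Fin d, ∑ j ∈ Finset.Icc (-((4 * d : ℕ) : ℤ)) (4 * d : ℕ),
          Real.exp (-(j : ℝ) ^ 2) := by
        rw [← Finset.mul_sum, Finset.prod_univ_sum]
    _ ≤ Real.exp (4 * d) * ∏ _i : Fin d, Real.exp 2 := by
        gcongr with i
        exact (sum_exp_neg_sq_le _).trans h3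
    _ = Real.exp (6 * d) := by
        rw [Finset.prod_const, ← Real.exp_nat_mul, ← Real.exp_add]
        simp; ring

/-- Rescale `x` to length `3√d / 2` and round each coordinate. The rounding error is at most `√d /
2`, so the lattice vector has length at most `2√d` and inner product at least `√d ‖x‖` with `x`: the
cosine of the angle is at least `1/2`. -/
lemma exists_latticeNet {d : ℕ} (x : EuclideanSpace ℝ (Fin d)) (hx : x ≠ 0) :
    ∃ k ∈ latticeNet d, (WithLp.toLp 2 fun i => (k i : ℝ) : EuclideanSpace ℝ (Fin d)) ≠ 0 ∧
      ‖x‖ ^ 2 * ‖(WithLp.toLp 2 fun i => (k i : ℝ) : EuclideanSpace ℝ (Fin d))‖ ^ 2 ≤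
        4 * inner ℝ (WithLp.toLp 2 fun i => (k i : ℝ) : EuclideanSpace ℝ (Fin d)) x ^ 2 := by
  have hx0 : 0 < ‖x‖ := norm_pos_iff.2 hx
  have hd : 0 < d := by
    rcases Nat.eq_zero_or_pos d with rfl | h
    · exact absurd (Subsingleton.elim x 0) hx
    · exact h
  have hd0 : (0 : ℝ) < d := by exact_mod_cast hd
  set a : ℝ := 3 / 2 * Real.sqrt d / ‖x‖ with ha
  set k : Fin d → ℤ := fun i => round (a * x i) with hk
  set z : EuclideanSpace ℝ (Fin d) := WithLp.toLp 2 fun i => (k i : ℝ) with hz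
  have hsd : 0 < Real.sqrt d := Real.sqrt_pos.2 hd0
  have hsq : Real.sqrt d ^ 2 = d := Real.sq_sqrt hd0.le
  have hr : ‖z - a • x‖ ≤ Real.sqrt d / 2 := by
    refine (sq_le_sq₀ (norm_nonneg _) (by positivity)).1 ?_
    rw [EuclideanSpace.real_norm_sq_eq, div_pow, hsq]
    calc ∑ i, (z - a • x) i ^ 2 ≤ ∑ i : Fin d, (1 / 4 : ℝ) := by
          refine Finset.sum_le_sum fun i _ => ?_
          have h1 := abs_sub_round (a * x i)
          have h2 : (z - a • x) i = -(a * x i - round (a * x i)) := by simp [hz, hk]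
          rw [h2, neg_sq, ← sq_abs]
          nlinarith [abs_nonneg (a * x i - round (a * x i))]
      _ = _ := by simp; ring
  have hax : ‖a • x‖ = 3 / 2 * Real.sqrt d := by
    rw [norm_smul, Real.norm_of_nonneg (by positivity), ha]; field_simp
  have hz2 : ‖z‖ ≤ 2 * Real.sqrt d := by
    have := norm_add_le (z - a • x) (a • x)
    rw [sub_add_cancel] at this
    linarith
  have hin : Real.sqrt d * ‖x‖ ≤ inner ℝ z x := by
    have h1 : inner ℝ z x = inner ℝ (z - a • x) x + a * ‖x‖ ^ 2 := by
      rw [inner_sub_left, real_inner_smul_left, real_inner_self_eq_norm_sq]; ring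
    have h2 := (abs_le.1 (abs_real_inner_le_norm (z - a • x) x)).1
    have h3 : a * ‖x‖ ^ 2 = 3 / 2 * Real.sqrt d * ‖x‖ := by rw [ha]; field_simp
    have h4 := mul_le_mul_of_nonneg_right hr hx0.le
    rw [h1, h3]
    linarith
  have hzsq : ‖z‖ ^ 2 ≤ 4 * d := by
    have := pow_le_pow_left₀ (norm_nonneg z) hz2 2
    rw [mul_pow, hsq] at this
    linarith
  refine ⟨k, ?_, ?_, ?_⟩
  · have hsum : ∑ i, (k i : ℝ) ^ 2 ≤ 4 * d := by
      rw [EuclideanSpace.real_norm_sq_eq] at hzsq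
      exact hzsq
    refine Finset.mem_filter.2 ⟨Fintype.mem_piFinset.2 fun i => ?_, hsum⟩
    have h1 : (k i : ℝ) ^ 2 ≤ 4 * d :=
      (Finset.single_le_sum (f := fun i => (k i : ℝ) ^ 2) (fun _ _ => sq_nonneg _)
        (Finset.mem_univ i)).trans hsum
    have h2 : k i ^ 2 ≤ 4 * d := by exact_mod_cast h1
    rw [Finset.mem_Icc]
    push_cast
    constructor <;> nlinarith
  · intro h0
    rw [← hz] at h0
    rw [h0, inner_zero_left] at hin
    have : 0 < Real.sqrt d * ‖x‖ := by positivity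
    linarith
  · rw [← hz]
    have h1 := pow_le_pow_left₀ (by positivity) hin 2
    rw [mul_pow, hsq] at h1
    have h2 := mul_le_mul_of_nonneg_left hzsq (sq_nonneg ‖x‖)
    linarith

end LatticeNet

/-! ### Tail of the covariate norm. -/

section Tail

variable {Ω : Type*} {m0 : MeasurableSpace Ω} {μ : Measure Ω} [IsProbabilityMeasure μ] {d : ℕ}
  {X : ℕ → Ω → EuclideanSpace ℝ (Fin d)} {l L : ℝ}

lemma CovariateAssumption.measure_direction_le {Y : ℕ → Ω → ℝ} (h : CovariateAssumption μ X Y l L)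
    (hY : ∀ t, Measurable (Y t)) (hd : 0 < d) (t : ℕ) {B : Set Ω}
    (hB : MeasurableSet[pastSigma X Y t] B) {u : EuclideanSpace ℝ (Fin d)} (hu : ‖u‖ = 1) (a : ℝ) :
    μ (B ∩ {ω | a ≤ inner ℝ u (X t ω) ^ 2 / L}) ≤ ENNReal.ofReal (2 * Real.exp (-a)) * μ B := by
  have hm := pastSigma_le h.measurable hY t
  have hBm : MeasurableSet B := hm _ hB
  have hXm := h.measurable t
  have hBi : Measurable[pastSigma X Y t] (B.indicator (fun _ => (1 : ℝ≥0∞))) :=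
    @Measurable.indicator Ω ℝ≥0∞ B (fun _ => 1) (pastSigma X Y t) _ _
      (@measurable_const _ _ _ (pastSigma X Y t) (1 : ℝ≥0∞)) hB
  have key := lintegral_condLaw (μ := μ) hm hXm hBi
    (g := fun q : ℝ≥0∞ × EuclideanSpace ℝ (Fin d) => q.1 * ENNReal.ofReal
      (Real.exp (inner ℝ u q.2 ^ 2 / L))) (by fun_prop)
  have h1 : ∫⁻ ω, B.indicator (fun _ => 1) ω * ENNReal.ofReal (Real.exp (inner ℝ u (X t ω) ^ 2 / L)) ∂μ ≤
      2 * μ B := by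
    refine key.trans_le ?_
    calc _ ≤ ∫⁻ ω, B.indicator (fun _ => 1) ω * 2 ∂μ := by
          refine lintegral_mono_ae ?_
          filter_upwards [h.ae_condLaw hY hd t (u := fun _ => u)
            (@measurable_const _ _ _ (pastSigma X Y t) u) (fun _ => hu)] with ω hω
          rw [lintegral_const_mul _ (by fun_prop)]
          gcongr
          rw [← ofReal_integral_eq_lintegral_ofReal hω.1.1
            (Filter.Eventually.of_forall fun _ => (Real.exp_pos _).le)]
          simpa using ENNReal.ofReal_le_ofReal hω.1.2
      _ = 2 * μ B := by
          rw [lintegral_mul_const _ (measurable_const.indicator hBm), mul_comm]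
          congr 1
          rw [lintegral_indicator hBm]; simp
  have hS : MeasurableSet (B ∩ {ω | a ≤ inner ℝ u (X t ω) ^ 2 / L}) :=
    hBm.inter (measurableSet_le measurable_const (by fun_prop))
  have h2 : μ (B ∩ {ω | a ≤ inner ℝ u (X t ω) ^ 2 / L}) ≤ ENNReal.ofReal (Real.exp (-a)) *
      ∫⁻ ω, B.indicator (fun _ => 1) ω * ENNReal.ofReal (Real.exp (inner ℝ u (X t ω) ^ 2 / L)) ∂μ := by
    rw [← lintegral_indicator_one hS, ← lintegral_const_mul' _ _ ENNReal.ofReal_ne_top]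
    refine lintegral_mono fun ω => ?_
    by_cases hω : ω ∈ B ∩ {ω | a ≤ inner ℝ u (X t ω) ^ 2 / L}
    · rw [Set.indicator_of_mem hω, Set.indicator_of_mem hω.1, one_mul,
        ← ENNReal.ofReal_mul (Real.exp_pos _).le, ← Real.exp_add, Pi.one_apply, ENNReal.one_le_ofReal]
      exact Real.one_le_exp (by have : a ≤ inner ℝ u (X t ω) ^ 2 / L := hω.2; linarith)
    · rw [Set.indicator_of_notMem hω]
      exact zero_le
  calc _ ≤ _ := h2
    _ ≤ ENNReal.ofReal (Real.exp (-a)) * (2 * μ B) := by gcongr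
    _ = _ := by
        rw [← mul_assoc, mul_comm 2 (Real.exp (-a)), ENNReal.ofReal_mul (Real.exp_pos _).le]
        simp

/-- The conditional tail of the norm of the covariate. -/
lemma CovariateAssumption.measure_norm_sq_gt_le {Y : ℕ → Ω → ℝ} (h : CovariateAssumption μ X Y l L)
    (hY : ∀ t, Measurable (Y t)) (hd : 0 < d) (t : ℕ) {B : Set Ω}
    (hB : MeasurableSet[pastSigma X Y t] B) {D : ℝ} (hdD : d ≤ D) :
    μ (B ∩ {ω | 32 * (L * D) < ‖X t ω‖ ^ 2}) ≤ ENNReal.ofReal (Real.exp (-D)) * μ B := by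
  have hL := h.lmax_pos hd
  have hd1 : (1 : ℝ) ≤ d := by exact_mod_cast hd
  set z : (Fin d → ℤ) → EuclideanSpace ℝ (Fin d) := fun k => WithLp.toLp 2 fun i => (k i : ℝ) with hz
  set N := (latticeNet d).filter fun k => z k ≠ 0 with hN
  -- The net loses a factor 4, so some lattice direction reaches level `32 / 4 = 8` times `D`. Its
  -- tail `2 exp (-8 D)` beats the `exp (6 d)` directions and leaves `exp (-D)`, since `6 d + 1 ≤ 7
  -- D`.
  have hsub : B ∩ {ω | 32 * (L * D) < ‖X t ω‖ ^ 2} ⊆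
      ⋃ k ∈ N, B ∩ {ω | 8 * D ≤ inner ℝ (‖z k‖⁻¹ • z k) (X t ω) ^ 2 / L} := fun ω hω => by
    have h1 : 32 * (L * D) < ‖X t ω‖ ^ 2 := hω.2
    have hX0 : X t ω ≠ 0 := by
      intro h0
      rw [h0] at h1
      have : 0 < L * D := mul_pos hL (by linarith)
      norm_num at h1
      linarith
    obtain ⟨k, hk, hk0, hk1⟩ := exists_latticeNet (X t ω) hX0
    refine Set.mem_biUnion (Finset.mem_filter.2 ⟨hk, hk0⟩) ⟨hω.1, ?_⟩
    have hzk : 0 < ‖z k‖ := norm_pos_iff.2 hk0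
    have h2 : ‖X t ω‖ ^ 2 * ‖z k‖ ^ 2 ≤ 4 * inner ℝ (z k) (X t ω) ^ 2 := hk1
    change 8 * D ≤ _
    rw [real_inner_smul_left, mul_pow, le_div_iff₀ hL, inv_pow, inv_mul_eq_div,
      le_div_iff₀ (by positivity)]
    have h3 := mul_le_mul_of_nonneg_right h1.le (sq_nonneg ‖z k‖)
    linarith
  have hcard : (N.card : ℝ) ≤ Real.exp (6 * d) :=
    (by exact_mod_cast Finset.card_filter_le _ _ : (N.card : ℝ) ≤ (latticeNet d).card).trans
      (card_latticeNet_le d)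
  have h2 : (2 : ℝ) ≤ Real.exp 1 := by linarith [Real.add_one_le_exp (1 : ℝ)]
  calc _ ≤ _ := measure_mono hsub
    _ ≤ ∑ k ∈ N, μ (B ∩ {ω | 8 * D ≤ inner ℝ (‖z k‖⁻¹ • z k) (X t ω) ^ 2 / L}) :=
        measure_biUnion_finset_le _ _
    _ ≤ ∑ k ∈ N, ENNReal.ofReal (2 * Real.exp (-(8 * D))) * μ B := by
        refine Finset.sum_le_sum fun k hk => h.measure_direction_le hY hd t hB ?_ _
        rw [norm_smul, norm_inv, norm_norm,
          inv_mul_cancel₀ (norm_ne_zero_iff.2 (Finset.mem_filter.1 hk).2)]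
    _ = ENNReal.ofReal (N.card * (2 * Real.exp (-(8 * D)))) * μ B := by
        rw [Finset.sum_const, nsmul_eq_mul, ← mul_assoc, ENNReal.ofReal_mul (Nat.cast_nonneg _),
          ENNReal.ofReal_natCast]
    _ ≤ ENNReal.ofReal (Real.exp (-D)) * μ B := by
        gcongr
        calc N.card * (2 * Real.exp (-(8 * D))) ≤
            Real.exp (6 * d) * (Real.exp 1 * Real.exp (-(8 * D))) := by gcongr
          _ = Real.exp (6 * d + (1 + -(8 * D))) := by rw [← Real.exp_add, ← Real.exp_add]
          _ ≤ Real.exp (-D) := Real.exp_le_exp.2 (by linarith)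

end Tail

/-! ### Comparison of moments with a deterministic envelope. -/

/-- The noise contributes a multiple of `W ^ (p - 1)`. Young's inequality relative to the scale `w`
converts it into `W ^ p` and a constant, so that the recursion closes on the `p`-th moment alone. -/
lemma pow_mul_drift_le {W w s a b : ℝ} {p : ℕ} (hW : 0 < W) (hw : 0 < w) (hb : 0 ≤ b) (hs : 0 ≤ s)
    (hp : 1 ≤ p) :
    W ^ p * (1 + p / W * (-a * W + b * s)) ≤
      w ^ p * ((1 - p * a + (p - 1) * (b * s / w)) * (W / w) ^ p + b * s / w) := by
  obtain ⟨n, rfl⟩ : ∃ n, p = n + 1 := ⟨p - 1, by omega⟩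
  obtain ⟨r, hr⟩ : ∃ r, r = W / w := ⟨_, rfl⟩
  obtain ⟨β, hβ⟩ : ∃ β, β = b * s / w := ⟨_, rfl⟩
  have hr0 : 0 < r := by rw [hr]; positivity
  have hβ0 : 0 ≤ β := by rw [hβ]; positivity
  have hWr : W = w * r := by rw [hr]; field_simp
  have hbs : b * s = w * β := by rw [hβ]; field_simp
  -- Bernoulli's inequality at `1 / r`, multiplied by `r ^ (n + 1)`.
  have hyoung : (n + 1) * r ^ n ≤ n * r ^ (n + 1) + 1 := by
    have h1 := one_add_mul_le_pow (a := r⁻¹ - 1) (by have := inv_pos.2 hr0; linarith) (n + 1)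
    rw [add_sub_cancel, inv_pow] at h1
    have h2 := mul_le_mul_of_nonneg_right h1 (pow_pos hr0 (n + 1)).le
    rw [inv_mul_cancel₀ (pow_pos hr0 (n + 1)).ne'] at h2
    have h3 : (1 + ((n + 1 : ℕ) : ℝ) * (r⁻¹ - 1)) * r ^ (n + 1) = (n + 1) * r ^ n - n * r ^ (n + 1) := by
      rw [pow_succ]; push_cast; field_simp; ring
    rw [h3] at h2
    linarith
  rw [← hβ, ← hr, hbs, hWr]
  have h4 : (w * r) ^ (n + 1) * (1 + ((n + 1 : ℕ) : ℝ) / (w * r) * (-a * (w * r) + w * β)) =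
      w ^ (n + 1) * ((1 - (n + 1) * a) * r ^ (n + 1) + β * ((n + 1) * r ^ n)) := by
    rw [mul_pow]; push_cast; field_simp; ring
  rw [h4]
  have := mul_le_mul_of_nonneg_left hyoung hβ0
  refine mul_le_mul_of_nonneg_left ?_ (by positivity)
  push_cast
  linarith

section Iterate

variable {Ω : Type*} {m0 : MeasurableSpace Ω} {μ : Measure Ω} [IsProbabilityMeasure μ] {d : ℕ}
  {X : ℕ → Ω → EuclideanSpace ℝ (Fin d)} {ξ : ℕ → Ω → ℝ}
  {βstar β₀ : EuclideanSpace ℝ (Fin d)} {l L σ : ℝ}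

/-- Rewriting `-ρ V + 3/2 s` as `-ρ W + (ρ + 3/2) s` puts the drift in the form of
`pow_mul_drift_le`. The coefficients of the normalised moment and of the constant add up to `1 - p a
+ p β`, which Bernoulli's inequality bounds by `(1 - a + β) ^ p ≤ (w' / w) ^ p`. Since `c` bounds
both the moment and `μ B`, it is passed on unchanged. -/
lemma lintegral_envelope_step_le (hX : CovariateAssumption μ X (response X ξ βstar) l L)
    (hξ : NoiseAssumption μ X (response X ξ βstar) ξ σ) (hd : 0 < d) (η : ℕ → ℝ) (t p : ℕ)
    {D s s' ρ w w' : ℝ} {B : Set Ω} {c : ℝ≥0∞}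
    (hB : MeasurableSet[pastSigma X (response X ξ βstar) t] B)
    (hη : 0 < η t) (hdD : d ≤ D) (hp : (p : ℝ) ≤ D / 1048576) (hp1 : 1 ≤ p)
    (hh : L * (D * η t * L) ^ 2 ≤ l) (hs : s = L / l * η t * σ ^ 2 * D) (hs' : s' ≤ s) (hs'0 : 0 ≤ s')
    (hρ0 : 0 ≤ ρ) (hρ : ρ + L / l * η t * d * L ≤ 7 / 4) (hw : 0 < w) (hw' : 0 < w')
    (hww : w * (1 - ρ * (η t * l)) + (ρ + 3 / 2) * (η t * l) * s ≤ w')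
    (hBc : μ B ≤ c)
    (hc : ∫⁻ ω in B, ENNReal.ofReal
      (((‖sgd X (response X ξ βstar) η β₀ t ω - βstar‖ ^ 2 + s) / w) ^ p) ∂μ ≤ c) :
    ∫⁻ ω in B ∩ {ω | ‖X t ω‖ ^ 2 ≤ 32 * (L * D)}, ENNReal.ofReal
      (((‖sgd X (response X ξ βstar) η β₀ (t + 1) ω - βstar‖ ^ 2 + s') / w') ^ p) ∂μ ≤ c := by
  have hYm : ∀ t, Measurable (response X ξ βstar t) :=
    measurable_response βstar hX.measurable hξ.measurable
  have hL := hX.lmax_pos hd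
  have hl := hX.lmin_pos
  have hlL := hX.lmin_le_lmax hYm hd
  have hσ : 0 < σ := (hξ.psi2_le 0).1
  have hd1 : (1 : ℝ) ≤ d := by exact_mod_cast hd
  have hD0 : 0 < D := by linarith
  have hs0 : 0 < s := by rw [hs]; positivity
  have hm := pastSigma_le hX.measurable hYm t
  have hp1' : (1 : ℝ) ≤ p := by exact_mod_cast hp1
  have hVm : Measurable (sgd X (response X ξ βstar) η β₀ t) :=
    (measurable_sgd (response X ξ βstar) η β₀ t).mono hm le_rfl
  obtain ⟨a, ha⟩ : ∃ a, a = ρ * (η t * l) := ⟨_, rfl⟩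
  obtain ⟨b, hb⟩ : ∃ b, b = (ρ + 3 / 2) * (η t * l) := ⟨_, rfl⟩
  obtain ⟨β, hβ⟩ : ∃ β, β = b * s / w := ⟨_, rfl⟩
  have ha0 : 0 ≤ a := by rw [ha]; positivity
  have hb0 : 0 ≤ b := by rw [hb]; positivity
  have hβ0 : 0 ≤ β := by rw [hβ]; positivity
  -- Needed so that the coefficient of the moment is nonnegative. It holds because `p` is a small
  -- multiple of `D` while `D η l ≤ D η L ≤ 1`.
  have hpa : p * a ≤ 1 := by
    have h4 : D * η t * L ≤ 1 := by
      have h5 : L * (D * η t * L) ^ 2 ≤ L * 1 := by linarith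
      exact (sq_le_one_iff₀ (by positivity)).1 (le_of_mul_le_mul_left h5 hL)
    have h6 : D * η t * l ≤ D * η t * L := by gcongr
    have h7 : ρ ≤ 7 / 4 := by
      have : 0 ≤ L / l * η t * d * L := by positivity
      linarith
    calc p * a ≤ D / 1048576 * (7 / 4 * (η t * l)) := by rw [ha]; gcongr
      _ = 7 / 4 / 1048576 * (D * η t * l) := by ring
      _ ≤ 1 := by linarith
  have ha1 : a ≤ 1 := le_trans (le_mul_of_one_le_left ha0 hp1') hpa
  have hθ1 : 0 ≤ 1 - p * a + (p - 1) * β := by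
    have := mul_nonneg (sub_nonneg.2 hp1') hβ0
    linarith
  have hwβ : w * (1 - a + β) ≤ w' := by
    have : w * (1 - a + β) = w * (1 - a) + b * s := by rw [hβ]; field_simp
    rw [this, ha, hb]; exact hww
  have hbern : w ^ p * (1 - p * a + p * β) ≤ w' ^ p := by
    have h1 := one_add_mul_le_pow (a := -a + β) (by linarith) p
    calc w ^ p * (1 - p * a + p * β) = w ^ p * (1 + p * (-a + β)) := by ring
      _ ≤ w ^ p * (1 + (-a + β)) ^ p := by gcongr
      _ = (w * (1 - a + β)) ^ p := by rw [← mul_pow]; ring_nf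
      _ ≤ w' ^ p := pow_le_pow_left₀ (mul_nonneg hw.le (by linarith)) hwβ p
  set V : Ω → ℝ := fun ω => ‖sgd X (response X ξ βstar) η β₀ t ω - βstar‖ ^ 2 with hV
  set V' : Ω → ℝ := fun ω => ‖sgd X (response X ξ βstar) η β₀ (t + 1) ω - βstar‖ ^ 2 with hV'
  have hstep := lintegral_pow_step_le (β₀ := β₀) hX hξ hd η t p hB hη hdD hp hh hs hρ
  have h1 : ∫⁻ ω in B ∩ {ω | ‖X t ω‖ ^ 2 ≤ 32 * (L * D)}, ENNReal.ofReal (((V' ω + s') / w') ^ p) ∂μ ≤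
      ENNReal.ofReal ((w' ^ p)⁻¹) *
        ∫⁻ ω in B ∩ {ω | ‖X t ω‖ ^ 2 ≤ 32 * (L * D)}, ENNReal.ofReal ((V' ω + s) ^ p) ∂μ := by
    rw [← lintegral_const_mul' _ _ ENNReal.ofReal_ne_top]
    refine lintegral_mono fun ω => ?_
    rw [← ENNReal.ofReal_mul (by positivity)]
    refine ENNReal.ofReal_le_ofReal ?_
    rw [div_pow, div_eq_inv_mul]
    have : 0 ≤ V' ω := sq_nonneg _
    gcongr
  have h2 : ∫⁻ ω in B, ENNReal.ofReal ((V ω + s) ^ p *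
      (1 + p * η t * l / (V ω + s) * (-ρ * V ω + 3 / 2 * s))) ∂μ ≤
      ∫⁻ ω in B, (ENNReal.ofReal (w ^ p * (1 - p * a + (p - 1) * β)) *
        ENNReal.ofReal (((V ω + s) / w) ^ p) + ENNReal.ofReal (w ^ p * β)) ∂μ := by
    refine lintegral_mono fun ω => ?_
    have hVω : 0 ≤ V ω := sq_nonneg _
    rw [← ENNReal.ofReal_mul (by positivity), ← ENNReal.ofReal_add (by positivity) (by positivity)]
    refine ENNReal.ofReal_le_ofReal ?_
    have h3 := pow_mul_drift_le (W := V ω + s) (w := w) (s := s) (a := a) (b := b) (p := p)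
      (by positivity) hw hb0 hs0.le hp1
    rw [← hβ] at h3
    calc _ = (V ω + s) ^ p * (1 + p / (V ω + s) * (-a * (V ω + s) + b * s)) := by
          rw [ha, hb]; ring
      _ ≤ _ := h3
      _ = _ := by ring
  have h3 : ∫⁻ ω in B, (ENNReal.ofReal (w ^ p * (1 - p * a + (p - 1) * β)) *
        ENNReal.ofReal (((V ω + s) / w) ^ p) + ENNReal.ofReal (w ^ p * β)) ∂μ ≤
      ENNReal.ofReal (w' ^ p) * c := by
    rw [lintegral_add_right _ measurable_const, lintegral_const_mul' _ _ ENNReal.ofReal_ne_top,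
      setLIntegral_const]
    calc _ ≤ ENNReal.ofReal (w ^ p * (1 - p * a + (p - 1) * β)) * c +
          ENNReal.ofReal (w ^ p * β) * c := by gcongr
      _ = ENNReal.ofReal (w ^ p * (1 - p * a + p * β)) * c := by
          rw [← add_mul, ← ENNReal.ofReal_add (by positivity) (by positivity)]
          ring_nf
      _ ≤ _ := by gcongr
  calc _ ≤ _ := h1
    _ ≤ ENNReal.ofReal ((w' ^ p)⁻¹) * (ENNReal.ofReal (w' ^ p) * c) := by
        gcongr
        exact (hstep.trans h2).trans h3
    _ = c := by
        rw [← mul_assoc, ← ENNReal.ofReal_mul (by positivity),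
          inv_mul_cancel₀ (pow_pos hw' p).ne', ENNReal.ofReal_one, one_mul]

lemma measurableSet_truncation (Y : ℕ → Ω → ℝ) {t₀ T : ℕ} (hT : t₀ ≤ T) {B : Set Ω} (b : ℕ → ℝ)
    (hB : MeasurableSet[pastSigma X Y t₀] B) :
    MeasurableSet[pastSigma X Y T] (B ∩ {ω | ∀ t, t₀ ≤ t → t < T → ‖X t ω‖ ^ 2 ≤ b t}) := by
  refine @MeasurableSet.inter _ (pastSigma X Y T) _ _ (pastSigma_mono Y hT _ hB) ?_
  simp only [Set.ofPred_forall]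
  refine @MeasurableSet.iInter _ _ (pastSigma X Y T) _ _ fun t =>
    @MeasurableSet.iInter _ _ (pastSigma X Y T) _ _ fun _ =>
    @MeasurableSet.iInter _ _ (pastSigma X Y T) _ _ fun h => ?_
  have hXt : Measurable[pastSigma X Y T] (X t) := measurable_pastSigma_covariate Y h
  exact @measurableSet_le ℝ Ω _ _ _ (pastSigma X Y T) _ _ _ _ _ ((measurable_norm.pow_const 2).comp hXt)
    (@measurable_const _ _ _ (pastSigma X Y T) (b t))

/-- The moments of the squared error stay below the moments of a deterministic envelope. -/
lemma lintegral_envelope_le (hX : CovariateAssumption μ X (response X ξ βstar) l L)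
    (hξ : NoiseAssumption μ X (response X ξ βstar) ξ σ) (hd : 0 < d) (η : ℕ → ℝ) (p : ℕ)
    {D ρ : ℝ} {s w : ℕ → ℝ} {B : Set Ω} {t₀ T : ℕ} (hT : t₀ ≤ T)
    (hB : MeasurableSet[pastSigma X (response X ξ βstar) t₀] B)
    (hdD : d ≤ D) (hp : (p : ℝ) ≤ D / 1048576) (hp1 : 1 ≤ p) (hρ0 : 0 ≤ ρ)
    (hη : ∀ t, t₀ ≤ t → 0 < η t)
    (hh : ∀ t, t₀ ≤ t → L * (D * η t * L) ^ 2 ≤ l)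
    (hs : ∀ t, t₀ ≤ t → s t = L / l * η t * σ ^ 2 * D) (hs' : ∀ t, t₀ ≤ t → s (t + 1) ≤ s t)
    (hρ : ∀ t, t₀ ≤ t → ρ + L / l * η t * d * L ≤ 7 / 4) (hw : ∀ t, t₀ ≤ t → 0 < w t)
    (hww : ∀ t, t₀ ≤ t →
      w t * (1 - ρ * (η t * l)) + (ρ + 3 / 2) * (η t * l) * s t ≤ w (t + 1))
    (hstart : ∀ ω ∈ B, ‖sgd X (response X ξ βstar) η β₀ t₀ ω - βstar‖ ^ 2 + s t₀ ≤ w t₀) :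
    ∫⁻ ω in B ∩ {ω | ∀ t, t₀ ≤ t → t < T → ‖X t ω‖ ^ 2 ≤ 32 * (L * D)}, ENNReal.ofReal
      (((‖sgd X (response X ξ βstar) η β₀ T ω - βstar‖ ^ 2 + s T) / w T) ^ p) ∂μ ≤ μ B := by
  have hYm : ∀ t, Measurable (response X ξ βstar t) :=
    measurable_response βstar hX.measurable hξ.measurable
  have hL := hX.lmax_pos hd
  have hl := hX.lmin_pos
  have hd1 : (1 : ℝ) ≤ d := by exact_mod_cast hd
  have hD0 : 0 ≤ D := by linarith
  have hs0 : ∀ t, t₀ ≤ t → 0 ≤ s t := fun t ht => by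
    have := hη t ht
    rw [hs t ht]; positivity
  induction T, hT using Nat.le_induction with
  | base =>
    have hBm : MeasurableSet B := pastSigma_le hX.measurable hYm t₀ _ hB
    have h0 : {ω | ∀ t, t₀ ≤ t → t < t₀ → ‖X t ω‖ ^ 2 ≤ 32 * (L * D)} = Set.univ :=
      Set.eq_univ_of_forall fun ω t h1 h2 => absurd h1 (not_le.2 h2)
    rw [h0, Set.inter_univ]
    calc _ ≤ ∫⁻ _ in B, 1 ∂μ := by
          refine setLIntegral_mono measurable_const fun ω hω => ?_
          rw [ENNReal.ofReal_le_one]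
          have h1 := hs0 t₀ le_rfl
          have h2 := hw t₀ le_rfl
          exact pow_le_one₀ (div_nonneg (add_nonneg (sq_nonneg _) h1) h2.le)
            ((div_le_one h2).2 (hstart ω hω))
      _ = μ B := by simp
  | succ T hT ih =>
    have hmeas := measurableSet_truncation (response X ξ βstar) hT (fun _ => 32 * (L * D)) hB
    have hset : B ∩ {ω | ∀ t, t₀ ≤ t → t < T + 1 → ‖X t ω‖ ^ 2 ≤ 32 * (L * D)} =
        (B ∩ {ω | ∀ t, t₀ ≤ t → t < T → ‖X t ω‖ ^ 2 ≤ 32 * (L * D)}) ∩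
          {ω | ‖X T ω‖ ^ 2 ≤ 32 * (L * D)} := by
      ext ω
      constructor
      · rintro ⟨h1, h2⟩
        exact ⟨⟨h1, fun t h3 h4 => h2 t h3 (h4.trans T.lt_succ_self)⟩, h2 T hT T.lt_succ_self⟩
      · rintro ⟨⟨h1, h2⟩, h3⟩
        refine ⟨h1, fun t h4 h5 => ?_⟩
        rcases Nat.lt_succ_iff_lt_or_eq.1 h5 with h6 | rfl
        · exact h2 t h4 h6
        · exact h3
    rw [hset]
    exact lintegral_envelope_step_le hX hξ hd η T p hmeas (hη T hT) hdD hp hp1 (hh T hT) (hs T hT)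
      (hs' T hT) (hs0 (T + 1) (hT.trans T.le_succ)) hρ0 (hρ T hT) (hw T hT)
      (hw (T + 1) (hT.trans T.le_succ)) (hww T hT) (measure_mono Set.inter_subset_left) ih

/-- Exceeding a multiple of the envelope is exponentially unlikely. -/
lemma measure_envelope_lt_le (hX : CovariateAssumption μ X (response X ξ βstar) l L)
    (hξ : NoiseAssumption μ X (response X ξ βstar) ξ σ) (hd : 0 < d) (η : ℕ → ℝ) (p : ℕ)
    {D ρ : ℝ} {s w : ℕ → ℝ} {B : Set Ω} {t₀ T : ℕ} (hT : t₀ ≤ T)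
    (hB : MeasurableSet[pastSigma X (response X ξ βstar) t₀] B)
    (hdD : d ≤ D) (hp : (p : ℝ) ≤ D / 1048576) (hp1 : 1 ≤ p) (hρ0 : 0 ≤ ρ)
    (hη : ∀ t, t₀ ≤ t → 0 < η t)
    (hh : ∀ t, t₀ ≤ t → L * (D * η t * L) ^ 2 ≤ l)
    (hs : ∀ t, t₀ ≤ t → s t = L / l * η t * σ ^ 2 * D) (hs' : ∀ t, t₀ ≤ t → s (t + 1) ≤ s t)
    (hρ : ∀ t, t₀ ≤ t → ρ + L / l * η t * d * L ≤ 7 / 4) (hw : ∀ t, t₀ ≤ t → 0 < w t)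
    (hww : ∀ t, t₀ ≤ t →
      w t * (1 - ρ * (η t * l)) + (ρ + 3 / 2) * (η t * l) * s t ≤ w (t + 1))
    (hstart : ∀ ω ∈ B, ‖sgd X (response X ξ βstar) η β₀ t₀ ω - βstar‖ ^ 2 + s t₀ ≤ w t₀)
    {θ : ℝ} (hθ : 0 < θ) :
    μ (B ∩ {ω | ∀ t, t₀ ≤ t → t < T → ‖X t ω‖ ^ 2 ≤ 32 * (L * D)} ∩
      {ω | θ * w T < ‖sgd X (response X ξ βstar) η β₀ T ω - βstar‖ ^ 2 + s T}) ≤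
      ENNReal.ofReal (θ⁻¹ ^ p) * μ B := by
  have hYm : ∀ t, Measurable (response X ξ βstar t) :=
    measurable_response βstar hX.measurable hξ.measurable
  have key := lintegral_envelope_le hX hξ hd η p hT hB hdD hp hp1 hρ0 hη hh hs hs' hρ hw hww hstart
  set E := B ∩ {ω | ∀ t, t₀ ≤ t → t < T → ‖X t ω‖ ^ 2 ≤ 32 * (L * D)} with hE
  have hm := pastSigma_le hX.measurable hYm T
  have hEm : MeasurableSet E := hm _ (measurableSet_truncation _ hT (fun _ => 32 * (L * D)) hB)
  have hVm : Measurable (sgd X (response X ξ βstar) η β₀ T) :=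
    (measurable_sgd (response X ξ βstar) η β₀ T).mono hm le_rfl
  have hSm : MeasurableSet (E ∩ {ω | θ * w T < ‖sgd X (response X ξ βstar) η β₀ T ω - βstar‖ ^ 2 + s T}) :=
    hEm.inter (measurableSet_lt measurable_const (by fun_prop))
  have hwT := hw T hT
  calc _ = ∫⁻ _ in E ∩ {ω | θ * w T < ‖sgd X (response X ξ βstar) η β₀ T ω - βstar‖ ^ 2 + s T}, 1 ∂μ := by
        simp
    _ ≤ ∫⁻ ω in E ∩ {ω | θ * w T < ‖sgd X (response X ξ βstar) η β₀ T ω - βstar‖ ^ 2 + s T},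
        ENNReal.ofReal (θ⁻¹ ^ p) * ENNReal.ofReal
          (((‖sgd X (response X ξ βstar) η β₀ T ω - βstar‖ ^ 2 + s T) / w T) ^ p) ∂μ := by
        refine setLIntegral_mono (by fun_prop) fun ω hω => ?_
        have h1 : θ * w T < ‖sgd X (response X ξ βstar) η β₀ T ω - βstar‖ ^ 2 + s T := hω.2
        rw [← ENNReal.ofReal_mul (by positivity), ← mul_pow, ENNReal.one_le_ofReal]
        refine one_le_pow₀ ?_
        rw [inv_mul_eq_div, le_div_iff₀ hθ, le_div_iff₀ hwT]
        linarith
    _ ≤ ∫⁻ ω in E, ENNReal.ofReal (θ⁻¹ ^ p) * ENNReal.ofReal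
          (((‖sgd X (response X ξ βstar) η β₀ T ω - βstar‖ ^ 2 + s T) / w T) ^ p) ∂μ :=
        lintegral_mono_set Set.inter_subset_left
    _ ≤ _ := by
        rw [lintegral_const_mul' _ _ ENNReal.ofReal_ne_top]
        gcongr

end Iterate

/-! ### From bounds on bad events to probabilities. -/

section Probability

variable {Ω : Type*} {m0 : MeasurableSpace Ω} {μ : Measure Ω} [IsProbabilityMeasure μ]

lemma one_sub_mul_measureReal_le {A G : Set Ω} {x : ℝ} (hx : 0 ≤ x)
    (h : μ (A \ G) ≤ ENNReal.ofReal x * μ A) : (1 - x) * μ.real A ≤ μ.real (A ∩ G) := by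
  have h1 : μ.real A ≤ μ.real (A ∩ G) + μ.real (A \ G) := by
    calc μ.real A = μ.real (A ∩ G ∪ A \ G) := by rw [Set.inter_union_sdiff]
      _ ≤ _ := measureReal_union_le _ _
  have h2 : μ.real (A \ G) ≤ x * μ.real A := by
    have := ENNReal.toReal_mono (ENNReal.mul_ne_top ENNReal.ofReal_ne_top (measure_ne_top μ A)) h
    rwa [ENNReal.toReal_mul, ENNReal.toReal_ofReal hx] at this
  linarith

lemma CondPsi2Le.integral_le {m : MeasurableSpace Ω} {Z : Ω → ℝ} {K : ℝ} (hm : m ≤ m0)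
    (h : CondPsi2Le μ m Z K) : ∫ ω, Real.exp (|Z ω / K| ^ 2) ∂μ ≤ 2 := by
  rw [← integral_condExp hm]
  calc _ ≤ ∫ _, (2 : ℝ) ∂μ := integral_mono_ae integrable_condExp (by fun_prop) h.2.2
    _ = 2 := by simp

end Probability

/-! ### Constant stepsize. -/

section ConstantStep

variable {Ω : Type*} {m0 : MeasurableSpace Ω} {μ : Measure Ω} [IsProbabilityMeasure μ] {d : ℕ}
  {X : ℕ → Ω → EuclideanSpace ℝ (Fin d)} {ξ : ℕ → Ω → ℝ}
  {βstar β₀ : EuclideanSpace ℝ (Fin d)} {l L σ : ℝ}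

/-- Both terms are at most `exp (-2 c D)` with `c = 1 / 20971520`. Half of the exponent pays for the
factor 2, because `c D ≥ 1`. -/
lemma two_mul_exp_neg_le {D p : ℝ} (hD : 20971520 ≤ D) (hp : D / 1048576 / 2 ≤ p) {θ : ℝ}
    (hθ : 0 ≤ θ) (hθ1 : θ ≤ 4 / 5) {n : ℕ} (hn : (n : ℝ) = p) :
    Real.exp (-D) + θ ^ n ≤ Real.exp (-(1 / 20971520) * D) := by
  have h1 : θ ^ n ≤ Real.exp (-(1 / 10485760) * D) := by
    calc θ ^ n ≤ Real.exp (-(1 / 5)) ^ n := by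
          gcongr
          linarith [Real.add_one_le_exp (-(1 / 5) : ℝ)]
      _ = Real.exp (n * -(1 / 5)) := by rw [Real.exp_nat_mul]
      _ ≤ _ := Real.exp_le_exp.2 (by rw [hn]; linarith)
  have h2 : Real.exp (-D) ≤ Real.exp (-(1 / 10485760) * D) := Real.exp_le_exp.2 (by linarith)
  have h3 : 2 * Real.exp (-(1 / 10485760) * D) ≤ Real.exp (-(1 / 20971520) * D) := by
    have : Real.exp (-(1 / 20971520) * D) =
        Real.exp (1 / 20971520 * D) * Real.exp (-(1 / 10485760) * D) := by
      rw [← Real.exp_add]; ring_nf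
    rw [this]
    gcongr
    linarith [Real.add_one_le_exp (1 / 20971520 * D)]
  linarith

lemma exists_nat_moment {D : ℝ} (hD : 20971520 ≤ D) :
    ∃ p : ℕ, 1 ≤ p ∧ (p : ℝ) ≤ D / 1048576 ∧ D / 1048576 / 2 ≤ p := by
  have h1 : 1 ≤ D / 1048576 := by rw [le_div_iff₀ (by norm_num)]; linarith
  refine ⟨⌊D / 1048576⌋₊, Nat.one_le_floor_iff _ |>.2 h1, Nat.floor_le (by linarith), ?_⟩
  have := Nat.lt_floor_add_one (D / 1048576)
  have h2 : (1 : ℝ) ≤ ⌊D / 1048576⌋₊ := by exact_mod_cast Nat.one_le_floor_iff _ |>.2 h1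
  linarith

lemma constant_step_of_large (hX : CovariateAssumption μ X (response X ξ βstar) l L)
    (hξ : NoiseAssumption μ X (response X ξ βstar) ξ σ) (hd : 20971520 ≤ (d : ℝ)) {η : ℝ}
    (hη : 0 < η) (hη1 : η ≤ l / (d * L ^ 2)) (t : ℕ) :
    1 - ((t : ℝ) + 1) * Real.exp (-(1 / 20971520) * d) ≤
      μ.real {ω | ‖sgd X (response X ξ βstar) (fun _ => η) β₀ (t + 1) ω - βstar‖ ^ 2 ≤
        5 * (1 - η * l / 2) ^ (t + 1) * ‖β₀ - βstar‖ ^ 2 + 5 * (L / l) * η * σ ^ 2 * d} := by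
  have hd0 : 0 < d := by
    have : (0 : ℝ) < d := by linarith
    exact_mod_cast this
  have hd1 : (0 : ℝ) < d := by linarith
  have hYm : ∀ t, Measurable (response X ξ βstar t) :=
    measurable_response βstar hX.measurable hξ.measurable
  have hL := hX.lmax_pos hd0
  have hl := hX.lmin_pos
  have hlL := hX.lmin_le_lmax hYm hd0
  have hσ : 0 < σ := (hξ.psi2_le 0).1
  have hηdL : η * d * L ≤ l / L := by
    rw [le_div_iff₀ (by positivity)] at hη1 ⊢
    linarith
  have hlL1 : l / L ≤ 1 := (div_le_one hL).2 hlL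
  have hκ : L / l * η * d * L ≤ 1 := by
    calc L / l * η * d * L = L / l * (η * d * L) := by ring
      _ ≤ L / l * (l / L) := by gcongr
      _ = 1 := by field_simp
  have hηl : η * l ≤ 1 := by
    have h1 : η * l ≤ η * d * L := by
      have : (1 : ℝ) ≤ d := by linarith
      calc η * l ≤ η * L := by gcongr
        _ = η * 1 * L := by ring
        _ ≤ _ := by gcongr
    linarith
  obtain ⟨p, hp1, hp, hp2⟩ := exists_nat_moment hd
  obtain ⟨s, hs⟩ : ∃ s, s = L / l * η * σ ^ 2 * d := ⟨_, rfl⟩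
  have hs0 : 0 < s := by rw [hs]; positivity
  -- With `ρ = 1/2`, the value `4 s` is the fixed point of the scalar recursion, since `(ρ + 3/2) /
  -- ρ = 4`. The level `θ = 5/4` then turns it into `5 s`.
  obtain ⟨w, hw⟩ : ∃ w : ℕ → ℝ, ∀ t, w t = (1 - η * l / 2) ^ t * ‖β₀ - βstar‖ ^ 2 + 4 * s :=
    ⟨_, fun _ => rfl⟩
  have hq : 0 ≤ 1 - η * l / 2 := by linarith
  have hw0 : ∀ t, 0 < w t := fun t => by rw [hw]; positivity
  have key := measure_envelope_lt_le (β₀ := β₀) hX hξ hd0 (fun _ => η) p (D := d) (ρ := 1 / 2)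
    (s := fun _ => s) (w := w) (B := Set.univ) (Nat.zero_le (t + 1))
    (@MeasurableSet.univ _ (pastSigma X _ 0)) le_rfl hp hp1 (by norm_num) (fun _ _ => hη)
    (fun _ _ => by
      have h1 : d * η * L ≤ l / L := by linarith
      calc L * (d * η * L) ^ 2 ≤ L * (l / L) ^ 2 := by gcongr
        _ = l * (l / L) := by field_simp
        _ ≤ l * 1 := by gcongr
        _ = l := mul_one l)
    (fun _ _ => hs) (fun _ _ => le_rfl) (fun _ _ => by linarith) (fun t _ => hw0 t)
    (fun t _ => by rw [hw, hw, pow_succ (1 - η * l / 2)]; linarith)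
    (fun ω _ => by rw [hw]; simp only [sgd, pow_zero, one_mul]; linarith)
    (θ := 5 / 4) (by norm_num)
  have htail : ∀ i, μ {ω | 32 * (L * d) < ‖X i ω‖ ^ 2} ≤ ENNReal.ofReal (Real.exp (-d)) := fun i => by
    have := hX.measure_norm_sq_gt_le hYm hd0 i (@MeasurableSet.univ _ (pastSigma X _ i))
      (le_refl (d : ℝ))
    simpa using this
  set G := {ω | ‖sgd X (response X ξ βstar) (fun _ => η) β₀ (t + 1) ω - βstar‖ ^ 2 ≤
        5 * (1 - η * l / 2) ^ (t + 1) * ‖β₀ - βstar‖ ^ 2 + 5 * (L / l) * η * σ ^ 2 * d} with hG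
  have hbad : μ (Set.univ \ G) ≤
      ENNReal.ofReal (((t : ℝ) + 1) * Real.exp (-(1 / 20971520) * d)) * μ Set.univ := by
    have hsub : Set.univ \ G ⊆ (⋃ i ∈ Finset.range (t + 1), {ω | 32 * (L * d) < ‖X i ω‖ ^ 2}) ∪
        (Set.univ ∩ {ω | ∀ i, 0 ≤ i → i < t + 1 → ‖X i ω‖ ^ 2 ≤ 32 * (L * d)} ∩
        {ω | 5 / 4 * w (t + 1) <
          ‖sgd X (response X ξ βstar) (fun _ => η) β₀ (t + 1) ω - βstar‖ ^ 2 + s}) := fun ω hω => by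
      by_cases h1 : ∀ i, 0 ≤ i → i < t + 1 → ‖X i ω‖ ^ 2 ≤ 32 * (L * d)
      · refine Or.inr ⟨⟨trivial, h1⟩, ?_⟩
        by_contra h2
        refine hω.2 ?_
        have h3 : ‖sgd X (response X ξ βstar) (fun _ => η) β₀ (t + 1) ω - βstar‖ ^ 2 + s ≤
          5 / 4 * w (t + 1) := not_lt.1 h2
        have h4 : 0 ≤ (1 - η * l / 2) ^ (t + 1) * ‖β₀ - βstar‖ ^ 2 := by positivity
        have h5 : 5 * (L / l) * η * σ ^ 2 * d = 5 * s := by rw [hs]; ring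
        rw [hw] at h3
        rw [hG, Set.mem_ofPred_eq]
        rw [h5]
        linarith
      · push Not at h1
        obtain ⟨i, -, h2, h3⟩ := h1
        exact Or.inl (Set.mem_biUnion (Finset.mem_coe.2 (Finset.mem_range.2 h2)) h3)
    calc μ (Set.univ \ G) ≤ _ := measure_mono hsub
      _ ≤ _ := measure_union_le _ _
      _ ≤ ∑ i ∈ Finset.range (t + 1), ENNReal.ofReal (Real.exp (-d)) +
          ENNReal.ofReal ((5 / 4 : ℝ)⁻¹ ^ p) * μ Set.univ :=
          add_le_add ((measure_biUnion_finset_le _ _).trans (Finset.sum_le_sum fun i _ => htail i)) key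
      _ = ENNReal.ofReal (((t : ℝ) + 1) * Real.exp (-d) + (5 / 4 : ℝ)⁻¹ ^ p) := by
          rw [measure_univ, mul_one, Finset.sum_const, Finset.card_range, nsmul_eq_mul,
            ENNReal.ofReal_add (by positivity) (by positivity), ENNReal.ofReal_mul (by positivity)]
          congr 2
          rw [← Nat.cast_succ, ENNReal.ofReal_natCast]
      _ ≤ _ := by
          rw [measure_univ, mul_one]
          refine ENNReal.ofReal_le_ofReal ?_
          have h1 := two_mul_exp_neg_le hd hp2 (θ := (5 / 4 : ℝ)⁻¹) (by norm_num) (by norm_num) rfl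
          have h2 : 0 ≤ (t : ℝ) * (5 / 4 : ℝ)⁻¹ ^ p := by positivity
          have h3 := mul_le_mul_of_nonneg_left h1 (show (0 : ℝ) ≤ t + 1 by positivity)
          linarith
  have := one_sub_mul_measureReal_le (by positivity) hbad
  simpa using this

/-- For bounded `d` the claim after one step still has content: some fixed positive probability is
required. Markov's inequality gives `‖X_0‖² ≤ 2 d L` and `ξ_0² ≤ 3/2 σ²` outside probability `1/2 +
9/20`. On that event `η ‖X_0‖² ≤ 2`, so the noiseless step does not increase the error. -/
lemma constant_step_first (hX : CovariateAssumption μ X (response X ξ βstar) l L)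
    (hξ : NoiseAssumption μ X (response X ξ βstar) ξ σ) (hd : 0 < d) {η : ℝ}
    (hη : 0 < η) (hη1 : η ≤ l / (d * L ^ 2)) :
    1 / 20 ≤ μ.real {ω | ‖sgd X (response X ξ βstar) (fun _ => η) β₀ 1 ω - βstar‖ ^ 2 ≤
        5 * (1 - η * l / 2) ^ 1 * ‖β₀ - βstar‖ ^ 2 + 5 * (L / l) * η * σ ^ 2 * d} := by
  have hd1 : (1 : ℝ) ≤ d := by exact_mod_cast hd
  have hYm : ∀ t, Measurable (response X ξ βstar t) :=
    measurable_response βstar hX.measurable hξ.measurable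
  have hL := hX.lmax_pos hd
  have hl := hX.lmin_pos
  have hlL := hX.lmin_le_lmax hYm hd
  have hσ : 0 < σ := (hξ.psi2_le 0).1
  have hηdL : η * d * L ≤ l / L := by
    rw [le_div_iff₀ (by positivity)] at hη1 ⊢
    linarith
  have hlL1 : l / L ≤ 1 := (div_le_one hL).2 hlL
  have hηL : η * L ≤ 1 := by
    calc η * L = η * 1 * L := by ring
      _ ≤ η * d * L := by gcongr
      _ ≤ 1 := by linarith
  have hηl : η * l ≤ 1 := (mul_le_mul_of_nonneg_left hlL hη.le).trans hηL
  have hcoord : ∀ i : Fin d, Integrable (fun ω => Real.exp (X 0 ω i ^ 2 / L)) μ ∧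
      ∫ ω, Real.exp (X 0 ω i ^ 2 / L) ∂μ ≤ 2 := fun i => by
    have h1 := hX.psi2_le 0 (fun _ => EuclideanSpace.single i 1)
      (@measurable_const _ _ _ (pastSigma X (response X ξ βstar) 0) _) (by simp)
    have h2 := h1.integral_le (pastSigma_le hX.measurable hYm 0)
    have h3 := h1.2.1
    simp only [sq_abs, div_pow, Real.sq_sqrt hL.le] at h2 h3
    constructor
    · simpa [EuclideanSpace.inner_single_left] using h3
    · simpa [EuclideanSpace.inner_single_left] using h2
  have hXtail : μ.real {ω | 2 * (d : ℝ) ≤ ∑ i, (Real.exp (X 0 ω i ^ 2 / L) - 1)} ≤ 1 / 2 := by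
    have h1 := mul_meas_ge_le_integral_of_nonneg (μ := μ)
      (f := fun ω => ∑ i, (Real.exp (X 0 ω i ^ 2 / L) - 1))
      (Filter.Eventually.of_forall fun ω => Finset.sum_nonneg fun i _ =>
        sub_nonneg.2 (Real.one_le_exp (by positivity)))
      (integrable_finsetSum _ fun i _ => (hcoord i).1.sub (integrable_const 1)) (2 * (d : ℝ))
    have h2 : ∫ ω, ∑ i, (Real.exp (X 0 ω i ^ 2 / L) - 1) ∂μ ≤ d := by
      have hint : ∀ i ∈ Finset.univ, Integrable (fun ω => Real.exp (X 0 ω i ^ 2 / L) - 1) μ :=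
        fun i _ => (hcoord i).1.sub (integrable_const 1)
      rw [integral_finsetSum _ hint]
      calc _ ≤ ∑ i : Fin d, (1 : ℝ) := Finset.sum_le_sum fun i _ => by
            rw [integral_sub (hcoord i).1 (integrable_const 1)]
            have := (hcoord i).2
            simp only [integral_const, probReal_univ, smul_eq_mul]
            linarith
        _ = d := by simp
    have h3 : 2 * (d : ℝ) * μ.real {ω | 2 * (d : ℝ) ≤ ∑ i, (Real.exp (X 0 ω i ^ 2 / L) - 1)} ≤
      2 * d * (1 / 2) := by linarith
    exact le_of_mul_le_mul_left h3 (by positivity)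
  have hξtail : μ.real {ω | Real.exp (3 / 2) ≤ Real.exp (|ξ 0 ω / σ| ^ 2)} ≤ 9 / 20 := by
    have h1 := mul_meas_ge_le_integral_of_nonneg (μ := μ)
      (f := fun ω => Real.exp (|ξ 0 ω / σ| ^ 2))
      (Filter.Eventually.of_forall fun ω => (Real.exp_pos _).le) (hξ.psi2_le 0).2.1 (Real.exp (3 / 2))
    have h2 := (hξ.psi2_le 0).integral_le (pastSigmaPlus_le hX.measurable hYm 0)
    have h3 : (40 / 9 : ℝ) ≤ Real.exp (3 / 2) := by
      have h4 : Real.exp (3 / 2) ^ 2 = Real.exp 1 ^ 3 := by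
        rw [← Real.exp_nat_mul, ← Real.exp_nat_mul]; norm_num
      have h5 : (2.718 : ℝ) ^ 3 ≤ Real.exp 1 ^ 3 :=
        pow_le_pow_left₀ (by norm_num) (by linarith [Real.exp_one_gt_d9]) 3
      refine (sq_le_sq₀ (by norm_num) (Real.exp_pos _).le).1 ?_
      rw [h4]
      exact le_trans (by norm_num) h5
    have h6 : (40 / 9 : ℝ) * μ.real {ω | Real.exp (3 / 2) ≤ Real.exp (|ξ 0 ω / σ| ^ 2)} ≤ 2 :=
      (mul_le_mul_of_nonneg_right h3 measureReal_nonneg).trans (h1.trans h2)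
    linarith
  set G := {ω | ‖sgd X (response X ξ βstar) (fun _ => η) β₀ 1 ω - βstar‖ ^ 2 ≤
        5 * (1 - η * l / 2) ^ 1 * ‖β₀ - βstar‖ ^ 2 + 5 * (L / l) * η * σ ^ 2 * d} with hG
  have hcover : Set.univ ⊆ G ∪ ({ω | 2 * (d : ℝ) ≤ ∑ i, (Real.exp (X 0 ω i ^ 2 / L) - 1)} ∪
      {ω | Real.exp (3 / 2) ≤ Real.exp (|ξ 0 ω / σ| ^ 2)}) := fun ω _ => by
    by_contra hω
    simp only [Set.mem_union, not_or] at hω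
    obtain ⟨h0, h1, h2⟩ := hω
    have h3 : ‖X 0 ω‖ ^ 2 ≤ 2 * d * L := by
      rw [EuclideanSpace.real_norm_sq_eq, ← div_le_iff₀ hL, Finset.sum_div]
      refine (Finset.sum_le_sum fun i _ => ?_).trans (not_le.1 h1).le
      linarith [Real.add_one_le_exp (X 0 ω i ^ 2 / L)]
    have h4 : ξ 0 ω ^ 2 ≤ 3 / 2 * σ ^ 2 := by
      have := Real.exp_lt_exp.1 (not_le.1 h2)
      rw [sq_abs, div_pow, div_lt_iff₀ (by positivity)] at this
      exact this.le
    refine h0 ?_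
    rw [hG, Set.mem_ofPred_eq]
    have h5 := sgd_succ_sub (X := X) (ξ := ξ) (β₀ := β₀) (response X ξ βstar) (fun _ => η) 0 ω rfl
    rw [zero_add] at h5
    simp only [sgd] at h5 ⊢
    rw [h5]
    set v := β₀ - βstar
    have h6 : v - (η * (inner ℝ (X 0 ω) v - ξ 0 ω)) • X 0 ω =
        (v - (η * (inner ℝ (X 0 ω) v - 0)) • X 0 ω) + (η * ξ 0 ω) • X 0 ω := by
      module
    have h7 : ‖v - (η * (inner ℝ (X 0 ω) v - 0)) • X 0 ω‖ ^ 2 ≤ ‖v‖ ^ 2 := by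
      rw [norm_sub_smul_sq]
      have h8 : η * ‖X 0 ω‖ ^ 2 ≤ 2 := by
        calc η * ‖X 0 ω‖ ^ 2 ≤ η * (2 * d * L) := by gcongr
          _ = 2 * (η * d * L) := by ring
          _ ≤ 2 := by linarith
      have h9 : 0 ≤ η * inner ℝ (X 0 ω) v ^ 2 := by positivity
      have := mul_le_mul_of_nonneg_left h8 h9
      linarith
    have h8 : ‖(η * ξ 0 ω) • X 0 ω‖ ^ 2 ≤ 3 * (L / l) * η * σ ^ 2 * d := by
      rw [norm_smul, mul_pow, Real.norm_eq_abs, sq_abs, mul_pow]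
      calc η ^ 2 * ξ 0 ω ^ 2 * ‖X 0 ω‖ ^ 2 ≤ η ^ 2 * (3 / 2 * σ ^ 2) * (2 * d * L) := by gcongr
        _ = 3 * η * σ ^ 2 * d * (η * L) := by ring
        _ ≤ 3 * η * σ ^ 2 * d * 1 := by gcongr
        _ ≤ 3 * η * σ ^ 2 * d * (L / l) := by gcongr; exact (one_le_div hl).2 hlL
        _ = _ := by ring
    have h9 : 1 / 2 * ‖v‖ ^ 2 ≤ (1 - η * l / 2) ^ 1 * ‖v‖ ^ 2 := by
      rw [pow_one]; gcongr; linarith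
    rw [h6]
    set a := v - (η * (inner ℝ (X 0 ω) v - 0)) • X 0 ω
    set b := (η * ξ 0 ω) • X 0 ω
    -- The weights satisfy `2/5 + 3/5 = 1`. They are matched to `1 - η l / 2 ≥ 1/2` and to the
    -- constant 3 in the noise bound, so that both terms end with the constant 5.
    have h10 : ‖a + b‖ ^ 2 ≤ 5 / 2 * ‖a‖ ^ 2 + 5 / 3 * ‖b‖ ^ 2 := by
      have := pow_le_pow_left₀ (norm_nonneg _) (norm_add_le a b) 2
      nlinarith [sq_nonneg (3 * ‖a‖ - 2 * ‖b‖)]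
    linarith
  have h1 : (1 : ℝ) ≤ μ.real G + (1 / 2 + 9 / 20) := by
    calc (1 : ℝ) = μ.real Set.univ := by simp
      _ ≤ _ := measureReal_mono hcover
      _ ≤ _ := measureReal_union_le _ _
      _ ≤ μ.real G + (1 / 2 + 9 / 20) := by
        gcongr
        exact (measureReal_union_le _ _).trans (add_le_add hXtail hξtail)
  linarith

/-- The exponent is `1/20` of the one for large `d`, so that `exp (-c d) ≥ 19/20` below the
threshold. The claim is then void from the second step on, and asks for at most `1/20` at the first.
-/
lemma constant_step (hX : CovariateAssumption μ X (response X ξ βstar) l L)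
    (hξ : NoiseAssumption μ X (response X ξ βstar) ξ σ) (hd : 0 < d) {η : ℝ}
    (hη : 0 < η) (hη1 : η ≤ l / (d * L ^ 2)) (t : ℕ) :
    1 - ((t : ℝ) + 1) * Real.exp (-(1 / 419430400) * d) ≤
      μ.real {ω | ‖sgd X (response X ξ βstar) (fun _ => η) β₀ (t + 1) ω - βstar‖ ^ 2 ≤
        5 * (1 - η * l / 2) ^ (t + 1) * ‖β₀ - βstar‖ ^ 2 + 5 * (L / l) * η * σ ^ 2 * d} := by
  rcases le_or_gt 20971520 (d : ℝ) with hd1 | hd1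
  · refine le_trans ?_ (constant_step_of_large hX hξ hd1 hη hη1 t)
    gcongr
    norm_num
  · have h1 : 19 / 20 ≤ Real.exp (-(1 / 419430400) * d) := by
      linarith [Real.add_one_le_exp (-(1 / 419430400) * (d : ℝ))]
    rcases Nat.eq_zero_or_pos t with rfl | ht
    · refine le_trans ?_ (constant_step_first hX hξ hd hη hη1)
      norm_num at h1 ⊢
      linarith
    · have h2 : (1 : ℝ) ≤ t := by exact_mod_cast ht
      refine le_trans ?_ measureReal_nonneg
      nlinarith

lemma constant_step_burn_in (hX : CovariateAssumption μ X (response X ξ βstar) l L)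
    (hξ : NoiseAssumption μ X (response X ξ βstar) ξ σ) (hd : 0 < d) {η : ℝ}
    (hη : 0 < η) (hη1 : η ≤ l / (d * L ^ 2)) (t₁ : ℕ)
    (ht : 4 / (η * l) * Real.log (‖β₀ - βstar‖ / (Real.sqrt (η * d) * σ)) ≤ (t₁ : ℝ)) :
    1 - (t₁ : ℝ) * Real.exp (-(1 / 419430400) * d) ≤
      μ.real {ω | ‖sgd X (response X ξ βstar) (fun _ => η) β₀ t₁ ω - βstar‖ ^ 2 ≤
        10 * (L / l) * η * σ ^ 2 * d} := by
  have hd1 : (1 : ℝ) ≤ d := by exact_mod_cast hd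
  have hYm : ∀ t, Measurable (response X ξ βstar t) :=
    measurable_response βstar hX.measurable hξ.measurable
  have hL := hX.lmax_pos hd
  have hl := hX.lmin_pos
  have hlL := hX.lmin_le_lmax hYm hd
  have hσ : 0 < σ := (hξ.psi2_le 0).1
  have hκ : 1 ≤ L / l := (one_le_div hl).2 hlL
  have hηl : η * l ≤ 1 := by
    calc η * l ≤ l / (d * L ^ 2) * l := by gcongr
      _ = (l / L) ^ 2 / d := by field_simp
      _ ≤ 1 / 1 := by
        gcongr
        exact pow_le_one₀ (by positivity) ((div_le_one hL).2 hlL)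
      _ = 1 := by norm_num
  have hq : 0 ≤ 1 - η * l / 2 := by linarith
  -- The burn-in time makes `exp (-t₁ η l / 2)` at most `r⁻²`. When `β₀ = β*` the bound is trivial.
  have hburn : (1 - η * l / 2) ^ t₁ * ‖β₀ - βstar‖ ^ 2 ≤ η * d * σ ^ 2 := by
    rcases eq_or_lt_of_le (norm_nonneg (β₀ - βstar)) with h0 | h0
    · rw [← h0]
      have : 0 ≤ η * d * σ ^ 2 := by positivity
      simpa using this
    · have hR : 0 < Real.sqrt (η * d) * σ := by positivity
      set r := ‖β₀ - βstar‖ / (Real.sqrt (η * d) * σ) with hr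
      have hr0 : 0 < r := by positivity
      have h1 : (1 - η * l / 2) ^ t₁ ≤ (r ^ 2)⁻¹ := by
        calc (1 - η * l / 2) ^ t₁ ≤ Real.exp (-(η * l / 2)) ^ t₁ := by
              gcongr
              linarith [Real.add_one_le_exp (-(η * l / 2))]
          _ = Real.exp (t₁ * -(η * l / 2)) := by rw [Real.exp_nat_mul]
          _ ≤ Real.exp (-(2 * Real.log r)) := by
              refine Real.exp_le_exp.2 ?_
              have h2 := mul_le_mul_of_nonneg_right ht (show 0 ≤ η * l / 2 by positivity)
              have h3 : 4 / (η * l) * Real.log r * (η * l / 2) = 2 * Real.log r := by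
                field_simp; ring
              linarith
          _ = (r ^ 2)⁻¹ := by
              rw [Real.exp_neg, two_mul, Real.exp_add, Real.exp_log hr0, sq]
      calc _ ≤ (r ^ 2)⁻¹ * ‖β₀ - βstar‖ ^ 2 := by gcongr
        _ = η * d * σ ^ 2 := by
          have h4 : ‖β₀ - βstar‖ = r * (Real.sqrt (η * d) * σ) := by rw [hr]; field_simp
          rw [h4, mul_pow, mul_pow, Real.sq_sqrt (by positivity)]
          field_simp
  have hle : η * d * σ ^ 2 ≤ (L / l) * η * σ ^ 2 * d := by
    calc η * d * σ ^ 2 = 1 * η * σ ^ 2 * d := by ring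
      _ ≤ _ := by gcongr
  -- `constant_step` starts at time 1. At time 0 the burn-in bound already gives the claim for every
  -- outcome.
  rcases Nat.eq_zero_or_pos t₁ with rfl | ht1
  · have h1 : {ω | ‖sgd X (response X ξ βstar) (fun _ => η) β₀ 0 ω - βstar‖ ^ 2 ≤
        10 * (L / l) * η * σ ^ 2 * d} = Set.univ := by
      refine Set.eq_univ_of_forall fun ω => ?_
      rw [Set.mem_ofPred_eq]
      simp only [sgd]
      rw [pow_zero, one_mul] at hburn
      have : 0 ≤ (L / l) * η * σ ^ 2 * d := by positivity
      linarith
    rw [h1]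
    simp
  · obtain ⟨t, rfl⟩ : ∃ t, t₁ = t + 1 := ⟨t₁ - 1, by omega⟩
    have h1 := constant_step (β₀ := β₀) hX hξ hd hη hη1 t
    rw [← Nat.cast_succ] at h1
    refine h1.trans (measureReal_mono fun ω hω => ?_)
    have h2 : ‖sgd X (response X ξ βstar) (fun _ => η) β₀ (t + 1) ω - βstar‖ ^ 2 ≤ _ := hω
    rw [Set.mem_ofPred_eq]
    linarith

end ConstantStep

/-! ### Decaying stepsizes: envelopes and restarts. -/

section Decay

variable {Ω : Type*} {m0 : MeasurableSpace Ω} {μ : Measure Ω} [IsProbabilityMeasure μ] {d : ℕ}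
  {X : ℕ → Ω → EuclideanSpace ℝ (Fin d)} {ξ : ℕ → Ω → ℝ}
  {βstar β₀ : EuclideanSpace ℝ (Fin d)} {l L σ Ca Cb : ℝ} {η : ℕ → ℝ} {t₁ : ℕ}

lemma effective_sample_size_ge {N : ℝ} {t t₁ : ℕ} (ht : t₁ ≤ t) : N ≤ (t : ℝ) - t₁ + N := by
  have : (t₁ : ℝ) ≤ t := by exact_mod_cast ht
  linarith

/-- From a bound at time `t₀` to a bound at time `T`, in the decaying stepsize regime. -/
lemma measure_decay_lt_le (hX : CovariateAssumption μ X (response X ξ βstar) l L)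
    (hξ : NoiseAssumption μ X (response X ξ βstar) ξ σ) (hd : 0 < d)
    (hCa : 2 ≤ Ca) (hCb : 3 * Ca ^ 2 * (L ^ 2 / l ^ 2) ≤ Cb)
    (hη : ∀ t : ℕ, t₁ ≤ t → η t = (Ca / l) / ((t : ℝ) - t₁ + Cb * d)) {t₀ T : ℕ} (ht₀ : t₁ ≤ t₀)
    (hT : t₀ ≤ T) {D E v₀ : ℝ} (hdD : d ≤ D) (hE : 20971520 ≤ E) (hED : E ≤ D) (hv₀ : 0 ≤ v₀)
    (hH : L * (D * η t₀ * L) ^ 2 ≤ l) {B : Set Ω}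
    (hB : MeasurableSet[pastSigma X (response X ξ βstar) t₀] B)
    (hBv : ∀ ω ∈ B, ‖sgd X (response X ξ βstar) η β₀ t₀ ω - βstar‖ ^ 2 ≤ v₀) :
    μ (B ∩ {ω | ∀ t, t₀ ≤ t → t < T → ‖X t ω‖ ^ 2 ≤ 32 * (L * D)} ∩
      {ω | 2 * (v₀ * (((t₀ : ℝ) - t₁ + Cb * d) / ((T : ℝ) - t₁ + Cb * d)) ^ 3 +
        5 * (L / l * η T * σ ^ 2 * D)) < ‖sgd X (response X ξ βstar) η β₀ T ω - βstar‖ ^ 2}) ≤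
      ENNReal.ofReal (Real.exp (-(1 / 20971520) * E) - Real.exp (-E)) * μ B := by
  have hD := hE.trans hED
  have hd1 : (1 : ℝ) ≤ d := by exact_mod_cast hd
  have hYm : ∀ t, Measurable (response X ξ βstar t) :=
    measurable_response βstar hX.measurable hξ.measurable
  have hL := hX.lmax_pos hd
  have hl := hX.lmin_pos
  have hlL := hX.lmin_le_lmax hYm hd
  have hσ : 0 < σ := (hξ.psi2_le 0).1
  have hCb0 : 0 < Cb := lt_of_lt_of_le (by positivity) hCb
  obtain ⟨n, hn⟩ : ∃ n : ℕ → ℝ, ∀ t, n t = (t : ℝ) - t₁ + Cb * d := ⟨_, fun _ => rfl⟩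
  have hnN : ∀ t, t₁ ≤ t → Cb * d ≤ n t := fun t ht => by rw [hn]; exact effective_sample_size_ge ht
  have hN0 : 0 < Cb * d := by positivity
  have hn0 : ∀ t, t₁ ≤ t → 0 < n t := fun t ht => hN0.trans_le (hnN t ht)
  have hn1 : ∀ t, n (t + 1) = n t + 1 := fun t => by rw [hn, hn]; push_cast; ring
  have hηn : ∀ t, t₁ ≤ t → η t = (Ca / l) / n t := fun t ht => by rw [hη t ht, hn]
  have hη0 : ∀ t, t₁ ≤ t → 0 < η t := fun t ht => by
    have := hn0 t ht
    rw [hηn t ht]; positivity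
  have hηmono : ∀ t, t₀ ≤ t → η t ≤ η t₀ := fun t ht => by
    rw [hηn t (ht₀.trans ht), hηn t₀ ht₀]
    have h1 := hn0 t₀ ht₀
    have h2 : n t₀ ≤ n t := by
      rw [hn, hn]
      have : (t₀ : ℝ) ≤ t := by exact_mod_cast ht
      linarith
    gcongr
  obtain ⟨s, hs⟩ : ∃ s : ℕ → ℝ, ∀ t, s t = L / l * η t * σ ^ 2 * D := ⟨_, fun _ => rfl⟩
  have hD0 : 0 < D := by linarith
  have hs0 : ∀ t, t₁ ≤ t → 0 < s t := fun t ht => by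
    have := hη0 t ht
    rw [hs]; positivity
  -- With `ρ = 3/2` and `Ca ≥ 2` one step contracts by at most `1 - 3 / n ≤ (n / (n + 1)) ^ 3`,
  -- hence the cube. For the floor, `5 (1 - 3/2 Ca/n) + 3 Ca/n = 5 (1 - 9/10 Ca/n)`, which is below
  -- `5 n / (n + 1)`, the decay of `5 s`.
  obtain ⟨w, hw⟩ : ∃ w : ℕ → ℝ, ∀ t, w t = v₀ * (n t₀ / n t) ^ 3 + 5 * s t := ⟨_, fun _ => rfl⟩
  have hs1 : ∀ t, t₁ ≤ t → s (t + 1) = s t * (n t / (n t + 1)) := fun t ht => by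
    have := hn0 t ht
    rw [hs, hs, hηn t ht, hηn (t + 1) (ht.trans t.le_succ), hn1]
    field_simp
  obtain ⟨p, hp1, hp, hp2⟩ := exists_nat_moment hD
  have key := measure_envelope_lt_le (β₀ := β₀) hX hξ hd η p (D := D) (ρ := 3 / 2)
    (s := s) (w := w) hT hB hdD hp hp1 (by norm_num) (fun t ht => hη0 t (ht₀.trans ht))
    (fun t ht => by
      refine le_trans ?_ hH
      have := hη0 t (ht₀.trans ht)
      have := hηmono t ht
      gcongr)
    (fun t _ => hs t)
    (fun t ht => by
      have h1 := hn0 t (ht₀.trans ht)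
      rw [hs1 t (ht₀.trans ht)]
      exact mul_le_of_le_one_right (hs0 t (ht₀.trans ht)).le ((div_le_one (by linarith)).2 (by linarith)))
    (fun t ht => by
      have h1 := hn0 t (ht₀.trans ht)
      have h2 := hnN t (ht₀.trans ht)
      have h3 : L / l * η t * d * L ≤ 1 / 4 := by
        rw [hηn t (ht₀.trans ht)]
        have h4 : L / l * (Ca / l / n t) * d * L = Ca * (L ^ 2 / l ^ 2) * d / n t := by field_simp
        rw [h4, div_le_iff₀ h1]
        have h5 := mul_le_mul_of_nonneg_right hCb (show (0 : ℝ) ≤ d by positivity)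
        have h6 : 0 ≤ Ca * (L ^ 2 / l ^ 2) * d := by positivity
        have h7 := mul_le_mul_of_nonneg_left hCa h6
        linarith
      linarith)
    (fun t ht => by
      have h1 := hs0 t (ht₀.trans ht)
      have h2 := hn0 t (ht₀.trans ht)
      have h3 := hn0 t₀ ht₀
      rw [hw]; positivity)
    (fun t ht => by
      have h1 := hs0 t (ht₀.trans ht)
      have h2 := hn0 t (ht₀.trans ht)
      have h3 := hn0 t₀ ht₀
      have hηl : η t * l = Ca / n t := by rw [hηn t (ht₀.trans ht)]; field_simp
      rw [hw, hw, hs1 t (ht₀.trans ht), hn1, hηl]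
      obtain ⟨m, hm⟩ : ∃ m, m = n t := ⟨_, rfl⟩
      rw [← hm] at h2 ⊢
      have h4 : 2 / m ≤ Ca / m := by gcongr
      have e1 : v₀ * (n t₀ / m) ^ 3 * (1 - 3 / 2 * (Ca / m)) ≤ v₀ * (n t₀ / (m + 1)) ^ 3 := by
        have e2 : 1 - 3 / 2 * (Ca / m) ≤ (m / (m + 1)) ^ 3 := by
          have e3 : 1 - 3 / m ≤ (m / (m + 1)) ^ 3 := by
            rw [div_pow, le_div_iff₀ (by positivity)]
            have e4 : (1 - 3 / m) * (m + 1) ^ 3 = (m ^ 4 - 6 * m ^ 2 - 8 * m - 3) / m := by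
              field_simp; ring
            rw [e4, div_le_iff₀ h2]
            nlinarith
          have e5 : 3 / m = 3 / 2 * (2 / m) := by ring
          linarith
        calc _ ≤ v₀ * (n t₀ / m) ^ 3 * (m / (m + 1)) ^ 3 := by gcongr
          _ = _ := by field_simp
      have e2 : 5 * s t * (1 - 3 / 2 * (Ca / m)) + (3 / 2 + 3 / 2) * (Ca / m) * s t ≤
          5 * (s t * (m / (m + 1))) := by
        have e6 : 1 - 9 / 10 * (Ca / m) ≤ m / (m + 1) := by
          have e4 : m / (m + 1) = 1 - 1 / (m + 1) := by field_simp; ring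
          have e5 : 1 / (m + 1) ≤ 1 / 2 * (2 / m) := by
            rw [show 1 / 2 * (2 / m) = 1 / m by ring]
            gcongr; linarith
          have e7 : 0 ≤ Ca / m := by positivity
          rw [e4]
          linarith
        have := mul_le_mul_of_nonneg_left e6 (show 0 ≤ 5 * s t by positivity)
        linarith
      linarith)
    (fun ω hω => by
      have h1 := hs0 t₀ ht₀
      have h2 := hn0 t₀ ht₀
      rw [hw, div_self h2.ne', one_pow, mul_one]
      linarith [hBv ω hω])
    (θ := 2) (by norm_num)
  refine (measure_mono (Set.inter_subset_inter_right _ fun ω hω => ?_)).trans (key.trans ?_)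
  · rw [Set.mem_ofPred_eq] at hω ⊢
    rw [hw, hs, hn, hn]
    have := hs0 T (ht₀.trans hT)
    rw [hs] at this
    linarith
  · gcongr
    have := two_mul_exp_neg_le (p := (p : ℝ)) hE (by linarith) (θ := (2 : ℝ)⁻¹) (by norm_num) (by norm_num) rfl
    linarith

/-- The deterministic bound of the squared error in the decaying stepsize regime. -/
def decayBound (l L σ Ca Cb d : ℝ) (D : ℕ → ℝ) (t₁ t : ℕ) : ℝ :=
  2 * (Cb * d / ((t : ℝ) - t₁ + Cb * d)) ^ 2 * (σ ^ 2 / L) +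
    20 * (L / l * (Ca / l / ((t : ℝ) - t₁ + Cb * d)) * σ ^ 2 * D t)

/-- A first failure at `T` means that the bound holds at an earlier restart time, from which the
envelope covers the window up to `T` at the single level `D T`. The effective sample size grows by a
factor of at most 4 on that window, so `hH` is needed only there. The separate index `s` lets a
failure at time `t + 1` be charged to the level at time `t`. -/
lemma measure_first_exceedance_le (hX : CovariateAssumption μ X (response X ξ βstar) l L)
    (hξ : NoiseAssumption μ X (response X ξ βstar) ξ σ) (hd : 0 < d)
    (hCa : 2 ≤ Ca) (hCb : 3 * Ca ^ 2 * (L ^ 2 / l ^ 2) ≤ Cb)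
    (hη : ∀ t : ℕ, t₁ ≤ t → η t = (Ca / l) / ((t : ℝ) - t₁ + Cb * d)) {D : ℕ → ℝ}
    (hdD : ∀ t, d ≤ D t) (hmono : ∀ s t, t₁ ≤ s → s ≤ t → D s ≤ D t) (hd0 : 20971520 ≤ (d : ℝ))
    (hH : ∀ t T : ℕ, t₁ ≤ t → t ≤ T →
      (T : ℝ) - t₁ + Cb * d ≤ 4 * ((t : ℝ) - t₁ + Cb * d) → L * (D T * η t * L) ^ 2 ≤ l)
    {s T : ℕ} (hs : D s ≤ D T) (hT : t₁ < T) {A : Set Ω}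
    (hA : A = {ω | ‖sgd X (response X ξ βstar) η β₀ t₁ ω - βstar‖ ^ 2 ≤ σ ^ 2 / L}) :
    μ (A ∩ {ω | ∀ t, t₁ ≤ t → t < T →
          ‖sgd X (response X ξ βstar) η β₀ t ω - βstar‖ ^ 2 ≤ decayBound l L σ Ca Cb d D t₁ t} ∩
        {ω | ∀ t, t₁ ≤ t → t < T → ‖X t ω‖ ^ 2 ≤ 32 * (L * D t)} ∩
        {ω | decayBound l L σ Ca Cb d D t₁ T <
          ‖sgd X (response X ξ βstar) η β₀ T ω - βstar‖ ^ 2}) ≤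
      ENNReal.ofReal (Real.exp (-(1 / 20971520) * D s) - Real.exp (-D s)) * μ A := by
  have hd1 : (1 : ℝ) ≤ d := by exact_mod_cast hd
  have hYm : ∀ t, Measurable (response X ξ βstar t) :=
    measurable_response βstar hX.measurable hξ.measurable
  have hL := hX.lmax_pos hd
  have hl := hX.lmin_pos
  have hlL := hX.lmin_le_lmax hYm hd
  have hσ : 0 < σ := (hξ.psi2_le 0).1
  have hκ : 1 ≤ L ^ 2 / l ^ 2 := by rw [one_le_div (by positivity)]; gcongr
  have hCb1 : 12 ≤ Cb := by
    refine le_trans ?_ hCb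
    calc (12 : ℝ) = 3 * 2 ^ 2 * 1 := by norm_num
      _ ≤ _ := by gcongr
  have hCb0 : 0 < Cb := by linarith
  have hmeas : ∀ (t : ℕ) (b : ℝ), MeasurableSet[pastSigma X (response X ξ βstar) t]
      {ω | ‖sgd X (response X ξ βstar) η β₀ t ω - βstar‖ ^ 2 ≤ b} := fun t b => by
    have h1 := measurable_sgd (X := X) (response X ξ βstar) η β₀ t
    have h2 : Measurable fun v : EuclideanSpace ℝ (Fin d) => ‖v - βstar‖ ^ 2 := by fun_prop
    exact @measurableSet_le ℝ Ω _ _ _ (pastSigma X (response X ξ βstar) t) _ _ _ _ _ (h2.comp h1)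
      (@measurable_const _ _ _ (pastSigma X (response X ξ βstar) t) b)
  have hAm : MeasurableSet[pastSigma X (response X ξ βstar) t₁] A := hA ▸ hmeas t₁ _
  obtain ⟨n, hn⟩ : ∃ n : ℕ → ℝ, ∀ t, n t = (t : ℝ) - t₁ + Cb * d := ⟨_, fun _ => rfl⟩
  have hN0 : 0 < Cb * d := by positivity
  have hnN : ∀ t, t₁ ≤ t → Cb * d ≤ n t := fun t ht => by rw [hn]; exact effective_sample_size_ge ht
  have hn0 : ∀ t, t₁ ≤ t → 0 < n t := fun t ht => hN0.trans_le (hnN t ht)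
  have hD0 : ∀ t, 0 < D t := fun t => by linarith [hdD t]
  have hdb : ∀ t, t₁ ≤ t → decayBound l L σ Ca Cb d D t₁ t =
      2 * (Cb * d / n t) ^ 2 * (σ ^ 2 / L) + 20 * (L / l * η t * σ ^ 2 * D t) := fun t ht => by
    rw [decayBound, hη t ht, hn]
  have hηn : ∀ t, t₁ ≤ t → η t = (Ca / l) / n t := fun t ht => by rw [hη t ht, hn]
  have hnT := hn0 T hT.le
  -- Early times restart at `t₁` itself, from the event `A`; the effective sample size has at most
  -- tripled.
  rcases lt_or_ge ((T : ℝ) - t₁) (2 * (Cb * d)) with hcase | hcase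
  · have key := measure_decay_lt_le (β₀ := β₀) hX hξ hd hCa hCb hη (le_refl t₁) hT.le (hdD T) (hd0.trans (hdD s)) hs
      (v₀ := σ ^ 2 / L) (by positivity) (hH t₁ T le_rfl hT.le (by simp; linarith)) hAm
      (fun ω hω => by rw [hA] at hω; exact hω)
    refine (measure_mono fun ω hω => ?_).trans key
    obtain ⟨⟨⟨h1, -⟩, h2⟩, h3⟩ := hω
    refine ⟨⟨h1, fun t ht ht' => (h2 t ht ht').trans ?_⟩, ?_⟩
    · have := hmono t T ht ht'.le
      gcongr
    · rw [Set.mem_ofPred_eq] at h3 ⊢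
      refine lt_of_le_of_lt ?_ h3
      rw [hdb T hT.le, ← hn, ← hn]
      have e1 : n t₁ = Cb * d := by rw [hn]; ring
      rw [e1]
      have e2 : (Cb * d / n T) ^ 3 ≤ (Cb * d / n T) ^ 2 :=
        pow_le_pow_of_le_one (by positivity) ((div_le_one hnT).2 (hnN T hT.le)) (by norm_num)
      have e3 := mul_le_mul_of_nonneg_left e2 (show 0 ≤ σ ^ 2 / L by positivity)
      have e4 : 0 ≤ L / l * η T * σ ^ 2 * D T := by
        have := hD0 T
        rw [hηn T hT.le]; positivity
      linarith
  -- Restarting a quarter of the way makes the ratio `r` of effective sample sizes lie between `1/4`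
  -- and `1/2`. Then `2 r³ ≤ r²`: the initial-error term is reproduced exactly, and the floor `20`
  -- at the restart becomes at most `10`, which adds to the new `2 * 5 = 10`.
  · obtain ⟨k, hk⟩ : ∃ k, k = (T - t₁) / 4 := ⟨_, rfl⟩
    have hk1 : 4 * k ≤ T - t₁ := by omega
    have hk2 : T - t₁ < 4 * (k + 1) := by omega
    have hcast : ((T - t₁ : ℕ) : ℝ) = (T : ℝ) - t₁ := Nat.cast_sub hT.le
    have hk1' : 4 * (k : ℝ) ≤ (T : ℝ) - t₁ := by rw [← hcast]; exact_mod_cast hk1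
    have hk2' : (T : ℝ) - t₁ < 4 * ((k : ℝ) + 1) := by rw [← hcast]; exact_mod_cast hk2
    have ht₀ : t₁ ≤ t₁ + k := Nat.le_add_right _ _
    have ht₀T : t₁ + k < T := by omega
    have hn₀ : n (t₁ + k) = k + Cb * d := by rw [hn]; push_cast; ring
    have hnT' : n T = (T : ℝ) - t₁ + Cb * d := hn T
    have hhalf : n (t₁ + k) ≤ n T / 2 := by rw [hn₀, hnT']; linarith
    have hN12 : 12 ≤ Cb * d := by nlinarith
    have hquarter : n T ≤ 4 * n (t₁ + k) := by rw [hn₀, hnT']; linarith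
    have hn₀0 := hn0 (t₁ + k) ht₀
    set b₀ := decayBound l L σ Ca Cb d D t₁ (t₁ + k) with hb₀
    have hb₀' := hdb (t₁ + k) ht₀
    have hb₀0 : 0 ≤ b₀ := by
      have := hD0 (t₁ + k)
      rw [hb₀, hb₀', hηn _ ht₀]; positivity
    have hBm : MeasurableSet[pastSigma X (response X ξ βstar) (t₁ + k)]
        (A ∩ {ω | ‖sgd X (response X ξ βstar) η β₀ (t₁ + k) ω - βstar‖ ^ 2 ≤ b₀}) :=
      @MeasurableSet.inter _ (pastSigma X (response X ξ βstar) (t₁ + k)) _ _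
        (pastSigma_mono _ ht₀ _ hAm) (hmeas _ _)
    have key := measure_decay_lt_le (β₀ := β₀) hX hξ hd hCa hCb hη ht₀ ht₀T.le (hdD T) (hd0.trans (hdD s)) hs
      (v₀ := b₀) hb₀0
      (hH (t₁ + k) T ht₀ ht₀T.le (by rw [← hn, ← hn]; exact hquarter)) hBm
      (fun ω hω => hω.2)
    refine ((measure_mono fun ω hω => ?_).trans key).trans (by gcongr; exact Set.inter_subset_left)
    obtain ⟨⟨⟨h1, h0⟩, h2⟩, h3⟩ := hω
    refine ⟨⟨⟨h1, h0 _ ht₀ ht₀T⟩, fun t ht ht' => (h2 t (ht₀.trans ht) ht').trans ?_⟩, ?_⟩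
    · have := hmono t T (ht₀.trans ht) ht'.le
      gcongr
    · rw [Set.mem_ofPred_eq] at h3 ⊢
      refine lt_of_le_of_lt ?_ h3
      rw [hdb T hT.le, ← hn, ← hn]
      have e4 : 0 ≤ L / l * η T * σ ^ 2 * D T := by
        have := hD0 T
        rw [hηn T hT.le]; positivity
      have e1 : 2 * (n (t₁ + k) / n T) ^ 3 ≤ (n (t₁ + k) / n T) ^ 2 := by
        have : n (t₁ + k) / n T ≤ 1 / 2 := by rw [div_le_iff₀ hnT]; linarith
        have h5 := mul_le_mul_of_nonneg_left this (sq_nonneg (n (t₁ + k) / n T))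
        linarith
      have e2 : (n (t₁ + k) / n T) ^ 2 * b₀ ≤ 2 * (Cb * d / n T) ^ 2 * (σ ^ 2 / L) +
          10 * (L / l * η T * σ ^ 2 * D T) := by
        rw [hb₀, hb₀', hηn _ ht₀, hηn T hT.le]
        have e5 : (n (t₁ + k) / n T) ^ 2 * (2 * (Cb * d / n (t₁ + k)) ^ 2 * (σ ^ 2 / L) +
            20 * (L / l * (Ca / l / n (t₁ + k)) * σ ^ 2 * D (t₁ + k))) =
            2 * (Cb * d / n T) ^ 2 * (σ ^ 2 / L) + 20 * (n (t₁ + k) / n T) *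
              (L / l * (Ca / l / n T) * σ ^ 2 * D (t₁ + k)) := by field_simp
        rw [e5]
        have e6 : n (t₁ + k) / n T ≤ 1 / 2 := by rw [div_le_iff₀ hnT]; linarith
        have e7 : L / l * (Ca / l / n T) * σ ^ 2 * D (t₁ + k) ≤
            L / l * (Ca / l / n T) * σ ^ 2 * D T := by
          have := hmono (t₁ + k) T ht₀ ht₀T.le
          gcongr
        have e8 : 20 * (n (t₁ + k) / n T) * (L / l * (Ca / l / n T) * σ ^ 2 * D (t₁ + k)) ≤
            20 * (1 / 2) * (L / l * (Ca / l / n T) * σ ^ 2 * D T) := by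
          have := hD0 (t₁ + k)
          gcongr
        linarith
      have e3 := mul_le_mul_of_nonneg_right e1 hb₀0
      linarith

/-- With high conditional probability, the deterministic bound holds up to a finite horizon. -/
lemma measure_exceedance_le (hX : CovariateAssumption μ X (response X ξ βstar) l L)
    (hξ : NoiseAssumption μ X (response X ξ βstar) ξ σ) (hd : 0 < d)
    (hCa : 2 ≤ Ca) (hCb : 3 * Ca ^ 2 * (L ^ 2 / l ^ 2) ≤ Cb)
    (hη : ∀ t : ℕ, t₁ ≤ t → η t = (Ca / l) / ((t : ℝ) - t₁ + Cb * d)) {D : ℕ → ℝ}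
    (hdD : ∀ t, d ≤ D t) (hmono : ∀ s t, t₁ ≤ s → s ≤ t → D s ≤ D t) (hd0 : 20971520 ≤ (d : ℝ))
    (hH : ∀ t T : ℕ, t₁ ≤ t → t ≤ T →
      (T : ℝ) - t₁ + Cb * d ≤ 4 * ((t : ℝ) - t₁ + Cb * d) → L * (D T * η t * L) ^ 2 ≤ l)
    (T : ℕ) {A : Set Ω}
    (hA : A = {ω | ‖sgd X (response X ξ βstar) η β₀ t₁ ω - βstar‖ ^ 2 ≤ σ ^ 2 / L}) :
    μ (A \ {ω | ∀ t, t₁ ≤ t → t ≤ T →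
        ‖sgd X (response X ξ βstar) η β₀ t ω - βstar‖ ^ 2 ≤ decayBound l L σ Ca Cb d D t₁ t}) ≤
      ENNReal.ofReal (∑ t ∈ Finset.Ico t₁ T, Real.exp (-(1 / 20971520) * D t)) * μ A := by
  have hd1 : (1 : ℝ) ≤ d := by exact_mod_cast hd
  have hYm : ∀ t, Measurable (response X ξ βstar t) :=
    measurable_response βstar hX.measurable hξ.measurable
  have hL := hX.lmax_pos hd
  have hl := hX.lmin_pos
  have hσ : 0 < σ := (hξ.psi2_le 0).1
  have hCb0 : 0 < Cb := lt_of_lt_of_le (by positivity) hCb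
  have hD0 : ∀ t, 20971520 ≤ D t := fun t => hd0.trans (hdD t)
  have hmeas : MeasurableSet[pastSigma X (response X ξ βstar) t₁] A := by
    have h1 := measurable_sgd (X := X) (response X ξ βstar) η β₀ t₁
    have h2 : Measurable fun v : EuclideanSpace ℝ (Fin d) => ‖v - βstar‖ ^ 2 := by fun_prop
    rw [hA]
    exact @measurableSet_le ℝ Ω _ _ _ (pastSigma X (response X ξ βstar) t₁) _ _ _ _ _ (h2.comp h1)
      (@measurable_const _ _ _ (pastSigma X (response X ξ βstar) t₁) _)
  set F : ℕ → Set Ω := fun T => A ∩ {ω | ∀ t, t₁ ≤ t → t < T →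
          ‖sgd X (response X ξ βstar) η β₀ t ω - βstar‖ ^ 2 ≤ decayBound l L σ Ca Cb d D t₁ t} ∩
        {ω | ∀ t, t₁ ≤ t → t < T → ‖X t ω‖ ^ 2 ≤ 32 * (L * D t)} ∩
        {ω | decayBound l L σ Ca Cb d D t₁ T <
          ‖sgd X (response X ξ βstar) η β₀ T ω - βstar‖ ^ 2} with hF
  have hsub : A \ {ω | ∀ t, t₁ ≤ t → t ≤ T →
        ‖sgd X (response X ξ βstar) η β₀ t ω - βstar‖ ^ 2 ≤ decayBound l L σ Ca Cb d D t₁ t} ⊆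
      ⋃ t ∈ Finset.Ico t₁ T, (F (t + 1) ∪ A ∩ {ω | 32 * (L * D t) < ‖X t ω‖ ^ 2}) := fun ω hω => by
    obtain ⟨hωA, hω⟩ := hω
    rw [Set.mem_ofPred_eq] at hω
    push Not at hω
    classical
    obtain ⟨h1, h2, h3⟩ := Nat.find_spec hω
    have hmin : ∀ t, t₁ ≤ t → t < Nat.find hω →
        ‖sgd X (response X ξ βstar) η β₀ t ω - βstar‖ ^ 2 ≤ decayBound l L σ Ca Cb d D t₁ t :=
      fun t ht ht' => by
        by_contra hc
        exact Nat.find_min hω ht' ⟨ht, ht'.le.trans h2, not_le.1 hc⟩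
    generalize Nat.find hω = τ at h1 h2 h3 hmin
    -- At `t₁` the bound holds on `A`, since its first term alone is `2 σ² / L`. The first failure
    -- thus has a predecessor `t ≥ t₁`.
    have hne : t₁ ≠ τ := by
      rintro rfl
      have h4 : ‖sgd X (response X ξ βstar) η β₀ t₁ ω - βstar‖ ^ 2 ≤ σ ^ 2 / L := by
        rw [hA] at hωA; exact hωA
      have h5 : 0 ≤ 20 * (L / l * (Ca / l / ((t₁ : ℝ) - t₁ + Cb * d)) * σ ^ 2 * D t₁) := by
        have := hD0 t₁
        have h6 : 0 < D t₁ := by linarith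
        rw [sub_self, zero_add]
        positivity
      have h6 : 0 ≤ σ ^ 2 / L := by positivity
      rw [decayBound, sub_self, zero_add, div_self (by positivity)] at h3
      rw [sub_self, zero_add] at h5
      linarith
    obtain ⟨t, rfl⟩ : ∃ t, τ = t + 1 := ⟨τ - 1, by omega⟩
    by_cases hc : ∀ i, t₁ ≤ i → i < t + 1 → ‖X i ω‖ ^ 2 ≤ 32 * (L * D i)
    · exact Set.mem_biUnion (Finset.mem_coe.2 (Finset.mem_Ico.2 ⟨by omega, by omega⟩))
        (Or.inl ⟨⟨⟨hωA, hmin⟩, hc⟩, h3⟩)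
    · push Not at hc
      obtain ⟨i, hi1, hi2, hi3⟩ := hc
      exact Set.mem_biUnion (Finset.mem_coe.2 (Finset.mem_Ico.2 ⟨hi1, by omega⟩))
        (Or.inr ⟨hωA, hi3⟩)
  calc _ ≤ _ := measure_mono hsub
    _ ≤ _ := measure_biUnion_finset_le _ _
    _ ≤ ∑ t ∈ Finset.Ico t₁ T, ENNReal.ofReal (Real.exp (-(1 / 20971520) * D t)) * μ A := by
        refine Finset.sum_le_sum fun t ht => ?_
        have ht1 := (Finset.mem_Ico.1 ht).1
        have h1 := measure_first_exceedance_le (β₀ := β₀) hX hξ hd hCa hCb hη hdD hmono hd0 hH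
          (hmono t (t + 1) ht1 t.le_succ) (Nat.lt_succ_of_le ht1) hA
        have h2 := hX.measure_norm_sq_gt_le hYm hd t
          (pastSigma_mono (response X ξ βstar) ht1 _ hmeas) (hdD t)
        refine (measure_union_le _ _).trans ((add_le_add h1 h2).trans ?_)
        -- The exceedance bound leaves out exactly `exp (-D t)`, which is the cost of the covariate
        -- tail.
        have h3 : Real.exp (-D t) ≤ Real.exp (-(1 / 20971520) * D t) :=
          Real.exp_le_exp.2 (by linarith [hD0 t])
        rw [← add_mul, ← ENNReal.ofReal_add (sub_nonneg.2 h3) (Real.exp_pos _).le, sub_add_cancel]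
    _ = _ := by
        rw [← Finset.sum_mul, ENNReal.ofReal_sum_of_nonneg fun _ _ => (Real.exp_pos _).le]

end Decay

/-! ### Estimates at the logarithmic tail level, and the final constants. -/

lemma four_mul_mul_pow_three_le {a b : ℝ} (ha : 0 ≤ a) (hb : 0 ≤ b) :
    4 * a * b ^ 3 ≤ (a + b) ^ 4 := by
  have h : (a + b) ^ 4 = a ^ 4 + 4 * a ^ 3 * b + 6 * a ^ 2 * b ^ 2 + 4 * a * b ^ 3 + b ^ 4 := by ring
  rw [h]
  have : 0 ≤ a ^ 4 + 4 * a ^ 3 * b + 6 * a ^ 2 * b ^ 2 + b ^ 4 := by positivity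
  linarith

lemma log_pow_four_le {a : ℝ} (ha : 1 ≤ a) : Real.log a ^ 4 ≤ 256 * a := by
  have h0 : 0 ≤ a := by linarith
  have h1 := Real.log_le_rpow_div h0 (show (0 : ℝ) < 1 / 4 by norm_num)
  calc Real.log a ^ 4 ≤ (a ^ (1 / 4 : ℝ) / (1 / 4)) ^ 4 := by
        have := Real.log_nonneg ha
        gcongr
    _ = 256 * (a ^ (1 / 4 : ℝ)) ^ 4 := by ring
    _ = 256 * a := by
        rw [← Real.rpow_natCast, ← Real.rpow_mul h0]
        norm_num

/-- At a logarithmic tail level, the decaying stepsizes are small enough for the one-step bound. -/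
lemma decaying_step_small {l L Ca Cb d D S n A : ℝ} (hl : 0 < l) (hlL : l ≤ L) (hCa : 2 ≤ Ca)
    (hCb : 3 * Ca ^ 2 * (L ^ 2 / l ^ 2) ≤ Cb) (hS : 0 ≤ S) (hn : S + Cb * d ≤ 4 * n)
    (hA : 1 ≤ A) (hd : 8 * A ^ 2 ≤ d) (hdD : d ≤ D) (hD : D ≤ max d (A * Real.log (1 + S))) :
    L * (D * (Ca / l / n) * L) ^ 2 ≤ l := by
  have hL : 0 < L := hl.trans_le hlL
  obtain ⟨Q, hQ⟩ : ∃ Q, Q = Ca * (L / l) := ⟨_, rfl⟩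
  have hκ : 1 ≤ L / l := (one_le_div hl).2 hlL
  have hκQ : 2 * (L / l) ≤ Q := by rw [hQ]; gcongr
  have hQ2 : 2 ≤ Q := by linarith
  have hCbQ : 3 * Q ^ 2 ≤ Cb := by
    refine le_trans (le_of_eq ?_) hCb
    rw [hQ]; ring
  have hd8 : 8 ≤ d := by nlinarith
  have hD0 : 0 ≤ D := by linarith
  have hm : S + 3 * Q ^ 2 * d ≤ 4 * n := by
    refine le_trans ?_ hn
    gcongr
  have hn0 : 0 < n := by
    have : 0 < 3 * Q ^ 2 * d := by positivity
    linarith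
  -- Here `Q = Ca κ` and `κ ≤ Q / 2`, so this is the stepsize condition cleared of denominators. At
  -- the level `d` it follows from `4 n ≥ 3 Q² d`. At the logarithmic level it is squared: `D⁴`
  -- grows at most linearly in `1 + S`, the factor `d³` absorbs `A⁴`, and the product is one term of
  -- the binomial expansion of a fourth power.
  have key : 8 * Q ^ 3 * D ^ 2 ≤ (4 * n) ^ 2 := by
    rcases le_max_iff.1 hD with h | h
    · calc 8 * Q ^ 3 * D ^ 2 ≤ 8 * Q ^ 3 * d ^ 2 := by gcongr
        _ ≤ (3 * Q ^ 2 * d) ^ 2 := by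
            have h1 : (3 * Q ^ 2 * d) ^ 2 = 9 * Q * Q ^ 3 * d ^ 2 := by ring
            rw [h1]
            gcongr
            linarith
        _ ≤ _ := pow_le_pow_left₀ (by positivity) (by linarith) 2
    · have h1 : (8 * Q ^ 3 * D ^ 2) ^ 2 ≤ ((4 * n) ^ 2) ^ 2 := by
        have h2 : D ^ 4 ≤ A ^ 4 * (256 * (1 + S)) := by
          calc D ^ 4 ≤ (A * Real.log (1 + S)) ^ 4 := by gcongr
            _ = A ^ 4 * Real.log (1 + S) ^ 4 := by ring
            _ ≤ _ := by
              have := log_pow_four_le (show 1 ≤ 1 + S by linarith)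
              gcongr
        have h3 : 512 * A ^ 4 ≤ d ^ 3 := by
          calc 512 * A ^ 4 = 8 * (8 * A ^ 2) ^ 2 := by ring
            _ ≤ d * d ^ 2 := by gcongr
            _ = d ^ 3 := by ring
        have h4 : 1 ≤ Q ^ 2 * d := by nlinarith
        calc (8 * Q ^ 3 * D ^ 2) ^ 2 = 64 * Q ^ 6 * D ^ 4 := by ring
          _ ≤ 64 * Q ^ 6 * (A ^ 4 * (256 * (1 + S))) := by gcongr
          _ = 32 * (1 + S) * Q ^ 6 * (512 * A ^ 4) := by ring
          _ ≤ 32 * (1 + S) * Q ^ 6 * d ^ 3 := by gcongr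
          _ = 4 * (1 + S) * (2 * Q ^ 2 * d) ^ 3 := by ring
          _ ≤ (1 + S + 2 * Q ^ 2 * d) ^ 4 :=
              four_mul_mul_pow_three_le (by linarith) (by positivity)
          _ ≤ (4 * n) ^ 4 := by gcongr; linarith
          _ = _ := by ring
      exact (pow_le_pow_iff_left₀ (by positivity) (by positivity) two_ne_zero).1 h1
  have h5 : L * (D * (Ca / l / n) * L) ^ 2 = l * ((L / l) * Q ^ 2 * D ^ 2 / n ^ 2) := by
    rw [hQ]; field_simp
  rw [h5]
  refine mul_le_of_le_one_right hl.le ?_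
  rw [div_le_one (by positivity)]
  have h6 : (2 * (L / l)) * (Q ^ 2 * D ^ 2) ≤ Q * (Q ^ 2 * D ^ 2) := by gcongr
  nlinarith

lemma sum_one_add_inv_sq_le (n : ℕ) : ∑ i ∈ Finset.range n, ((1 + (i : ℝ)) ^ 2)⁻¹ ≤ 2 := by
  -- Telescoping with half-integer shifts gives the bound 2 from the first term on.
  have h : ∑ i ∈ Finset.range n, ((1 + (i : ℝ)) ^ 2)⁻¹ ≤ 2 - 1 / ((n : ℝ) + 1 / 2) := by
    induction n with
    | zero => norm_num
    | succ n ih =>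
      rw [Finset.sum_range_succ]
      have h0 : (0 : ℝ) ≤ n := n.cast_nonneg
      have h1 : ((1 + (n : ℝ)) ^ 2)⁻¹ ≤ 1 / ((n : ℝ) + 1 / 2) - 1 / ((n : ℝ) + 3 / 2) := by
        rw [div_sub_div _ _ (by positivity) (by positivity), inv_eq_one_div,
          div_le_div_iff₀ (by positivity) (by positivity)]
        nlinarith
      push_cast
      rw [show (n : ℝ) + 1 + 1 / 2 = n + 3 / 2 by ring]
      linarith
  have : 0 ≤ 1 / ((n : ℝ) + 1 / 2) := by positivity
  linarith

/-- The summed failure probabilities at the tail level `max d (A log (1 + k))`. -/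
lemma sum_exp_neg_log_level_le (d : ℝ) (n : ℕ) :
    ∑ i ∈ Finset.range n, Real.exp (-(1 / 41943040) * (d + 83886080 * Real.log (1 + i))) ≤
      2 * Real.exp (-(1 / 41943040) * d) := by
  -- The factor of the logarithm is twice the inverse rate, so the terms decay like an inverse
  -- square.
  have h : ∀ i : ℕ, Real.exp (-(1 / 41943040) * (d + 83886080 * Real.log (1 + i))) =
      Real.exp (-(1 / 41943040) * d) * ((1 + (i : ℝ)) ^ 2)⁻¹ := fun i => by
    have h0 : (0 : ℝ) < 1 + i := by positivity
    rw [← Real.exp_log (inv_pos.2 (pow_pos h0 2)), Real.log_inv, Real.log_pow, ← Real.exp_add]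
    congr 1
    push_cast
    ring
  simp_rw [h]
  rw [← Finset.mul_sum, mul_comm]
  gcongr
  exact sum_one_add_inv_sq_le n

lemma exp_neg_max_le {d y : ℝ} :
    Real.exp (-(1 / 20971520) * max d y) ≤ Real.exp (-(1 / 41943040) * (d + y)) := by
  refine Real.exp_le_exp.2 ?_
  linarith [le_max_left d y, le_max_right d y]

/-- Capping a tail level costs at most the failure probability of the cap. -/
lemma exp_neg_max_min_le {d x y : ℝ} :
    Real.exp (-(1 / 20971520) * max d (min x y)) ≤
      Real.exp (-(1 / 41943040) * (d + y)) + Real.exp (-(1 / 41943040) * (d + x)) := by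
  refine exp_neg_max_le.trans ?_
  rcases min_choice x y with h | h <;> rw [h]
  · exact le_add_of_nonneg_left (Real.exp_pos _).le
  · exact le_add_of_nonneg_right (Real.exp_pos _).le

/-- The noise term gives the `Ca κ` part. For the initial-error term, `(Cb d / n)² ≤ Cb d / n`
always gives the `Cb / κ` part; once `n` passes the stated threshold, the same term is itself at
most of order `Ca κ`. -/
lemma withinRate_of_le {C Ca Cb l L σ d D D' n V K : ℝ} (hl : 0 < l) (hL : 0 < L) (hCa : 0 < Ca)
    (hCb : 0 < Cb) (hd : 0 < d) (hn : Cb * d ≤ n) (hdD : d ≤ D) (hD : D' ≤ K * D) (hK : 0 ≤ K)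
    (hC : 20 * K + 2 ≤ C)
    (hV : V ≤ 2 * (Cb * d / n) ^ 2 * (σ ^ 2 / L) + 20 * (L / l * (Ca / l / n) * σ ^ 2 * D')) :
    WithinRate C Ca Cb l L σ d D n V := by
  have hN : 0 < Cb * d := by positivity
  have hn0 : 0 < n := hN.trans_le hn
  have hD0 : 0 < D := hd.trans_le hdD
  obtain ⟨u, hu⟩ : ∃ u, u = 1 / l * (D / n) * σ ^ 2 := ⟨_, rfl⟩
  have hu0 : 0 ≤ u := by rw [hu]; positivity
  have hκ : 0 < L / l := by positivity
  have hcu : Ca * (L / l) * u = L / l * (Ca / l / n) * σ ^ 2 * D := by rw [hu]; field_simp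
  have h1 : L / l * (Ca / l / n) * σ ^ 2 * D' ≤ K * (Ca * (L / l) * u) := by
    calc _ ≤ L / l * (Ca / l / n) * σ ^ 2 * (K * D) := by gcongr
      _ = _ := by rw [hcu]; ring
  have hdu : 1 / l * (d / n) * σ ^ 2 ≤ u := by rw [hu]; gcongr
  have hCu : (20 * K + 2) * (Ca * (L / l) * u) ≤ C * (Ca * (L / l) * u) := by gcongr
  refine ⟨?_, fun h => ?_⟩
  · have h2 : (Cb * d / n) ^ 2 * (σ ^ 2 / L) ≤ Cb * (l / L) * u := by
      calc _ ≤ Cb * d / n * (σ ^ 2 / L) := by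
            have : Cb * d / n ≤ 1 := (div_le_one hn0).2 hn
            have h0 : 0 ≤ Cb * d / n := by positivity
            gcongr
            nlinarith
        _ = Cb * (l / L) * (1 / l * (d / n) * σ ^ 2) := by field_simp
        _ ≤ _ := by gcongr
    have h3 : (20 * K + 2) * (Cb * (l / L) * u) ≤ C * (Cb * (l / L) * u) := by gcongr
    have h4 : 0 ≤ K * (Cb * (l / L) * u) := by positivity
    have h5 : 0 ≤ Ca * (L / l) * u := by positivity
    have h6 : C * (Ca * (L / l) + Cb * (l / L)) * (1 / l) * (D / n) * σ ^ 2 =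
        C * (Ca * (L / l) * u) + C * (Cb * (l / L) * u) := by rw [hu]; ring
    rw [h6]
    linarith
  · have h2 : (Cb * d / n) ^ 2 * (σ ^ 2 / L) ≤ Ca * (L / l) * u := by
      calc (Cb * d / n) ^ 2 * (σ ^ 2 / L) = Cb ^ 2 * d * (d * σ ^ 2 / (n ^ 2 * L)) := by
            field_simp
        _ ≤ Ca * (L / l) ^ 2 * n * (d * σ ^ 2 / (n ^ 2 * L)) := by gcongr
        _ = Ca * (L / l) * (1 / l * (d / n) * σ ^ 2) := by field_simp
        _ ≤ _ := by gcongr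
    have h5 : 0 ≤ K * (Ca * (L / l) * u) := by positivity
    have h6 : 2 * C * Ca * (L / l) * (1 / l) * (D / n) * σ ^ 2 =
        2 * (C * (Ca * (L / l) * u)) := by rw [hu]; ring
    have h7 : 0 ≤ Ca * (L / l) * u := by positivity
    rw [h6]
    linarith

/-- The number is `20 * 167772160 + 2`, the requirement of `withinRate_of_le` with the largest `K`
that occurs. The additional exponential makes the probability bounds nonpositive below the dimension
threshold. -/
lemma exists_rate_constant : ∃ C : ℝ, 3355443202 ≤ C ∧
    ∀ d : ℝ, d < 8 * 83886080 ^ 2 → 1 ≤ C * Real.exp (-(1 / 41943040) * d) := by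
  obtain ⟨r, hr⟩ : ∃ r : ℝ, r = 1 / 41943040 * (8 * 83886080 ^ 2) := ⟨_, rfl⟩
  refine ⟨3355443202 + Real.exp r, by linarith [Real.exp_pos r], fun d hd => ?_⟩
  calc 1 ≤ Real.exp r * Real.exp (-(1 / 41943040) * d) := by
        rw [← Real.exp_add]
        exact Real.one_le_exp (by rw [hr]; linarith)
    _ ≤ _ := by
        gcongr
        linarith

lemma measure_sdiff_forall_le {Ω : Type*} {m0 : MeasurableSpace Ω} {μ : Measure Ω} {t₁ : ℕ} {A : Set Ω} {P : ℕ → Ω → Prop} {b : ℝ≥0∞}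
    (h : ∀ T, t₁ ≤ T → μ (A \ {ω | ∀ t, t₁ ≤ t → t ≤ T → P t ω}) ≤ b) :
    μ (A \ {ω | ∀ t, t₁ ≤ t → P t ω}) ≤ b := by
  have hmono : Monotone fun T => A \ {ω | ∀ t, t₁ ≤ t → t ≤ T → P t ω} := fun S T hST =>
    Set.sdiff_subset_sdiff_right fun ω hω t ht ht' => hω t ht (ht'.trans hST)
  have hsub : A \ {ω | ∀ t, t₁ ≤ t → P t ω} ⊆
      ⋃ T, A \ {ω | ∀ t, t₁ ≤ t → t ≤ T → P t ω} := fun ω ⟨hA, hω⟩ => by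
    rw [Set.mem_ofPred_eq] at hω
    push Not at hω
    obtain ⟨t, ht, hP⟩ := hω
    exact Set.mem_iUnion.2 ⟨t, hA, fun hc => hP (hc t ht le_rfl)⟩
  refine (measure_mono hsub).trans ?_
  rw [hmono.measure_iUnion]
  refine iSup_le fun T => ?_
  exact (measure_mono (hmono (le_max_left T t₁))).trans (h _ (le_max_right T t₁))

/-! ### Failure probabilities over a whole horizon. -/

section Horizon

variable {Ω : Type*} {m0 : MeasurableSpace Ω} {μ : Measure Ω} [IsProbabilityMeasure μ] {d : ℕ}
  {X : ℕ → Ω → EuclideanSpace ℝ (Fin d)} {ξ : ℕ → Ω → ℝ}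
  {βstar β₀ : EuclideanSpace ℝ (Fin d)} {l L σ Ca Cb : ℝ} {η : ℕ → ℝ} {t₁ : ℕ}

lemma measure_exceedance_log_level_le (hX : CovariateAssumption μ X (response X ξ βstar) l L)
    (hξ : NoiseAssumption μ X (response X ξ βstar) ξ σ) (hd : 0 < d)
    (hCa : 2 ≤ Ca) (hCb : 3 * Ca ^ 2 * (L ^ 2 / l ^ 2) ≤ Cb)
    (hη : ∀ t : ℕ, t₁ ≤ t → η t = (Ca / l) / ((t : ℝ) - t₁ + Cb * d)) {D : ℕ → ℝ}
    (hdD : ∀ t, d ≤ D t) (hmono : ∀ s t, t₁ ≤ s → s ≤ t → D s ≤ D t)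
    (hlog : ∀ t, D t ≤ max (d : ℝ) (83886080 * Real.log (1 + ((t : ℝ) - t₁))))
    (hd0 : 8 * 83886080 ^ 2 ≤ (d : ℝ)) {b : ℝ} {T : ℕ}
    (hb : ∑ t ∈ Finset.Ico t₁ T, Real.exp (-(1 / 20971520) * D t) ≤ b) {A : Set Ω}
    (hA : A = {ω | ‖sgd X (response X ξ βstar) η β₀ t₁ ω - βstar‖ ^ 2 ≤ σ ^ 2 / L}) :
    μ (A \ {ω | ∀ t, t₁ ≤ t → t ≤ T →
        ‖sgd X (response X ξ βstar) η β₀ t ω - βstar‖ ^ 2 ≤ decayBound l L σ Ca Cb d D t₁ t}) ≤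
      ENNReal.ofReal b * μ A := by
  have hYm : ∀ t, Measurable (response X ξ βstar t) :=
    measurable_response βstar hX.measurable hξ.measurable
  refine (measure_exceedance_le hX hξ hd hCa hCb hη hdD hmono
    (le_trans (by norm_num) hd0) (fun t T ht hT hn => ?_) T hA).trans (by gcongr)
  rw [hη t ht]
  have hT' : (t₁ : ℝ) ≤ T := by exact_mod_cast ht.trans hT
  exact decaying_step_small hX.lmin_pos (hX.lmin_le_lmax hYm hd) hCa hCb (by linarith) hn
    (by norm_num) hd0 (hdD T) (hlog T)

lemma log_level_mono {s t : ℕ} (hs : t₁ ≤ s) (hst : s ≤ t) :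
    83886080 * Real.log (1 + ((s : ℝ) - t₁)) ≤ 83886080 * Real.log (1 + ((t : ℝ) - t₁)) := by
  have h1 : (t₁ : ℝ) ≤ s := by exact_mod_cast hs
  have h2 : (s : ℝ) ≤ t := by exact_mod_cast hst
  have h3 : 0 < 1 + ((s : ℝ) - t₁) := by linarith
  gcongr

/-- The failure probability for a prescribed tail level `δ`, truncated at a logarithmic one. -/
lemma measure_not_withinRate_le (hX : CovariateAssumption μ X (response X ξ βstar) l L)
    (hξ : NoiseAssumption μ X (response X ξ βstar) ξ σ) (hd : 0 < d)
    (hCa : 2 ≤ Ca) (hCb : 3 * Ca ^ 2 * (L ^ 2 / l ^ 2) ≤ Cb)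
    (hη : ∀ t : ℕ, t₁ ≤ t → η t = (Ca / l) / ((t : ℝ) - t₁ + Cb * d))
    (hd0 : 8 * 83886080 ^ 2 ≤ (d : ℝ)) {δ : ℕ → ℝ} (hδ : Monotone δ) {C : ℝ}
    (hC : 3355443202 ≤ C) (T : ℕ) {A : Set Ω}
    (hA : A = {ω | ‖sgd X (response X ξ βstar) η β₀ t₁ ω - βstar‖ ^ 2 ≤ σ ^ 2 / L}) :
    μ (A \ {ω | ∀ t, t₁ ≤ t → t ≤ T → WithinRate C Ca Cb l L σ d (max (d : ℝ) (δ (t + 1)))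
        ((t : ℝ) + 1 - t₁ + Cb * d)
        (‖sgd X (response X ξ βstar) η β₀ (t + 1) ω - βstar‖ ^ 2)}) ≤
      ENNReal.ofReal (2 * Real.exp (-(1 / 41943040) * d) +
        ∑ t ∈ Finset.Icc t₁ T, Real.exp (-(1 / 41943040) * (d + δ t))) * μ A := by
  have hL := hX.lmax_pos hd
  have hl := hX.lmin_pos
  have hd' : (0 : ℝ) < d := by exact_mod_cast hd
  have hCb0 : 0 < Cb := lt_of_lt_of_le (by positivity) hCb
  -- The cap keeps the stepsize condition valid at all times. Lowering the level only strengthens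
  -- the bound on the error, and the lost probability is summable.
  obtain ⟨D, hD⟩ : ∃ D : ℕ → ℝ, ∀ t, D t =
      max (d : ℝ) (min (δ t) (83886080 * Real.log (1 + ((t : ℝ) - t₁)))) := ⟨_, fun _ => rfl⟩
  refine (measure_mono (Set.sdiff_subset_sdiff_right fun ω hω t ht htT => ?_)).trans
    (measure_exceedance_log_level_le (D := D) (T := T + 1) (β₀ := β₀) hX hξ hd hCa hCb hη
      (fun t => by rw [hD]; exact le_max_left _ _)
      (fun s t hs hst => by
        rw [hD, hD]
        exact max_le_max le_rfl (min_le_min (hδ hst) (log_level_mono hs hst)))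
      (fun t => by rw [hD]; exact max_le_max le_rfl (min_le_right _ _)) hd0 ?_ hA)
  · have h1 := hω (t + 1) (by omega) (by omega)
    rw [decayBound] at h1
    push_cast at h1
    refine withinRate_of_le (K := 1) (D' := D (t + 1)) hl hL (by linarith) hCb0 hd' ?_
      (le_max_left _ _) ?_ zero_le_one (by linarith) h1
    · have : (t₁ : ℝ) ≤ t := by exact_mod_cast ht
      linarith
    · rw [hD, one_mul]
      exact max_le_max le_rfl (min_le_left _ _)
  · have h1 := sum_exp_neg_log_level_le d (T + 1 - t₁)
    have h2 : ∀ t ∈ Finset.Ico t₁ (T + 1), Real.exp (-(1 / 20971520) * D t) ≤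
        Real.exp (-(1 / 41943040) * (d + 83886080 * Real.log (1 + ((t : ℝ) - t₁)))) +
        Real.exp (-(1 / 41943040) * (d + δ t)) := fun t _ => by
      rw [hD]; exact exp_neg_max_min_le
    refine (Finset.sum_le_sum h2).trans ?_
    rw [Finset.sum_add_distrib]
    refine add_le_add ?_ (le_of_eq rfl)
    rw [Finset.sum_Ico_eq_sum_range]
    simpa using h1

/-- The failure probability at the logarithmic tail level. -/
lemma measure_not_withinRate_log_le (hX : CovariateAssumption μ X (response X ξ βstar) l L)
    (hξ : NoiseAssumption μ X (response X ξ βstar) ξ σ) (hd : 0 < d)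
    (hCa : 2 ≤ Ca) (hCb : 3 * Ca ^ 2 * (L ^ 2 / l ^ 2) ≤ Cb)
    (hη : ∀ t : ℕ, t₁ ≤ t → η t = (Ca / l) / ((t : ℝ) - t₁ + Cb * d))
    (hd0 : 8 * 83886080 ^ 2 ≤ (d : ℝ)) {C : ℝ}
    (hC : 3355443202 ≤ C) (T : ℕ) {A : Set Ω}
    (hA : A = {ω | ‖sgd X (response X ξ βstar) η β₀ t₁ ω - βstar‖ ^ 2 ≤ σ ^ 2 / L}) :
    μ (A \ {ω | ∀ t, t₁ ≤ t → t ≤ T →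
        WithinRate C Ca Cb l L σ d (max (d : ℝ) (Real.log ((t : ℝ) - t₁)))
        ((t : ℝ) - t₁ + Cb * d)
        (‖sgd X (response X ξ βstar) η β₀ t ω - βstar‖ ^ 2)}) ≤
      ENNReal.ofReal (2 * Real.exp (-(1 / 41943040) * d)) * μ A := by
  have hL := hX.lmax_pos hd
  have hl := hX.lmin_pos
  have hd1 : (1 : ℝ) ≤ d := by exact_mod_cast hd
  have hCb0 : 0 < Cb := lt_of_lt_of_le (by positivity) hCb
  obtain ⟨D, hD⟩ : ∃ D : ℕ → ℝ, ∀ t, D t =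
      max (d : ℝ) (83886080 * Real.log (1 + ((t : ℝ) - t₁))) := ⟨_, fun _ => rfl⟩
  refine (measure_mono (Set.sdiff_subset_sdiff_right fun ω hω t ht htT => ?_)).trans
    (measure_exceedance_log_level_le (D := D) (T := T) (β₀ := β₀) hX hξ hd hCa hCb hη
      (fun t => by rw [hD]; exact le_max_left _ _)
      (fun s t hs hst => by
        rw [hD, hD]
        exact max_le_max le_rfl (log_level_mono hs hst))
      (fun t => (hD t).le) hd0 ?_ hA)
  · have h1 := hω t ht htT
    rw [decayBound] at h1
    -- `K` is twice `83886080`: for `k ≥ 1`, `log (1 + k) ≤ 1 + log k ≤ 2 max d (log k)`.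
    refine withinRate_of_le (K := 167772160) (D' := D t) hl hL (by linarith) hCb0 (by linarith)
      (effective_sample_size_ge ht) (le_max_left _ _) ?_ (by norm_num) (by linarith) h1
    have hm1 := le_max_left (d : ℝ) (Real.log ((t : ℝ) - t₁))
    have hm2 := le_max_right (d : ℝ) (Real.log ((t : ℝ) - t₁))
    rw [hD]
    refine max_le (by linarith) ?_
    -- At `t = t₁` both logarithms are zero, `log 0` by convention, so the level is `d` as intended.
    rcases ht.eq_or_lt with rfl | h
    · simp
    · have h2 : (1 : ℝ) ≤ (t : ℝ) - t₁ := by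
        have : (t₁ : ℝ) + 1 ≤ t := by exact_mod_cast h
        linarith
      have h3 : Real.log (1 + ((t : ℝ) - t₁)) ≤ Real.log 2 + Real.log ((t : ℝ) - t₁) := by
        rw [← Real.log_mul two_ne_zero (by linarith)]
        exact Real.log_le_log (by linarith) (by linarith)
      have h4 : Real.log 2 ≤ 1 := by
        have := Real.log_le_sub_one_of_pos (show (0 : ℝ) < 2 by norm_num)
        linarith
      linarith
  · have h1 := sum_exp_neg_log_level_le d (T - t₁)
    have h2 : ∀ t ∈ Finset.Ico t₁ T, Real.exp (-(1 / 20971520) * D t) ≤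
        Real.exp (-(1 / 41943040) * (d + 83886080 * Real.log (1 + ((t : ℝ) - t₁)))) :=
      fun t _ => by rw [hD]; exact exp_neg_max_le
    refine (Finset.sum_le_sum h2).trans ?_
    rw [Finset.sum_Ico_eq_sum_range]
    simpa using h1

end Horizon

end

/-! ### Assembly of the three parts. -/

theorem mainTheorem5 :
    -- Part 1: constant stepsize, with absolute constants `c₁`, `C₁`.
    (∃ c₁ : ℝ, 0 < c₁ ∧ ∃ C₁ : ℝ, 0 < C₁ ∧
      ∀ (Ω : Type*) (_ : MeasurableSpace Ω) (μ : Measure Ω) (_ : IsProbabilityMeasure μ)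
        (d : ℕ) (X : ℕ → Ω → EuclideanSpace ℝ (Fin d)) (ξ : ℕ → Ω → ℝ)
        (βstar β₀ : EuclideanSpace ℝ (Fin d)) (lmin lmax σ η : ℝ),
        0 < d →
        CovariateAssumption μ X (response X ξ βstar) lmin lmax →
        NoiseAssumption μ X (response X ξ βstar) ξ σ →
        0 < η → η ≤ lmin / (d * lmax ^ 2) →
        (∀ t : ℕ, 1 - ((t : ℝ) + 1) * Real.exp (-c₁ * d) ≤
          μ.real {ω | ‖sgd X (response X ξ βstar) (fun _ => η) β₀ (t + 1) ω - βstar‖ ^ 2 ≤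
            5 * (1 - η * lmin / 2) ^ (t + 1) * ‖β₀ - βstar‖ ^ 2
              + 5 * (lmax / lmin) * η * σ ^ 2 * d}) ∧
        (∀ t₁ : ℕ,
          4 / (η * lmin) * Real.log (‖β₀ - βstar‖ / (Real.sqrt (η * d) * σ)) ≤ (t₁ : ℝ) →
          1 - (t₁ : ℝ) * Real.exp (-c₁ * d) ≤
            μ.real {ω | ‖sgd X (response X ξ βstar) (fun _ => η) β₀ t₁ ω - βstar‖ ^ 2 ≤
              C₁ * (lmax / lmin) * η * σ ^ 2 * d}) ∧
        C₁ * (lmax / lmin) * η * σ ^ 2 * d ≤ C₁ * (σ ^ 2 / lmax)) ∧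
    -- Part 2: decaying stepsize from time `t₁` on, conditionally on a good iterate at time `t₁`;
    -- finite and infinite horizon. The constants depend only on the constant `C₀` that bounds
    -- the tail sequence.
    (∀ C₀ : ℝ, 0 < C₀ → ∃ C : ℝ, 0 < C ∧ ∃ c : ℝ, 0 < c ∧
      ∀ (Ω : Type*) (_ : MeasurableSpace Ω) (μ : Measure Ω) (_ : IsProbabilityMeasure μ)
        (d : ℕ) (X : ℕ → Ω → EuclideanSpace ℝ (Fin d)) (ξ : ℕ → Ω → ℝ)
        (βstar β₀ : EuclideanSpace ℝ (Fin d)) (lmin lmax σ Ca Cb : ℝ) (η δ : ℕ → ℝ) (t₁ : ℕ),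
        0 < d →
        CovariateAssumption μ X (response X ξ βstar) lmin lmax →
        NoiseAssumption μ X (response X ξ βstar) ξ σ →
        2 ≤ Ca → 3 * Ca ^ 2 * (lmax ^ 2 / lmin ^ 2) ≤ Cb →
        (∀ t : ℕ, t₁ ≤ t → η t = (Ca / lmin) / ((t : ℝ) - t₁ + Cb * d)) →
        (∀ t, 0 ≤ δ t) → Monotone δ → (∀ t : ℕ, δ t ≤ C₀ * t / Cb) →
        (∀ T : ℕ, t₁ ≤ T →
          (1 - C * Real.exp (-c * d) - ∑ l ∈ Finset.Icc t₁ T, Real.exp (-c * (d + δ l))) *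
              μ.real {ω | ‖sgd X (response X ξ βstar) η β₀ t₁ ω - βstar‖ ^ 2 ≤ σ ^ 2 / lmax} ≤
            μ.real {ω | ‖sgd X (response X ξ βstar) η β₀ t₁ ω - βstar‖ ^ 2 ≤ σ ^ 2 / lmax ∧
              ∀ t : ℕ, t₁ ≤ t → t ≤ T →
                WithinRate C Ca Cb lmin lmax σ d (max (d : ℝ) (δ (t + 1)))
                  ((t : ℝ) + 1 - t₁ + Cb * d)
                  (‖sgd X (response X ξ βstar) η β₀ (t + 1) ω - βstar‖ ^ 2)}) ∧
        (∀ S : ℝ, HasSum (fun l : ℕ => Real.exp (-c * (d + δ (t₁ + l)))) S →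
          (1 - C * Real.exp (-c * d) - S) *
              μ.real {ω | ‖sgd X (response X ξ βstar) η β₀ t₁ ω - βstar‖ ^ 2 ≤ σ ^ 2 / lmax} ≤
            μ.real {ω | ‖sgd X (response X ξ βstar) η β₀ t₁ ω - βstar‖ ^ 2 ≤ σ ^ 2 / lmax ∧
              ∀ t : ℕ, t₁ ≤ t →
                WithinRate C Ca Cb lmin lmax σ d (max (d : ℝ) (δ (t + 1)))
                  ((t : ℝ) + 1 - t₁ + Cb * d)
                  (‖sgd X (response X ξ βstar) η β₀ (t + 1) ω - βstar‖ ^ 2)})) ∧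
    -- Part 3: logarithmic tail level, all times at once, absolute constants.
    (∃ C : ℝ, 0 < C ∧ ∃ c : ℝ, 0 < c ∧
      ∀ (Ω : Type*) (_ : MeasurableSpace Ω) (μ : Measure Ω) (_ : IsProbabilityMeasure μ)
        (d : ℕ) (X : ℕ → Ω → EuclideanSpace ℝ (Fin d)) (ξ : ℕ → Ω → ℝ)
        (βstar β₀ : EuclideanSpace ℝ (Fin d)) (lmin lmax σ Ca Cb : ℝ) (η : ℕ → ℝ) (t₁ : ℕ),
        0 < d →
        CovariateAssumption μ X (response X ξ βstar) lmin lmax →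
        NoiseAssumption μ X (response X ξ βstar) ξ σ →
        2 ≤ Ca → 3 * Ca ^ 2 * (lmax ^ 2 / lmin ^ 2) ≤ Cb →
        (∀ t : ℕ, t₁ ≤ t → η t = (Ca / lmin) / ((t : ℝ) - t₁ + Cb * d)) →
        (1 - C * Real.exp (-c * d)) *
            μ.real {ω | ‖sgd X (response X ξ βstar) η β₀ t₁ ω - βstar‖ ^ 2 ≤ σ ^ 2 / lmax} ≤
          μ.real {ω | ‖sgd X (response X ξ βstar) η β₀ t₁ ω - βstar‖ ^ 2 ≤ σ ^ 2 / lmax ∧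
            ∀ t : ℕ, t₁ ≤ t →
              WithinRate C Ca Cb lmin lmax σ d (max (d : ℝ) (Real.log ((t : ℝ) - t₁)))
                ((t : ℝ) - t₁ + Cb * d)
                (‖sgd X (response X ξ βstar) η β₀ t ω - βstar‖ ^ 2)}) := by
  obtain ⟨C, hC, hCd⟩ := exists_rate_constant
  have hC0 : 0 < C := by linarith
  refine ⟨⟨1 / 419430400, by norm_num, 10, by norm_num, ?_⟩,
    fun _ _ => ⟨C, hC0, 1 / 41943040, by norm_num, ?_⟩, ⟨C, hC0, 1 / 41943040, by norm_num, ?_⟩⟩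
  · intro Ω _ μ _ d X ξ βstar β₀ l L σ η hd hX hξ hη hη1
    refine ⟨fun t => constant_step hX hξ hd hη hη1 t,
      fun t₁ ht₁ => constant_step_burn_in hX hξ hd hη hη1 t₁ ht₁, ?_⟩
    have hL := hX.lmax_pos hd
    have hl := hX.lmin_pos
    have hd' : (0 : ℝ) < d := by exact_mod_cast hd
    calc 10 * (L / l) * η * σ ^ 2 * d ≤ 10 * (L / l) * (l / (d * L ^ 2)) * σ ^ 2 * d := by gcongr
      _ = 10 * (σ ^ 2 / L) := by field_simp
  · intro Ω _ μ _ d X ξ βstar β₀ l L σ Ca Cb η δ t₁ hd hX hξ hCa hCb hη _ hδ _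
    have hexp : 2 * Real.exp (-(1 / 41943040) * d) ≤ C * Real.exp (-(1 / 41943040) * d) := by
      gcongr
      linarith
    refine ⟨fun T _ => ?_, fun S hS => ?_⟩
    · have hsum : 0 ≤ ∑ t ∈ Finset.Icc t₁ T, Real.exp (-(1 / 41943040) * (d + δ t)) :=
        Finset.sum_nonneg fun _ _ => (Real.exp_pos _).le
      -- Below the threshold `C exp (-c d) ≥ 1`, so the left side is nonpositive.
      rcases lt_or_ge (d : ℝ) (8 * 83886080 ^ 2) with h | h
      · refine le_trans ?_ measureReal_nonneg
        exact mul_nonpos_of_nonpos_of_nonneg (by linarith [hCd d h]) measureReal_nonneg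
      · have key := one_sub_mul_measureReal_le (by positivity)
          (measure_not_withinRate_le (β₀ := β₀) hX hξ hd hCa hCb hη h hδ hC T rfl)
        refine le_trans (mul_le_mul_of_nonneg_right ?_ measureReal_nonneg) key
        linarith
    · have hS0 : 0 ≤ S := hS.nonneg fun _ => (Real.exp_pos _).le
      rcases lt_or_ge (d : ℝ) (8 * 83886080 ^ 2) with h | h
      · refine le_trans ?_ measureReal_nonneg
        exact mul_nonpos_of_nonpos_of_nonneg (by linarith [hCd d h]) measureReal_nonneg
      · have key := one_sub_mul_measureReal_le (x := 2 * Real.exp (-(1 / 41943040) * d) + S)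
          -- Every finite horizon has the same bound, since partial sums stay below `S`; continuity
          -- of the measure along increasing events gives the infinite horizon.
          (by positivity) (measure_sdiff_forall_le fun T _ =>
            (measure_not_withinRate_le (β₀ := β₀) hX hξ hd hCa hCb hη h hδ hC T rfl).trans (by
              gcongr
              have hIcc : Finset.Icc t₁ T = Finset.Ico t₁ (T + 1) := rfl
              rw [hIcc, Finset.sum_Ico_eq_sum_range]
              exact sum_le_hasSum _ (fun _ _ => (Real.exp_pos _).le) hS))
        refine le_trans (mul_le_mul_of_nonneg_right ?_ measureReal_nonneg) key
        linarith
  · intro Ω _ μ _ d X ξ βstar β₀ l L σ Ca Cb η t₁ hd hX hξ hCa hCb hη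
    rcases lt_or_ge (d : ℝ) (8 * 83886080 ^ 2) with h | h
    · refine le_trans ?_ measureReal_nonneg
      exact mul_nonpos_of_nonpos_of_nonneg (by linarith [hCd d h]) measureReal_nonneg
    · have key := one_sub_mul_measureReal_le (by positivity) (measure_sdiff_forall_le fun T _ =>
        measure_not_withinRate_log_le (β₀ := β₀) hX hξ hd hCa hCb hη h hC T rfl)
      refine le_trans (mul_le_mul_of_nonneg_right ?_ measureReal_nonneg) key
      gcongr
      linarith
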